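/- Let $\lambda,\sigma,\rho>0$ and $D=[0,\lambda]\times\mathbb R$. Let $f:\mathbb R\to\mathbb R$ be smooth with $f(0)=f(1)=0$ and, for some constants $M>0$ and $m$, $$0\le f(\theta)\le \theta,\qquad -f''(\theta)\ge M,\qquad -f'(\theta)\le m\qquad\text{for } 0\le \theta\le 1 .$$ Consider a global classical solution of the reactive Boussinesq system $$\partial_t\omega+v\cdot\nabla\omega-\sigma\Delta\omega=\sigma\rho\,\partial_xT,\qquad \partial_tT+v\cdot\nabla T-\Delta T=f(T),$$ $$v=(u,w),\qquad \nabla\cdot v=0,\qquad \omega=\partial_xw-\partial_zu,$$ that is, $T,u,w,\omega$ are functions of $(x,z,t)$ that are continuous for $t\ge 0$ and $C^2$ for $t>0$, are $\lambda$-periodic in $x$, satisfy the equations for $t>0$, and satisfy $T\to1$ as $z\to-\infty$, $T\to0$ as $z\to+\infty$, and $v\to0$, $\omega\to0$ as $|z|\to\infty$, uniformly in $x$ and uniformly for $t$ in bounded intervals. Assume that the initial data $T_0=T(\cdot,0)$, $\omega_0=\omega(\cdot,0)$ are front-like: $0\le T_0\le1$, $\int_D|\omega_0|^2\,dx\,dz<\infty$,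 and $$T_0(x,z)\le e^{\alpha-z},\qquad 1-T_0(x,z)\le e^{\alpha'+\beta z}$$ for some $\alpha,\alpha'\in\mathbb R$ and $\beta>0$. Put $$N(t)=\frac1t\int_0^t\frac1\lambda\int_D|\nabla T|^2\,dx\,dz\,ds,\qquad W(t)=\frac1t\int_0^t\|w(\cdot,s)\|_{L^\infty(D)}\,ds,$$ $$V(t)=\frac1\lambda\int_D\partial_tT\,dx\,dz,\qquad \overline V(t)=\frac1t\int_0^tV(s)\,ds .$$ Then, with an absolute constant $C>0$ (independent of all parameters, of $f$ and of the solution) and with constants $K_1,\dots,K_4$ depending only on $\lambda,\sigma,\rho,f,m,M$ and the initial data $T_0,\omega_0$, one has for all $t>0$ $$N(t)\le \frac{C^2(m+2)^2}{M^2}\rho^2\lambda^5+\frac{4m+6}{M}+\frac{K_1}{\sqrt t}+\frac{K_2}{t},$$ $$W(t)\le \frac{C^2(m+2)}{M}\rho^2\lambda^5+C\sqrt{\frac{4m+6}{M}}\,\rho\lambda^{5/2}+\frac{K_3}{t^{1/4}}+\frac{K_4}{t^{1/2}} .$$ If, moreover, $\partial_tT(\cdot,t)$ is integrable on $D$ for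 every $t>0$, so that $V(t)$ is defined, then $V$ is integrable on $(0,t)$ for every $t>0$ and $$\limsup_{t\to\infty}\overline V(t)\le 2+\frac{C^2(m+2)}{M}\rho^2\lambda^5+C\sqrt{\frac{4m+6}{M}}\,\rho\lambda^{5/2} .$$ -/

import Mathlib

open Set Filter Topology MeasureTheory
open scoped ENNReal

namespace Boussinesq

/-- A time dependent scalar field on the plane; `g t x z` is the value at time `t`, at the point with
horizontal coordinate `x` and vertical coordinate `z`. -/
abbrev ScalarField := ℝ → ℝ → ℝ → ℝ

/-- The partial derivative in time. -/
noncomputable def dt (g : ScalarField) : ScalarField := fun t x z => deriv (fun s => g s x z) t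

/-- The partial derivative in the horizontal variable. -/
noncomputable def dx (g : ScalarField) : ScalarField := fun t x z => deriv (fun y => g t y z) x

/-- The partial derivative in the vertical variable. -/
noncomputable def dz (g : ScalarField) : ScalarField := fun t x z => deriv (fun y => g t x y) z

/-- The Laplacian in the space variables. -/
noncomputable def laplacian (g : ScalarField) : ScalarField :=
  fun t x z => dx (dx g) t x z + dz (dz g) t x z

/-- One period of the strip, `D = [0, L] × ℝ`. -/
def strip (L : ℝ) : Set (ℝ × ℝ) := Icc 0 L ×ˢ univ

/-- A classical regularity class: continuous for `t ≥ 0` and of class `C²` for `t > 0`. -/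
structure IsClassical (g : ScalarField) : Prop where
  continuousOn : ContinuousOn (fun p : ℝ × ℝ × ℝ => g p.1 p.2.1 p.2.2) (Ici 0 ×ˢ univ)
  contDiffOn : ContDiffOn ℝ 2 (fun p : ℝ × ℝ × ℝ => g p.1 p.2.1 p.2.2) (Ioi 0 ×ˢ univ)

/-- Horizontal periodicity with period `L`. -/
def IsPeriodic (L : ℝ) (g : ScalarField) : Prop :=
  ∀ t, 0 ≤ t → ∀ x z, g t (x + L) z = g t x z

/-- `g(t, x, z) → c` as `z` tends to infinity along the filter `l` (`atTop` or `atBot`), uniformly in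
`x` and in `t` on bounded time intervals. -/
def HasVerticalLimit (g : ScalarField) (l : Filter ℝ) (c : ℝ) : Prop :=
  ∀ τ : ℝ, TendstoUniformlyOn (fun (z : ℝ) (p : ℝ × ℝ) => g p.1 p.2 z) (fun _ => c) l
    (Icc 0 τ ×ˢ univ)

/-- Global classical solutions of the nondimensional reactive Boussinesq system in the strip of width
`L`, with Prandtl number `σ`, Rayleigh number `ρ` and reaction term `f`: temperature `T`, velocity
`(u, w)` (`w` is the vertical component) and vorticity `ω`, with front boundary conditions in `z` and
periodic boundary conditions in `x`. -/
structure IsSolution (L σ ρ : ℝ) (f : ℝ → ℝ) (T u w ω : ScalarField) : Prop where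
  classical_T : IsClassical T
  classical_u : IsClassical u
  classical_w : IsClassical w
  classical_ω : IsClassical ω
  periodic_T : IsPeriodic L T
  periodic_u : IsPeriodic L u
  periodic_w : IsPeriodic L w
  periodic_ω : IsPeriodic L ω
  T_bot : HasVerticalLimit T atBot 1
  T_top : HasVerticalLimit T atTop 0
  u_bot : HasVerticalLimit u atBot 0
  u_top : HasVerticalLimit u atTop 0
  w_bot : HasVerticalLimit w atBot 0
  w_top : HasVerticalLimit w atTop 0
  ω_bot : HasVerticalLimit ω atBot 0
  ω_top : HasVerticalLimit ω atTop 0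
  incompressible : ∀ t, 0 < t → ∀ x z, dx u t x z + dz w t x z = 0
  vorticity : ∀ t, 0 < t → ∀ x z, ω t x z = dx w t x z - dz u t x z
  vorticity_eq : ∀ t, 0 < t → ∀ x z,
    dt ω t x z + (u t x z * dx ω t x z + w t x z * dz ω t x z) - σ * laplacian ω t x z
      = σ * ρ * dx T t x z
  temperature_eq : ∀ t, 0 < t → ∀ x z,
    dt T t x z + (u t x z * dx T t x z + w t x z * dz T t x z) - laplacian T t x z
      = f (T t x z)

/-- Concave KPP nonlinearities with constants `m` and `M`. -/
structure IsConcaveKPP (f : ℝ → ℝ) (m M : ℝ) : Prop where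
  smooth : ContDiff ℝ ((⊤ : ℕ∞) : WithTop ℕ∞) f
  zero : f 0 = 0
  one : f 1 = 0
  nonneg : ∀ θ ∈ Icc (0 : ℝ) 1, 0 ≤ f θ
  le_self : ∀ θ ∈ Icc (0 : ℝ) 1, f θ ≤ θ
  M_pos : 0 < M
  concave : ∀ θ ∈ Icc (0 : ℝ) 1, M ≤ -deriv (deriv f) θ
  slope : ∀ θ ∈ Icc (0 : ℝ) 1, -deriv f θ ≤ m

/-- Front-like initial temperatures: between `0` and `1`, at most of size `exp (-z)` at `+∞`, and
tending to `1` at some exponential rate at `-∞`. -/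
structure IsFrontLike (T₀ : ℝ → ℝ → ℝ) : Prop where
  nonneg : ∀ x z, 0 ≤ T₀ x z
  le_one : ∀ x z, T₀ x z ≤ 1
  upper_tail : ∃ α : ℝ, ∀ x z, T₀ x z ≤ Real.exp (α - z)
  lower_tail : ∃ α β : ℝ, 0 < β ∧ ∀ x z, 1 - T₀ x z ≤ Real.exp (α + β * z)

/-- The square of the normalized `L²` norm, `‖g‖² = L⁻¹ ∫_D |g|² dx dz`, in `[0, ∞]`. -/
noncomputable def normSqL2 (L : ℝ) (g : ℝ → ℝ → ℝ) : ℝ≥0∞ :=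
  (ENNReal.ofReal L)⁻¹ * ∫⁻ p in strip L, ENNReal.ofReal (g p.1 p.2 ^ 2)

/-- The time average `N(t)` of `‖∇T(·, s)‖²` (normalized `L²` norm), in `[0, ∞]`. -/
noncomputable def avgGradSq (L : ℝ) (T : ScalarField) (t : ℝ) : ℝ≥0∞ :=
  (ENNReal.ofReal t)⁻¹ * ∫⁻ s in Ioc 0 t, (normSqL2 L (dx T s) + normSqL2 L (dz T s))

/-- The time average `W(t)` of the `L^∞(D)` norm of the vertical velocity, in `[0, ∞]`. -/
noncomputable def avgSup (L : ℝ) (w : ScalarField) (t : ℝ) : ℝ≥0∞ :=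
  (ENNReal.ofReal t)⁻¹ *
    ∫⁻ s in Ioc 0 t, eLpNorm (fun p : ℝ × ℝ => w s p.1 p.2) ∞ (volume.restrict (strip L))

/-- The bulk burning rate `V(t) = L⁻¹ ∫_D ∂T/∂t dx dz`. -/
noncomputable def burningRate (L : ℝ) (T : ScalarField) (t : ℝ) : ℝ :=
  1 / L * ∫ p in strip L, dt T t p.1 p.2

/-- The time average of the bulk burning rate. -/
noncomputable def avgBurningRate (L : ℝ) (T : ScalarField) (t : ℝ) : ℝ :=
  1 / t * ∫ s in (0 : ℝ)..t, burningRate L T s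

end Boussinesq

/-!
The proof is a chain of energy and comparison estimates which closes because the drift
`A(t) = ∫₀ᵗ sup |w|` is controlled by the *square root* of the space-time integral of `|∇T|²`, while
the latter is controlled *linearly* by `A`.  The constant `C = 1` is admissible.

*Comparison.*  The maximum principle (`maximum_principle`) gives `0 ≤ T ≤ 1` and the barriers
`T ≤ exp (α + 2t + A(t) - z)` and `1 - T ≤ exp (α' + βz + β²t + βA(t))`, where `β ≤ 1` without loss of
generality.  So the front moves up by at most `2t + A(t)` and down by at most `t + A(t)`, up to
constants.

*Temperature.*  All integrations by parts are made against vertical cutoffs at height `R`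
(`exists_weak_form`).  The errors vanish as `R → ∞` for every bounded field, merely because the
velocity tends to `0` at both ends, so that no decay of derivatives is needed.  Testing the
temperature equation with `1` bounds `∫∫ f(T)` by the gain of burnt mass,
`L (2t + A(t) + const)`.  Testing it with `f'(T)` and using `-f'' ≥ M`, `-f' ≤ m` yields
`M ∫∫ |∇T|² ≤ ∫ f(T(t)) + m ∫∫ f(T)`, and `f(T) ≤ min (T, 1, m (1 - T))` bounds the first term by
`L (3t + 2A(t) + const)`.  This is `IsFrontSolution.lintegral_gradSq_le`.

*Vorticity.*  In the enstrophy balance functions of `z` may be subtracted from `ω` in its pairing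
with `∂ₓT`, hence `∫∫ (∂ₓω)² ≤ σ⁻¹ ∫ ω₀² + ρ² L² ∫∫ (∂ₓT)²`
(`IsSolution.lintegral_dx_vorticity_le`).

*Velocity.*  The vertical velocity has horizontal mean zero and solves `Δw = ∂ₓω`.  As `w` is only
`C²`, the estimate of its second derivatives is replaced by a one-dimensional argument: the function
`P(z) = ∫ (w(x + ε, z) - w(x, z))² dx` satisfies `P'' ≥ L⁻² P - ε² ∫ (∂ₓω)² dx` and vanishes at both
ends, so `P ≤ L ε² ∫∫ (∂ₓω)²`.  With `ε → 0` and the one-dimensional Poincaré inequality,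
`sup |w|² ≤ L² ∫∫ (∂ₓω)²` (`IsSolution.sq_w_le`).

Young's inequality resolves the two coupled inequalities (`coupled_bounds`).  Finally the bulk burning
rate equals `L⁻¹ ∫ f(T)` (`IsFrontSolution.burningRate_eq`), so that its time average is at most
`2 + A(t)/t + const/t`.
-/

namespace Boussinesq

/-! ### Calculus of classical fields -/

/-- A field that is of class `C^n` for positive times. -/
def IsSmoothField (n : WithTop ℕ∞) (g : ScalarField) : Prop :=
  ContDiffOn ℝ n (fun p : ℝ × ℝ × ℝ => g p.1 p.2.1 p.2.2) (Ioi 0 ×ˢ univ)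

section Smooth

variable {n : WithTop ℕ∞} {g h : ScalarField} {t : ℝ}

lemma isOpen_posTimes : IsOpen (Ioi (0 : ℝ) ×ˢ (univ : Set (ℝ × ℝ))) := isOpen_Ioi.prod isOpen_univ

lemma IsSmoothField.contDiffAt (hg : IsSmoothField n g) (ht : 0 < t) (x z : ℝ) :
    ContDiffAt ℝ n (fun p : ℝ × ℝ × ℝ => g p.1 p.2.1 p.2.2) (t, x, z) :=
  ContDiffOn.contDiffAt hg (isOpen_posTimes.mem_nhds ⟨ht, mem_univ _⟩)

lemma IsSmoothField.hasFDerivAt (hg : IsSmoothField n g) (hn : n ≠ 0) (ht : 0 < t) (x z : ℝ) :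
    HasFDerivAt (fun p : ℝ × ℝ × ℝ => g p.1 p.2.1 p.2.2)
      (fderiv ℝ (fun p : ℝ × ℝ × ℝ => g p.1 p.2.1 p.2.2) (t, x, z)) (t, x, z) :=
  ((hg.contDiffAt ht x z).differentiableAt hn).hasFDerivAt

lemma IsSmoothField.hasDerivAt_dt_fderiv (hg : IsSmoothField n g) (hn : n ≠ 0) (ht : 0 < t)
    (x z : ℝ) : HasDerivAt (fun s => g s x z)
      (fderiv ℝ (fun p : ℝ × ℝ × ℝ => g p.1 p.2.1 p.2.2) (t, x, z) (1, 0, 0)) t := by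
  have h1 : HasDerivAt (fun s : ℝ => ((s, x, z) : ℝ × ℝ × ℝ)) (1, 0, 0) t :=
    (hasDerivAt_id t).prodMk (hasDerivAt_const t (x, z))
  exact (hg.hasFDerivAt hn ht x z).comp_hasDerivAt t h1

lemma IsSmoothField.hasDerivAt_dx_fderiv (hg : IsSmoothField n g) (hn : n ≠ 0) (ht : 0 < t)
    (x z : ℝ) : HasDerivAt (fun y => g t y z)
      (fderiv ℝ (fun p : ℝ × ℝ × ℝ => g p.1 p.2.1 p.2.2) (t, x, z) (0, 1, 0)) x := by
  have h1 : HasDerivAt (fun s : ℝ => ((t, s, z) : ℝ × ℝ × ℝ)) (0, 1, 0) x :=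
    (hasDerivAt_const x t).prodMk ((hasDerivAt_id x).prodMk (hasDerivAt_const x z))
  exact (hg.hasFDerivAt hn ht x z).comp_hasDerivAt x h1

lemma IsSmoothField.hasDerivAt_dz_fderiv (hg : IsSmoothField n g) (hn : n ≠ 0) (ht : 0 < t)
    (x z : ℝ) : HasDerivAt (fun y => g t x y)
      (fderiv ℝ (fun p : ℝ × ℝ × ℝ => g p.1 p.2.1 p.2.2) (t, x, z) (0, 0, 1)) z := by
  have h1 : HasDerivAt (fun s : ℝ => ((t, x, s) : ℝ × ℝ × ℝ)) (0, 0, 1) z :=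
    (hasDerivAt_const z t).prodMk ((hasDerivAt_const z x).prodMk (hasDerivAt_id z))
  exact (hg.hasFDerivAt hn ht x z).comp_hasDerivAt z h1

lemma IsSmoothField.dt_eq_fderiv (hg : IsSmoothField n g) (hn : n ≠ 0) (ht : 0 < t) (x z : ℝ) :
    dt g t x z = fderiv ℝ (fun p : ℝ × ℝ × ℝ => g p.1 p.2.1 p.2.2) (t, x, z) (1, 0, 0) :=
  (hg.hasDerivAt_dt_fderiv hn ht x z).deriv

lemma IsSmoothField.dx_eq_fderiv (hg : IsSmoothField n g) (hn : n ≠ 0) (ht : 0 < t) (x z : ℝ) :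
    dx g t x z = fderiv ℝ (fun p : ℝ × ℝ × ℝ => g p.1 p.2.1 p.2.2) (t, x, z) (0, 1, 0) :=
  (hg.hasDerivAt_dx_fderiv hn ht x z).deriv

lemma IsSmoothField.dz_eq_fderiv (hg : IsSmoothField n g) (hn : n ≠ 0) (ht : 0 < t) (x z : ℝ) :
    dz g t x z = fderiv ℝ (fun p : ℝ × ℝ × ℝ => g p.1 p.2.1 p.2.2) (t, x, z) (0, 0, 1) :=
  (hg.hasDerivAt_dz_fderiv hn ht x z).deriv

lemma IsSmoothField.hasDerivAt_dt (hg : IsSmoothField n g) (hn : n ≠ 0) (ht : 0 < t) (x z : ℝ) :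
    HasDerivAt (fun s => g s x z) (dt g t x z) t :=
  (hg.hasDerivAt_dt_fderiv hn ht x z).differentiableAt.hasDerivAt

lemma IsSmoothField.hasDerivAt_dx (hg : IsSmoothField n g) (hn : n ≠ 0) (ht : 0 < t) (x z : ℝ) :
    HasDerivAt (fun y => g t y z) (dx g t x z) x :=
  (hg.hasDerivAt_dx_fderiv hn ht x z).differentiableAt.hasDerivAt

lemma IsSmoothField.hasDerivAt_dz (hg : IsSmoothField n g) (hn : n ≠ 0) (ht : 0 < t) (x z : ℝ) :
    HasDerivAt (fun y => g t x y) (dz g t x z) z :=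
  (hg.hasDerivAt_dz_fderiv hn ht x z).differentiableAt.hasDerivAt

lemma IsSmoothField.of_fderiv_apply (hg : IsSmoothField (n + 1) g) (v : ℝ × ℝ × ℝ)
    (hh : ∀ t, 0 < t → ∀ x z,
      h t x z = fderiv ℝ (fun p : ℝ × ℝ × ℝ => g p.1 p.2.1 p.2.2) (t, x, z) v) :
    IsSmoothField n h := by
  have h1 := ContDiffOn.fderiv_of_isOpen (m := n) hg isOpen_posTimes le_rfl
  refine (h1.clm_apply contDiffOn_const (g := fun _ => v)).congr ?_
  rintro ⟨t, x, z⟩ ⟨ht, -⟩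
  exact hh t ht x z

lemma IsSmoothField.dt (hg : IsSmoothField (n + 1) g) : IsSmoothField n (dt g) :=
  hg.of_fderiv_apply (1, 0, 0) fun _ ht x z => hg.dt_eq_fderiv (by simp) ht x z

lemma IsSmoothField.dx (hg : IsSmoothField (n + 1) g) : IsSmoothField n (dx g) :=
  hg.of_fderiv_apply (0, 1, 0) fun _ ht x z => hg.dx_eq_fderiv (by simp) ht x z

lemma IsSmoothField.dz (hg : IsSmoothField (n + 1) g) : IsSmoothField n (dz g) :=
  hg.of_fderiv_apply (0, 0, 1) fun _ ht x z => hg.dz_eq_fderiv (by simp) ht x z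

/-- Time slices are smooth functions on the plane. -/
lemma IsSmoothField.slice (hg : IsSmoothField n g) (ht : 0 < t) :
    ContDiff ℝ n (fun p : ℝ × ℝ => g t p.1 p.2) := by
  rw [contDiff_iff_contDiffAt]
  rintro ⟨x, z⟩
  exact (hg.contDiffAt ht x z).comp (x, z) (f := fun p : ℝ × ℝ => ((t, p) : ℝ × ℝ × ℝ))
    (contDiffAt_const.prodMk contDiffAt_id)

lemma IsSmoothField.continuousOn (hg : IsSmoothField n g) :
    ContinuousOn (fun p : ℝ × ℝ × ℝ => g p.1 p.2.1 p.2.2) (Ioi 0 ×ˢ univ) :=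
  ContDiffOn.continuousOn hg

lemma IsSmoothField.mono {m : WithTop ℕ∞} (hg : IsSmoothField n g) (h : m ≤ n) :
    IsSmoothField m g := ContDiffOn.of_le hg h

lemma IsClassical.smooth (hg : IsClassical g) : IsSmoothField 2 g := hg.contDiffOn

lemma IsClassical.smooth_dt (hg : IsClassical g) : IsSmoothField 1 (Boussinesq.dt g) :=
  IsSmoothField.dt (n := 1) hg.contDiffOn

lemma IsClassical.smooth_dx (hg : IsClassical g) : IsSmoothField 1 (Boussinesq.dx g) :=
  IsSmoothField.dx (n := 1) hg.contDiffOn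

lemma IsClassical.smooth_dz (hg : IsClassical g) : IsSmoothField 1 (Boussinesq.dz g) :=
  IsSmoothField.dz (n := 1) hg.contDiffOn

/-- Mixed partial derivatives commute. -/
lemma IsClassical.dx_dz_comm (hg : IsClassical g) (ht : 0 < t) (x z : ℝ) :
    Boussinesq.dx (Boussinesq.dz g) t x z = Boussinesq.dz (Boussinesq.dx g) t x z := by
  have key : ∀ (v e : ℝ × ℝ × ℝ) (h : ScalarField), IsSmoothField 1 h → (∀ t, 0 < t → ∀ x z,
      h t x z = fderiv ℝ (fun p : ℝ × ℝ × ℝ => g p.1 p.2.1 p.2.2) (t, x, z) v) →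
      fderiv ℝ (fun p : ℝ × ℝ × ℝ => h p.1 p.2.1 p.2.2) (t, x, z) e =
      fderiv ℝ (fderiv ℝ (fun p : ℝ × ℝ × ℝ => g p.1 p.2.1 p.2.2)) (t, x, z) e v := by
    intro v e h hh hv
    have h1 : (fun p : ℝ × ℝ × ℝ => h p.1 p.2.1 p.2.2) =ᶠ[𝓝 (t, x, z)]
        fun p => fderiv ℝ (fun p : ℝ × ℝ × ℝ => g p.1 p.2.1 p.2.2) p v := by
      filter_upwards [isOpen_posTimes.mem_nhds (show (t, x, z) ∈ _ from ⟨ht, mem_univ _⟩)] with p hp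
      exact hv p.1 hp.1 p.2.1 p.2.2
    rw [h1.fderiv_eq]
    have h2 : DifferentiableAt ℝ (fderiv ℝ (fun p : ℝ × ℝ × ℝ => g p.1 p.2.1 p.2.2)) (t, x, z) :=
      ((hg.smooth.contDiffAt ht x z).fderiv_right (m := 1) (by norm_num)).differentiableAt
        (by norm_num)
    rw [fderiv_clm_apply h2 (differentiableAt_const _)]
    simp
  have hs : IsSymmSndFDerivAt ℝ (fun p : ℝ × ℝ × ℝ => g p.1 p.2.1 p.2.2) (t, x, z) :=
    (hg.smooth.contDiffAt ht x z).isSymmSndFDerivAt (by simp)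
  rw [hg.smooth_dz.dx_eq_fderiv (by norm_num) ht, hg.smooth_dx.dz_eq_fderiv (by norm_num) ht,
    key (0, 0, 1) (0, 1, 0) _ hg.smooth_dz
      (fun t ht x z => hg.smooth.dz_eq_fderiv (by norm_num) ht x z),
    key (0, 1, 0) (0, 0, 1) _ hg.smooth_dx
      (fun t ht x z => hg.smooth.dx_eq_fderiv (by norm_num) ht x z)]
  exact hs _ _

end Smooth

/-! ### Integrals over the strip -/

lemma measurableSet_strip (L : ℝ) : MeasurableSet (strip L) :=
  measurableSet_Icc.prod MeasurableSet.univ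

lemma volume_restrict_strip (L : ℝ) : (volume : Measure (ℝ × ℝ)).restrict (strip L) =
    (volume.restrict (Icc 0 L)).prod (volume : Measure ℝ) := by
  rw [strip, Measure.volume_eq_prod, ← Measure.prod_restrict, Measure.restrict_univ]

/-- A continuous function on the plane which vanishes for large `|z|` is integrable on the strip. -/
lemma integrableOn_strip_of_vanish {L b : ℝ} {F : ℝ × ℝ → ℝ} (hF : Continuous F)
    (hb : ∀ p : ℝ × ℝ, b ≤ |p.2| → F p = 0) : IntegrableOn F (strip L) := by
  have h1 : IntegrableOn F (Icc (0, -b) (L, b)) := hF.continuousOn.integrableOn_compact isCompact_Icc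
  refine h1.of_forall_sdiff_eq_zero (measurableSet_strip L) ?_
  rintro ⟨x, z⟩ ⟨⟨hx, -⟩, hp⟩
  apply hb
  by_contra! hz
  rw [abs_lt] at hz
  exact hp ⟨⟨hx.1, hz.1.le⟩, hx.2, hz.2.le⟩

lemma setIntegral_strip_eq_box {L b : ℝ} {F : ℝ × ℝ → ℝ}
    (hb : ∀ p : ℝ × ℝ, b ≤ |p.2| → F p = 0) :
    ∫ p in strip L, F p = ∫ p in Icc (0, -b) (L, b), F p := by
  refine setIntegral_eq_of_subset_of_forall_sdiff_eq_zero (measurableSet_strip L) ?_ ?_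
  · rintro ⟨x, z⟩ ⟨h1, h2⟩
    exact ⟨⟨h1.1, h2.1⟩, mem_univ _⟩
  · rintro ⟨x, z⟩ ⟨⟨hx, -⟩, hp⟩
    apply hb
    by_contra! hz
    rw [abs_lt] at hz
    exact hp ⟨⟨hx.1, hz.1.le⟩, hx.2, hz.2.le⟩

/-- The divergence theorem in one period of the strip for vertically compactly supported fluxes. -/
lemma setIntegral_strip_div_eq_zero {L b : ℝ} (hL : 0 < L) {F G Fx Gz : ℝ × ℝ → ℝ}
    (hF : ContDiff ℝ 1 F) (hG : ContDiff ℝ 1 G)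
    (hFx : ∀ p : ℝ × ℝ, HasDerivAt (fun y => F (y, p.2)) (Fx p) p.1)
    (hGz : ∀ p : ℝ × ℝ, HasDerivAt (fun y => G (p.1, y)) (Gz p) p.2)
    (hper : ∀ z, F (L, z) = F (0, z)) (hb : 0 ≤ b)
    (hFb : ∀ p : ℝ × ℝ, b ≤ |p.2| → Fx p = 0) (hGb : ∀ p : ℝ × ℝ, b ≤ |p.2| → G p = 0)
    (hGb' : ∀ p : ℝ × ℝ, b ≤ |p.2| → Gz p = 0) :
    ∫ p in strip L, (Fx p + Gz p) = 0 := by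
  have eF : ∀ p, Fx p = fderiv ℝ F p (1, 0) := fun p => by
    have h1 : HasDerivAt (fun s : ℝ => ((s, p.2) : ℝ × ℝ)) (1, 0) p.1 :=
      (hasDerivAt_id p.1).prodMk (hasDerivAt_const p.1 p.2)
    exact (hFx p).unique (((hF.differentiable (by norm_num)) p).hasFDerivAt.comp_hasDerivAt p.1 h1)
  have eG : ∀ p, Gz p = fderiv ℝ G p (0, 1) := fun p => by
    have h1 : HasDerivAt (fun s : ℝ => ((p.1, s) : ℝ × ℝ)) (0, 1) p.2 :=
      (hasDerivAt_const p.2 p.1).prodMk (hasDerivAt_id p.2)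
    exact (hGz p).unique (((hG.differentiable (by norm_num)) p).hasFDerivAt.comp_hasDerivAt p.2 h1)
  rw [setIntegral_strip_eq_box (b := b) (fun p hp => by rw [hFb p hp, hGb' p hp, add_zero])]
  simp_rw [eF, eG]
  have cF : Continuous fun p => fderiv ℝ F p (1, 0) :=
    (hF.continuous_fderiv (by norm_num)).clm_apply continuous_const
  have cG : Continuous fun p => fderiv ℝ G p (0, 1) :=
    (hG.continuous_fderiv (by norm_num)).clm_apply continuous_const
  rw [integral_divergence_prod_Icc_of_hasFDerivAt_of_le F G (fderiv ℝ F) (fderiv ℝ G) (0, -b) (L, b)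
    ⟨hL.le, by simpa using hb⟩ hF.continuous.continuousOn hG.continuous.continuousOn
    (fun p _ => ((hF.differentiable (by norm_num)) p).hasFDerivAt)
    (fun p _ => ((hG.differentiable (by norm_num)) p).hasFDerivAt)
    ((cF.add cG).continuousOn.integrableOn_compact isCompact_Icc)]
  have g1 : ∀ x, G (x, b) = 0 := fun x => hGb (x, b) (le_abs_self b)
  have g2 : ∀ x, G (x, -b) = 0 := fun x => hGb (x, -b) (by simpa using le_abs_self b)
  simp [g1, g2, hper]

/-! ### Uniform control of fields with vertical limits -/

section Uniform

variable {L τ c c' : ℝ} {g : ScalarField}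

lemma HasVerticalLimit.exists_top (h : HasVerticalLimit g atTop c) (τ : ℝ) {ε : ℝ} (hε : 0 < ε) :
    ∃ Z, ∀ z, Z ≤ z → ∀ t ∈ Icc 0 τ, ∀ x, |g t x z - c| < ε := by
  obtain ⟨Z, hZ⟩ := eventually_atTop.1 (Metric.tendstoUniformlyOn_iff.1 (h τ) ε hε)
  refine ⟨Z, fun z hz t ht x => ?_⟩
  have := hZ z hz (t, x) ⟨ht, mem_univ _⟩
  rwa [dist_comm, Real.dist_eq] at this

lemma HasVerticalLimit.exists_bot (h : HasVerticalLimit g atBot c) (τ : ℝ) {ε : ℝ} (hε : 0 < ε) :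
    ∃ Z, ∀ z, z ≤ Z → ∀ t ∈ Icc 0 τ, ∀ x, |g t x z - c| < ε := by
  obtain ⟨Z, hZ⟩ := eventually_atBot.1 (Metric.tendstoUniformlyOn_iff.1 (h τ) ε hε)
  refine ⟨Z, fun z hz t ht x => ?_⟩
  have := hZ z hz (t, x) ⟨ht, mem_univ _⟩
  rwa [dist_comm, Real.dist_eq] at this

/-- A field that tends to `0` at both ends is uniformly small for large `|z|`. -/
lemma HasVerticalLimit.exists_abs (h : HasVerticalLimit g atBot 0) (h' : HasVerticalLimit g atTop 0)
    (τ : ℝ) {ε : ℝ} (hε : 0 < ε) :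
    ∃ Z, 0 < Z ∧ ∀ z, Z ≤ |z| → ∀ t ∈ Icc 0 τ, ∀ x, |g t x z| < ε := by
  obtain ⟨Z, hZ⟩ := h.exists_bot τ hε
  obtain ⟨Z', hZ'⟩ := h'.exists_top τ hε
  refine ⟨max 1 (max (-Z) Z'), by positivity, fun z hz t ht x => ?_⟩
  have h1 : -Z ≤ |z| := le_trans ((le_max_left _ _).trans (le_max_right _ _)) hz
  have h2 : Z' ≤ |z| := le_trans ((le_max_right _ _).trans (le_max_right _ _)) hz
  rcases le_total 0 z with h0 | h0
  · rw [abs_of_nonneg h0] at h2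
    simpa using hZ' z h2 t ht x
  · rw [abs_of_nonpos h0] at h1
    simpa using hZ z (by linarith) t ht x

lemma IsPeriodic.exists_mem_Icc (hL : 0 < L) (hg : IsPeriodic L g) {t : ℝ} (ht : 0 ≤ t) (x z : ℝ) :
    ∃ y ∈ Icc 0 L, g t x z = g t y z := by
  have h : Function.Periodic (fun x => g t x z) L := fun x => hg t ht x z
  obtain ⟨y, hy, h2⟩ := h.exists_mem_Ico₀ hL x
  exact ⟨y, Ico_subset_Icc_self hy, h2⟩

/-- Fields with vertical limits are bounded on bounded time intervals. -/
lemma exists_bound (hL : 0 < L)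
    (hc : ContinuousOn (fun p : ℝ × ℝ × ℝ => g p.1 p.2.1 p.2.2) (Ici 0 ×ˢ univ))
    (hp : IsPeriodic L g) (hb : HasVerticalLimit g atBot c) (ht : HasVerticalLimit g atTop c')
    (τ : ℝ) : ∃ B, 0 < B ∧ ∀ t ∈ Icc 0 τ, ∀ x z, |g t x z| ≤ B := by
  obtain ⟨Z, hZ⟩ := hb.exists_bot τ one_pos
  obtain ⟨Z', hZ'⟩ := ht.exists_top τ one_pos
  have hK : IsCompact (Icc 0 τ ×ˢ (Icc 0 L ×ˢ Icc Z Z')) :=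
    isCompact_Icc.prod (isCompact_Icc.prod isCompact_Icc)
  obtain ⟨B, hB⟩ := hK.exists_bound_of_continuousOn
    (hc.mono (fun p hp => ⟨hp.1.1, mem_univ _⟩))
  refine ⟨max 1 (max B (max (|c| + 1) (|c'| + 1))), by positivity, fun t ht x z => ?_⟩
  by_cases h1 : z ≤ Z
  · have h3 := hZ z h1 t ht x
    have h2 : |g t x z| ≤ |c| + 1 := by
      have := abs_sub_abs_le_abs_sub (g t x z) c
      linarith
    exact h2.trans (by simp)
  by_cases h1' : Z' ≤ z
  · have h3 := hZ' z h1' t ht x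
    have h2 : |g t x z| ≤ |c'| + 1 := by
      have := abs_sub_abs_le_abs_sub (g t x z) c'
      linarith
    exact h2.trans (by simp)
  obtain ⟨y, hy, h2⟩ := hp.exists_mem_Icc hL ht.1 x z
  have h3 := hB (t, y, z) ⟨ht, hy, (not_le.1 h1).le, (not_le.1 h1').le⟩
  rw [h2]
  exact (show |g t y z| ≤ B from h3).trans (by simp)

/-- The supremum over space of `|w|`; negative times are projected to `0`, which makes it a function
on the whole line. -/
noncomputable def supNorm (w : ScalarField) (t : ℝ) : ℝ := ⨆ p : ℝ × ℝ, |w (max t 0) p.1 p.2|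

/-- What is needed of a velocity component: a continuous periodic field tending to `0` at both ends
of the strip. -/
structure IsDecaying (L : ℝ) (w : ScalarField) : Prop where
  cont : ContinuousOn (fun p : ℝ × ℝ × ℝ => w p.1 p.2.1 p.2.2) (Ici 0 ×ˢ univ)
  periodic : IsPeriodic L w
  bot : HasVerticalLimit w atBot 0
  top : HasVerticalLimit w atTop 0

lemma IsDecaying.exists_bound {w : ScalarField} (hL : 0 < L) (hw : IsDecaying L w) (τ : ℝ) :
    ∃ B, 0 < B ∧ ∀ t ∈ Icc 0 τ, ∀ x z, |w t x z| ≤ B :=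
  Boussinesq.exists_bound hL hw.cont hw.periodic hw.bot hw.top τ

lemma IsDecaying.bddAbove {w : ScalarField} (hL : 0 < L) (hw : IsDecaying L w) {t : ℝ}
    (ht : 0 ≤ t) : BddAbove (range fun p : ℝ × ℝ => |w t p.1 p.2|) := by
  obtain ⟨B, -, hB⟩ := hw.exists_bound hL t
  exact ⟨B, by rintro _ ⟨p, rfl⟩; exact hB t ⟨ht, le_rfl⟩ p.1 p.2⟩

lemma IsDecaying.abs_le_supNorm {w : ScalarField} (hL : 0 < L) (hw : IsDecaying L w) {t : ℝ}
    (ht : 0 ≤ t) (x z : ℝ) : |w t x z| ≤ supNorm w t := by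
  have := le_ciSup (hw.bddAbove hL ht) (x, z)
  simpa [supNorm, max_eq_left ht] using this

lemma supNorm_le {w : ScalarField} {t B : ℝ} (ht : 0 ≤ t) (hB : ∀ x z, |w t x z| ≤ B) :
    supNorm w t ≤ B :=
  ciSup_le fun p => by rw [max_eq_left ht]; exact hB p.1 p.2

lemma supNorm_nonneg (w : ScalarField) (t : ℝ) : 0 ≤ supNorm w t :=
  Real.iSup_nonneg fun _ => abs_nonneg _

/-- Decaying fields are continuous in time uniformly in space. -/
lemma IsDecaying.exists_uniform {w : ScalarField} (hL : 0 < L) (hw : IsDecaying L w) {t₀ : ℝ}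
    (ht₀ : 0 ≤ t₀) {ε : ℝ} (hε : 0 < ε) : ∃ δ > 0, ∀ t, 0 ≤ t → |t - t₀| < δ →
      ∀ x z, |w t x z - w t₀ x z| ≤ ε := by
  obtain ⟨Z, hZ, hZw⟩ := hw.bot.exists_abs hw.top (t₀ + 1) (half_pos hε)
  have hK : IsCompact (Icc 0 (t₀ + 1) ×ˢ (Icc 0 L ×ˢ Icc (-Z) Z)) :=
    isCompact_Icc.prod (isCompact_Icc.prod isCompact_Icc)
  have hu := hK.uniformContinuousOn_of_continuous
    (hw.cont.mono (fun p hp => ⟨hp.1.1, mem_univ _⟩))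
  obtain ⟨δ, hδ, hd⟩ := Metric.uniformContinuousOn_iff_le.1 hu ε hε
  refine ⟨min δ 1, by positivity, fun t ht htd x z => ?_⟩
  have h1 : |t - t₀| < 1 := htd.trans_le (min_le_right _ _)
  have htI : t ∈ Icc 0 (t₀ + 1) := ⟨ht, by linarith [abs_lt.1 h1]⟩
  have ht₀I : t₀ ∈ Icc 0 (t₀ + 1) := ⟨ht₀, by linarith⟩
  by_cases hz : Z ≤ |z|
  · have a1 := hZw z hz t htI x
    have a2 := hZw z hz t₀ ht₀I x
    have := abs_sub (w t x z) (w t₀ x z)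
    linarith
  · have hz' := abs_lt.1 (not_le.1 hz)
    have hper : Function.Periodic (fun x => (w t x z, w t₀ x z)) L := fun x =>
      Prod.ext (hw.periodic t ht x z) (hw.periodic t₀ ht₀ x z)
    obtain ⟨y, hy, h2⟩ := hper.exists_mem_Ico₀ hL x
    simp only [Prod.mk.injEq] at h2
    rw [h2.1, h2.2]
    have := hd (t, y, z) ⟨htI, Ico_subset_Icc_self hy, hz'.1.le, hz'.2.le⟩ (t₀, y, z)
      ⟨ht₀I, Ico_subset_Icc_self hy, hz'.1.le, hz'.2.le⟩ (by
        rw [Prod.dist_eq, dist_self, Real.dist_eq, max_eq_left (abs_nonneg _)]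
        exact htd.le.trans (min_le_left _ _))
    exact this

lemma IsDecaying.continuous_supNorm {w : ScalarField} (hL : 0 < L) (hw : IsDecaying L w) :
    Continuous (supNorm w) := by
  rw [Metric.continuous_iff]
  intro t₀ ε hε
  obtain ⟨δ, hδ, hd⟩ := hw.exists_uniform hL (le_max_right t₀ 0) (half_pos hε)
  refine ⟨δ, hδ, fun t ht => ?_⟩
  have hmax : |max t 0 - max t₀ 0| < δ :=
    (abs_max_sub_max_le_abs t t₀ 0).trans_lt (by rwa [Real.dist_eq] at ht)
  have hdd := hd (max t 0) (le_max_right _ _) hmax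
  have e : ∀ s, supNorm w s = supNorm w (max s 0) := fun s => by simp [supNorm]
  have key : ∀ a b : ℝ, 0 ≤ a → 0 ≤ b → (∀ x z, |w a x z - w b x z| ≤ ε / 2) →
      supNorm w a ≤ supNorm w b + ε / 2 := fun a b ha hb hab =>
    supNorm_le ha fun x z => by
      have h1 := hw.abs_le_supNorm hL hb x z
      have h2 := hab x z
      have := abs_sub_abs_le_abs_sub (w a x z) (w b x z)
      linarith
  have k1 := key _ _ (le_max_right t 0) (le_max_right t₀ 0) hdd
  have k2 := key _ _ (le_max_right t₀ 0) (le_max_right t 0)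
    (fun x z => by rw [abs_sub_comm]; exact hdd x z)
  rw [Real.dist_eq, e t, e t₀, abs_lt]
  constructor <;> linarith

end Uniform

/-! ### The maximum principle -/

lemma deriv_nonneg_of_left_max {φ : ℝ → ℝ} {d t : ℝ} (ht : 0 < t) (hd : HasDerivAt φ d t)
    (hmax : ∀ s ∈ Icc 0 t, φ s ≤ φ t) : 0 ≤ d := by
  have h1 : Tendsto (slope φ t) (𝓝[<] t) (𝓝 d) :=
    (hasDerivAt_iff_tendsto_slope.1 hd).mono_left
      (nhdsWithin_mono _ fun s (hs : s < t) => hs.ne)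
  refine ge_of_tendsto h1 ?_
  filter_upwards [Ioo_mem_nhdsLT ht] with s hs
  rw [slope_def_field]
  exact div_nonneg_of_nonpos (by linarith [hmax s ⟨hs.1.le, hs.2.le⟩]) (by linarith [hs.2])

/-- At a global maximum the second derivative is nonpositive; where it does not exist `deriv` takes
the value `0`, so that no differentiability is needed. -/
lemma deriv_deriv_nonpos_of_max {φ : ℝ → ℝ} {x : ℝ} (hc : ContinuousAt φ x)
    (hmax : ∀ y, φ y ≤ φ x) : deriv (deriv φ) x ≤ 0 := by
  by_contra! h
  have h0 : deriv φ x = 0 := IsLocalMax.deriv_eq_zero (Eventually.of_forall hmax)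
  have h1 := isLocalMin_of_deriv_deriv_pos h h0 hc
  have h2 : φ =ᶠ[𝓝 x] fun _ => φ x := by
    filter_upwards [h1] with y hy using le_antisymm (hmax y) hy
  have h3 : deriv (deriv φ) x = 0 := by
    rw [h2.deriv.deriv_eq]
    simp
  linarith

/-- The weak maximum principle for subsolutions that are positive at most in a bounded part of the
strip, up to arbitrarily small errors. The differential inequality is only required where the
function is positive. -/
theorem maximum_principle {L τ k : ℝ} (hL : 0 < L) {u w g : ScalarField}
    (hc : ContinuousOn (fun p : ℝ × ℝ × ℝ => g p.1 p.2.1 p.2.2) (Ici 0 ×ˢ univ))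
    (hper : IsPeriodic L g)
    (htail : ∀ ε > 0, ∃ Z, ∀ t ∈ Icc 0 τ, ∀ x z, Z ≤ |z| → g t x z ≤ ε)
    (hinit : ∀ x z, g 0 x z ≤ 0)
    (hdiff : ∀ t ∈ Ioc 0 τ, ∀ x z, DifferentiableAt ℝ (fun s => g s x z) t)
    (heq : ∀ t ∈ Ioc 0 τ, ∀ x z, 0 < g t x z →
      dt g t x z + (u t x z * dx g t x z + w t x z * dz g t x z) - laplacian g t x z
        ≤ k * g t x z) :
    ∀ t ∈ Icc 0 τ, ∀ x z, g t x z ≤ 0 := by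
  intro t₁ ht₁ x₁ z₁
  by_contra! hpos
  set K := |k| + 1 with hK
  have hK0 : 0 < K := by positivity
  set a := g t₁ x₁ z₁ with ha
  set h : ℝ × ℝ × ℝ → ℝ := fun p => Real.exp (-(K * p.1)) * g p.1 p.2.1 p.2.2 with hh
  have hτ : 0 ≤ τ := ht₁.1.trans ht₁.2
  obtain ⟨Z, hZ⟩ := htail (a * Real.exp (-(K * τ)) / 2) (by positivity)
  set Z' := max Z (|z₁|) with hZ'
  have hKc : IsCompact (Icc 0 τ ×ˢ (Icc 0 L ×ˢ Icc (-Z') Z')) :=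
    isCompact_Icc.prod (isCompact_Icc.prod isCompact_Icc)
  have hhc : ContinuousOn h (Icc 0 τ ×ˢ (Icc 0 L ×ˢ Icc (-Z') Z')) := by
    refine ContinuousOn.mul (by fun_prop) (hc.mono fun p hp => ⟨hp.1.1, mem_univ _⟩)
  have hz₁ : z₁ ∈ Icc (-Z') Z' := abs_le.1 (le_max_right _ _)
  obtain ⟨y₁, hy₁, hxy⟩ := hper.exists_mem_Icc hL ht₁.1 x₁ z₁
  have hmem : (t₁, y₁, z₁) ∈ (Icc 0 τ ×ˢ (Icc 0 L ×ˢ Icc (-Z') Z')) := ⟨ht₁, hy₁, hz₁⟩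
  obtain ⟨⟨t, x, z⟩, ⟨ht, hx, hz⟩, hmax⟩ := hKc.exists_isMaxOn ⟨_, hmem⟩ hhc
  have hlow : a * Real.exp (-(K * τ)) ≤ h (t, x, z) := by
    have h1 := hmax hmem
    have h2 : h (t₁, y₁, z₁) = Real.exp (-(K * t₁)) * a := by simp only [hh, ha]; rw [hxy]
    have h3 : Real.exp (-(K * τ)) ≤ Real.exp (-(K * t₁)) :=
      Real.exp_le_exp.2 (by nlinarith [ht₁.2])
    calc a * Real.exp (-(K * τ)) ≤ Real.exp (-(K * t₁)) * a := by nlinarith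
      _ ≤ h (t, x, z) := by rw [← h2]; exact h1
  have hglob : ∀ s ∈ Icc 0 τ, ∀ y v, h (s, y, v) ≤ h (t, x, z) := by
    intro s hs y v
    by_cases hv : Z' ≤ |v|
    · have h1 := hZ s hs y v ((le_max_left _ _).trans hv)
      have h2 : Real.exp (-(K * s)) ≤ 1 := Real.exp_le_one_iff.2 (by nlinarith [hs.1])
      have h3 := Real.exp_pos (-(K * s))
      have h4 : 0 < a * Real.exp (-(K * τ)) := by positivity
      have h5 : h (s, y, v) ≤ a * Real.exp (-(K * τ)) / 2 := by
        simp only [hh]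
        nlinarith
      linarith
    · have hv' := abs_le.1 (not_le.1 hv).le
      obtain ⟨y', hy', e⟩ := hper.exists_mem_Icc hL hs.1 y v
      have := hmax (show (s, y', v) ∈ _ from ⟨hs, hy', hv'⟩)
      simp only [hh] at this ⊢
      rw [e]
      exact this
  have hgpos : 0 < g t x z := by
    have h4 : 0 < h (t, x, z) := lt_of_lt_of_le (by positivity) hlow
    exact (pos_iff_pos_of_mul_pos h4).1 (Real.exp_pos _)
  have ht0 : 0 < t := by
    rcases ht.1.lt_or_eq with h1 | h1
    · exact h1
    · exact absurd hgpos (not_lt.2 (by rw [show t = 0 from h1.symm]; exact hinit x z))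
  have hspace : ∀ y v, g t y v ≤ g t x z := fun y v =>
    le_of_mul_le_mul_left (hglob t ht y v) (Real.exp_pos _)
  have hgc : Continuous fun p : ℝ × ℝ => g t p.1 p.2 :=
    hc.comp_continuous (f := fun p : ℝ × ℝ => ((t, p) : ℝ × ℝ × ℝ)) (by fun_prop)
      fun p => ⟨ht.1, mem_univ _⟩
  have d1 : dx g t x z = 0 :=
    IsLocalMax.deriv_eq_zero (Eventually.of_forall fun y => hspace y z)
  have d2 : dz g t x z = 0 :=
    IsLocalMax.deriv_eq_zero (Eventually.of_forall fun y => hspace x y)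
  have d3 : dx (dx g) t x z ≤ 0 :=
    deriv_deriv_nonpos_of_max (φ := fun y => g t y z)
      (hgc.comp (by fun_prop : Continuous fun y : ℝ => (y, z))).continuousAt fun y => hspace y z
  have d4 : dz (dz g) t x z ≤ 0 :=
    deriv_deriv_nonpos_of_max (φ := fun y => g t x y)
      (hgc.comp (by fun_prop : Continuous fun y : ℝ => (x, y))).continuousAt fun y => hspace x y
  have d5 : 0 ≤ Real.exp (-(K * t)) * (dt g t x z - K * g t x z) := by
    refine deriv_nonneg_of_left_max ht0 (φ := fun s => h (s, x, z)) ?_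
      fun s hs => hglob s ⟨hs.1, hs.2.trans ht.2⟩ x z
    have e1 : HasDerivAt (fun s : ℝ => Real.exp (-(K * s))) (Real.exp (-(K * t)) * -(K * 1)) t :=
      (((hasDerivAt_id t).const_mul K).neg).exp
    have e2 : HasDerivAt (fun s => g s x z) (dt g t x z) t :=
      (hdiff t ⟨ht0, ht.2⟩ x z).hasDerivAt
    exact (e1.mul e2).congr_deriv (by ring)
  have d6 : 0 ≤ dt g t x z - K * g t x z := (mul_nonneg_iff_of_pos_left (Real.exp_pos _)).1 d5
  have d7 := heq t ⟨ht0, ht.2⟩ x z hgpos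
  rw [d1, d2, laplacian] at d7
  have d8 := le_abs_self k
  nlinarith

/-! ### Concave nonlinearities and front-like data -/

section Nonlinearity

variable {f : ℝ → ℝ} {m M : ℝ}

lemma exists_lipschitz_on_Icc (hf : ContDiff ℝ 1 f) (B : ℝ) :
    ∃ k, 0 ≤ k ∧ ∀ x ∈ Icc (-B) B, ∀ y ∈ Icc (-B) B, |f y - f x| ≤ k * |y - x| := by
  obtain ⟨k, hk⟩ := isCompact_Icc.exists_bound_of_continuousOn (s := Icc (-B) B)
    (hf.continuous_deriv le_rfl).continuousOn
  refine ⟨max k 0, le_max_right _ _, fun x hx y hy => ?_⟩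
  exact (convex_Icc (-B) B).norm_image_sub_le_of_norm_deriv_le
    (fun z _ => hf.differentiable (by norm_num) z) (fun z hz => (hk z hz).trans (le_max_left _ _))
    hx hy

lemma IsConcaveKPP.contDiff_nat (hf : IsConcaveKPP f m M) (n : ℕ) : ContDiff ℝ n f :=
  hf.smooth.of_le (by exact_mod_cast le_top)

lemma IsConcaveKPP.m_nonneg (hf : IsConcaveKPP f m M) : 0 ≤ m := by
  have hc : Continuous f := (hf.contDiff_nat 1).continuous
  obtain ⟨c, hc, h⟩ := exists_deriv_eq_zero (zero_lt_one' ℝ) hc.continuousOn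
    (by rw [hf.zero, hf.one])
  have := hf.slope c (Ioo_subset_Icc_self hc)
  linarith

lemma IsConcaveKPP.le_slope (hf : IsConcaveKPP f m M) {θ : ℝ} (hθ : θ ∈ Icc (0 : ℝ) 1) :
    f θ ≤ m * (1 - θ) := by
  have hd : Differentiable ℝ f := (hf.contDiff_nat 1).differentiable (by norm_num)
  have h := (convex_Icc (0 : ℝ) 1).mul_sub_le_image_sub_of_le_deriv
    hd.continuous.continuousOn hd.differentiableOn (C := -m)
    (fun x hx => by have := hf.slope x (interior_subset hx); linarith) θ hθ 1 (by simp) hθ.2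
  rw [hf.one] at h
  linarith

lemma IsConcaveKPP.le_one (hf : IsConcaveKPP f m M) {θ : ℝ} (hθ : θ ∈ Icc (0 : ℝ) 1) :
    f θ ≤ 1 := (hf.le_self θ hθ).trans hθ.2

/-- The decay rate of `1 - T₀` at `-∞` can be taken to be at most `1`, since `T₀` is nonnegative. -/
lemma IsFrontLike.exists_tails {T₀ : ℝ → ℝ → ℝ} (h : IsFrontLike T₀) :
    ∃ α α' β : ℝ, 0 < β ∧ β ≤ 1 ∧ (∀ x z, T₀ x z ≤ Real.exp (α - z)) ∧
      ∀ x z, 1 - T₀ x z ≤ Real.exp (α' + β * z) := by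
  obtain ⟨α, hα⟩ := h.upper_tail
  obtain ⟨α', β, hβ, hα'⟩ := h.lower_tail
  by_cases h1 : β ≤ 1
  · exact ⟨α, α', β, hβ, h1, hα, hα'⟩
  have h1 := not_le.1 h1
  refine ⟨α, α' / β, 1, one_pos, le_rfl, hα, fun x z => ?_⟩
  have e : α' + β * z = β * (α' / β + 1 * z) := by field_simp
  by_cases h2 : 0 ≤ α' / β + 1 * z
  · have := Real.one_le_exp h2
    linarith [h.nonneg x z]
  · refine (hα' x z).trans (Real.exp_le_exp.2 ?_)
    rw [e]
    nlinarith [not_le.1 h2]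

end Nonlinearity

/-! ### Comparison with exponentials -/

/-- The total displacement `∫₀ᵗ sup |w|` by which the flow can move the front until time `t`. -/
noncomputable def drift (w : ScalarField) (t : ℝ) : ℝ := ∫ s in (0 : ℝ)..t, supNorm w s

lemma IsDecaying.hasDerivAt_drift {L : ℝ} {w : ScalarField} (hL : 0 < L) (hw : IsDecaying L w)
    (t : ℝ) : HasDerivAt (drift w) (supNorm w t) t :=
  intervalIntegral.integral_hasDerivAt_right
    ((hw.continuous_supNorm hL).intervalIntegrable _ _)
    (hw.continuous_supNorm hL).stronglyMeasurable.stronglyMeasurableAtFilter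
    (hw.continuous_supNorm hL).continuousAt

lemma drift_nonneg (w : ScalarField) {t : ℝ} (ht : 0 ≤ t) : 0 ≤ drift w t :=
  intervalIntegral.integral_nonneg ht fun s _ => supNorm_nonneg w s

@[simp] lemma drift_zero (w : ScalarField) : drift w 0 = 0 := by simp [drift]

section Comparison

variable {L σ ρ : ℝ} {f : ℝ → ℝ} {m M : ℝ} {T u w ω : ScalarField}

lemma IsSolution.decaying_w (h : IsSolution L σ ρ f T u w ω) : IsDecaying L w :=
  ⟨h.classical_w.continuousOn, h.periodic_w, h.w_bot, h.w_top⟩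

/-- Comparison of an affine function of the temperature with an exponential. -/
lemma IsSolution.comparison (h : IsSolution L σ ρ f T u w ω) (hL : 0 < L)
    (κ c₀ e a b c d k τ : ℝ)
    (htail : ∀ ε > 0, ∃ Z, ∀ t ∈ Icc 0 τ, ∀ x z, Z ≤ |z| →
      κ * T t x z + c₀ - e * Real.exp (a + b * z + c * t + d * drift w t) ≤ ε)
    (hinit : ∀ x z, κ * T 0 x z + c₀ - e * Real.exp (a + b * z) ≤ 0)
    (heq : ∀ t ∈ Ioc 0 τ, ∀ x z,
      0 < κ * T t x z + c₀ - e * Real.exp (a + b * z + c * t + d * drift w t) →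
      κ * f (T t x z) - e * Real.exp (a + b * z + c * t + d * drift w t) *
          (c + d * supNorm w t + b * w t x z - b ^ 2)
        ≤ k * (κ * T t x z + c₀ - e * Real.exp (a + b * z + c * t + d * drift w t))) :
    ∀ t ∈ Icc 0 τ, ∀ x z,
      κ * T t x z + c₀ - e * Real.exp (a + b * z + c * t + d * drift w t) ≤ 0 := by
  set ψ : ScalarField := fun t _ z => Real.exp (a + b * z + c * t + d * drift w t) with hψ
  set g : ScalarField := fun t x z => κ * T t x z + c₀ - e * ψ t x z with hg
  have hdrift : Continuous (drift w) :=
    continuous_iff_continuousAt.2 fun t => (h.decaying_w.hasDerivAt_drift hL t).continuousAt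
  have hψc : Continuous fun p : ℝ × ℝ × ℝ => ψ p.1 p.2.1 p.2.2 := by
    simp only [hψ]; fun_prop
  have hTs := h.classical_T.smooth
  have e1 : ∀ t, 0 < t → ∀ x z, HasDerivAt (fun s => g s x z)
      (κ * dt T t x z - e * (ψ t x z * (c + d * supNorm w t))) t := fun t ht x z => by
    have h1 : HasDerivAt (fun s => ψ s x z) (ψ t x z * (c * 1 + d * supNorm w t)) t :=
      ((((hasDerivAt_id t).const_mul c).const_add (a + b * z)).add
        ((h.decaying_w.hasDerivAt_drift hL t).const_mul d)).exp
    have h2 := (((hTs.hasDerivAt_dt (by norm_num) ht x z).const_mul κ).add_const c₀).sub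
      (h1.const_mul e)
    rw [mul_one] at h2
    exact h2
  have e2 : ∀ t, 0 < t → ∀ x z, dx g t x z = κ * dx T t x z := fun t ht x z =>
    ((((hTs.hasDerivAt_dx (by norm_num) ht x z).const_mul κ).add_const c₀).sub_const
      (e * ψ t x z)).deriv
  have eψ : ∀ t x z, HasDerivAt (fun y => ψ t x y) (ψ t x z * b) z := fun t x z => by
    have := ((((hasDerivAt_id z).const_mul b).const_add a).add_const (c * t)).add_const
      (d * drift w t) |>.exp
    simpa using this
  have e3 : ∀ t, 0 < t → ∀ x z, dz g t x z = κ * dz T t x z - e * (ψ t x z * b) :=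
    fun t ht x z => ((((hTs.hasDerivAt_dz (by norm_num) ht x z).const_mul κ).add_const c₀).sub
      ((eψ t x z).const_mul e)).deriv
  have e4 : ∀ t, 0 < t → ∀ x z, dx (dx g) t x z = κ * dx (dx T) t x z := fun t ht x z => by
    have h0 : (fun y => dx g t y z) = fun y => κ * dx T t y z := funext fun y => e2 t ht y z
    have h1 := (h.classical_T.smooth_dx.hasDerivAt_dx (by norm_num) ht x z).const_mul κ
    rw [← h0] at h1
    exact h1.deriv
  have e5 : ∀ t, 0 < t → ∀ x z, dz (dz g) t x z = κ * dz (dz T) t x z - e * (ψ t x z * b ^ 2) :=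
    fun t ht x z => by
    have h0 : (fun y => dz g t x y) = fun y => κ * dz T t x y - e * (ψ t x y * b) :=
      funext fun y => e3 t ht x y
    have h1 := ((h.classical_T.smooth_dz.hasDerivAt_dz (by norm_num) ht x z).const_mul κ).sub
      (((eψ t x z).mul_const b).const_mul e)
    rw [show (_ - _ : ℝ → ℝ) = fun y => dz g t x y from h0.symm] at h1
    refine h1.deriv.trans ?_
    ring
  refine maximum_principle (u := u) (w := w) (g := g) (k := k) hL ?_ ?_ htail ?_ ?_ ?_
  · exact ((continuousOn_const.mul h.classical_T.continuousOn).add continuousOn_const).sub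
      (continuousOn_const.mul hψc.continuousOn)
  · intro t ht x z
    simp only [hg, hψ, h.periodic_T t ht x z]
  · intro x z
    simpa [hg, hψ] using hinit x z
  · exact fun t ht x z => (e1 t ht.1 x z).differentiableAt
  · intro t ht x z hpos
    have h1 : dt g t x z = _ := (e1 t ht.1 x z).deriv
    rw [h1, e2 t ht.1, e3 t ht.1, laplacian, e4 t ht.1, e5 t ht.1]
    refine le_trans (le_of_eq ?_) (heq t ht x z hpos)
    rw [← h.temperature_eq t ht.1 x z, laplacian]
    simp only [hψ]
    ring

lemma IsSolution.exists_bound_T (h : IsSolution L σ ρ f T u w ω) (hL : 0 < L) (τ : ℝ) :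
    ∃ B, 0 < B ∧ ∀ t ∈ Icc 0 τ, ∀ x z, |T t x z| ≤ B :=
  exists_bound hL h.classical_T.continuousOn h.periodic_T h.T_bot h.T_top τ

lemma exists_abs_of_top_bot {P : ℝ → Prop} (h1 : ∃ Z, ∀ z, z ≤ Z → P z)
    (h2 : ∃ Z, ∀ z, Z ≤ z → P z) : ∃ Z, ∀ z, Z ≤ |z| → P z := by
  obtain ⟨Z, hZ⟩ := h1
  obtain ⟨Z', hZ'⟩ := h2
  refine ⟨max (-Z) Z', fun z hz => ?_⟩
  rcases le_total 0 z with h0 | h0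
  · rw [abs_of_nonneg h0] at hz
    exact hZ' z ((le_max_right _ _).trans hz)
  · rw [abs_of_nonpos h0] at hz
    exact hZ z (by linarith [(le_max_left (-Z) Z').trans hz])

lemma IsSolution.nonneg_T (h : IsSolution L σ ρ f T u w ω) (hL : 0 < L) (hf : IsConcaveKPP f m M)
    (h0 : ∀ x z, 0 ≤ T 0 x z) {t : ℝ} (ht : 0 ≤ t) (x z : ℝ) : 0 ≤ T t x z := by
  obtain ⟨B, hB0, hB⟩ := h.exists_bound_T hL t
  obtain ⟨k, hk0, hk⟩ := exists_lipschitz_on_Icc (hf.contDiff_nat 1) B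
  have := h.comparison hL (-1) 0 0 0 0 0 0 k t ?_ ?_ ?_ t ⟨ht, le_rfl⟩ x z
  · linarith
  · intro ε hε
    obtain ⟨Z, hZ⟩ := exists_abs_of_top_bot
      (P := fun z => ∀ s ∈ Icc 0 t, ∀ x, -T s x z ≤ ε)
      (by
        obtain ⟨Z, hZ⟩ := h.T_bot.exists_bot t hε
        exact ⟨Z, fun z hz s hs x => by linarith [(abs_lt.1 (hZ z hz s hs x)).1]⟩)
      (by
        obtain ⟨Z, hZ⟩ := h.T_top.exists_top t hε
        exact ⟨Z, fun z hz s hs x => by linarith [(abs_lt.1 (hZ z hz s hs x)).1]⟩)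
    exact ⟨Z, fun s hs x z hz => by linarith [hZ z hz s hs x]⟩
  · intro x z
    linarith [h0 x z]
  · intro s hs x z hpos
    have h1 := hB s ⟨hs.1.le, hs.2⟩ x z
    have h2 := hk 0 ⟨by linarith, hB0.le⟩ (T s x z) (abs_le.1 h1)
    have hneg : T s x z < 0 := by linarith
    rw [hf.zero, sub_zero, sub_zero, abs_of_neg hneg] at h2
    linarith [(abs_le.1 h2).1]

lemma IsSolution.T_le_one (h : IsSolution L σ ρ f T u w ω) (hL : 0 < L) (hf : IsConcaveKPP f m M)
    (h0 : ∀ x z, T 0 x z ≤ 1) {t : ℝ} (ht : 0 ≤ t) (x z : ℝ) : T t x z ≤ 1 := by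
  obtain ⟨B, hB0, hB⟩ := h.exists_bound_T hL t
  obtain ⟨k, hk0, hk⟩ := exists_lipschitz_on_Icc (hf.contDiff_nat 1) (max B 1)
  have := h.comparison hL 1 (-1) 0 0 0 0 0 k t ?_ ?_ ?_ t ⟨ht, le_rfl⟩ x z
  · linarith
  · intro ε hε
    obtain ⟨Z, hZ⟩ := exists_abs_of_top_bot
      (P := fun z => ∀ s ∈ Icc 0 t, ∀ x, T s x z - 1 ≤ ε)
      (by
        obtain ⟨Z, hZ⟩ := h.T_bot.exists_bot t hε
        exact ⟨Z, fun z hz s hs x => by linarith [(abs_lt.1 (hZ z hz s hs x)).2]⟩)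
      (by
        obtain ⟨Z, hZ⟩ := h.T_top.exists_top t hε
        exact ⟨Z, fun z hz s hs x => by linarith [(abs_lt.1 (hZ z hz s hs x)).2]⟩)
    exact ⟨Z, fun s hs x z hz => by linarith [hZ z hz s hs x]⟩
  · intro x z
    linarith [h0 x z]
  · intro s hs x z hpos
    have h1 := (hB s ⟨hs.1.le, hs.2⟩ x z).trans (le_max_left B 1)
    have h3 := le_max_right B 1
    have h2 := hk 1 ⟨by linarith, h3⟩ (T s x z) (abs_le.1 h1)
    have hneg : 0 < T s x z - 1 := by linarith
    rw [hf.one, sub_zero, abs_of_pos hneg] at h2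
    linarith [(abs_le.1 h2).2]

/-- Upper barrier: the front advances upwards at speed at most `2 + sup |w|`. -/
lemma IsSolution.T_le_exp (h : IsSolution L σ ρ f T u w ω) (hL : 0 < L) (hf : IsConcaveKPP f m M)
    (h0 : ∀ x z, 0 ≤ T 0 x z) (h1 : ∀ x z, T 0 x z ≤ 1) {α : ℝ}
    (hα : ∀ x z, T 0 x z ≤ Real.exp (α - z)) {t : ℝ} (ht : 0 ≤ t) (x z : ℝ) :
    T t x z ≤ Real.exp (α + 2 * t + drift w t - z) := by
  have := h.comparison hL 1 0 1 α (-1) 2 1 1 t ?_ ?_ ?_ t ⟨ht, le_rfl⟩ x z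
  · rw [show α + 2 * t + drift w t - z = α + (-1) * z + 2 * t + 1 * drift w t by ring]
    linarith
  · intro ε hε
    obtain ⟨Z, hZ⟩ := exists_abs_of_top_bot (P := fun z => ∀ s ∈ Icc 0 t, ∀ x,
      1 * T s x z + 0 - 1 * Real.exp (α + (-1) * z + 2 * s + 1 * drift w s) ≤ ε)
      ⟨α, fun z hz s hs x => by
        have a1 := h.T_le_one hL hf h1 hs.1 x z
        have a2 : 1 ≤ Real.exp (α + (-1) * z + 2 * s + 1 * drift w s) :=
          Real.one_le_exp (by linarith [drift_nonneg w hs.1, hs.1])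
        linarith⟩
      (by
        obtain ⟨Z, hZ⟩ := h.T_top.exists_top t hε
        exact ⟨Z, fun z hz s hs x => by
          linarith [(abs_lt.1 (hZ z hz s hs x)).2,
            Real.exp_pos (α + (-1) * z + 2 * s + 1 * drift w s)]⟩)
    exact ⟨Z, fun s hs x z hz => hZ z hz s hs x⟩
  · intro x z
    rw [show α + (-1) * z = α - z by ring]
    linarith [hα x z]
  · intro s hs x z hpos
    have a0 : T s x z ∈ Icc (0 : ℝ) 1 :=
      ⟨h.nonneg_T hL hf h0 hs.1.le x z, h.T_le_one hL hf h1 hs.1.le x z⟩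
    have a1 := hf.le_self _ a0
    have a2 := (abs_le.1 (h.decaying_w.abs_le_supNorm hL hs.1.le x z)).2
    have a3 := Real.exp_pos (α + (-1) * z + 2 * s + 1 * drift w s)
    nlinarith [mul_nonneg a3.le (sub_nonneg.2 a2)]

/-- Lower barrier: the front advances downwards at speed at most `β + sup |w|`. -/
lemma IsSolution.one_sub_T_le_exp (h : IsSolution L σ ρ f T u w ω) (hL : 0 < L)
    (hf : IsConcaveKPP f m M) (h0 : ∀ x z, 0 ≤ T 0 x z) (h1 : ∀ x z, T 0 x z ≤ 1) {α β : ℝ}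
    (hβ : 0 < β) (hα : ∀ x z, 1 - T 0 x z ≤ Real.exp (α + β * z)) {t : ℝ} (ht : 0 ≤ t) (x z : ℝ) :
    1 - T t x z ≤ Real.exp (α + β * z + β ^ 2 * t + β * drift w t) := by
  have := h.comparison hL (-1) 1 1 α β (β ^ 2) β 0 t ?_ ?_ ?_ t ⟨ht, le_rfl⟩ x z
  · linarith
  · intro ε hε
    obtain ⟨Z, hZ⟩ := exists_abs_of_top_bot (P := fun z => ∀ s ∈ Icc 0 t, ∀ x,
      (-1) * T s x z + 1 - 1 * Real.exp (α + β * z + β ^ 2 * s + β * drift w s) ≤ ε)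
      (by
        obtain ⟨Z, hZ⟩ := h.T_bot.exists_bot t hε
        exact ⟨Z, fun z hz s hs x => by
          linarith [(abs_lt.1 (hZ z hz s hs x)).1,
            Real.exp_pos (α + β * z + β ^ 2 * s + β * drift w s)]⟩)
      ⟨-α / β, fun z hz s hs x => by
        have a1 := h.nonneg_T hL hf h0 hs.1 x z
        have a3 : -α ≤ z * β := (div_le_iff₀ hβ).1 hz
        have a2 : 1 ≤ Real.exp (α + β * z + β ^ 2 * s + β * drift w s) :=
          Real.one_le_exp (by
            nlinarith [mul_nonneg hβ.le (drift_nonneg w hs.1), mul_nonneg (sq_nonneg β) hs.1])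
        linarith⟩
    exact ⟨Z, fun s hs x z hz => hZ z hz s hs x⟩
  · intro x z
    linarith [hα x z]
  · intro s hs x z hpos
    have a0 : T s x z ∈ Icc (0 : ℝ) 1 :=
      ⟨h.nonneg_T hL hf h0 hs.1.le x z, h.T_le_one hL hf h1 hs.1.le x z⟩
    have a1 := hf.nonneg _ a0
    have a2 := (abs_le.1 (h.decaying_w.abs_le_supNorm hL hs.1.le x z)).1
    have a3 := Real.exp_pos (α + β * z + β ^ 2 * s + β * drift w s)
    have a4 : 0 ≤ β * supNorm w s + β * w s x z := by nlinarith
    nlinarith [mul_nonneg a3.le a4]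

end Comparison

/-! ### Vertical cutoffs -/

/-- A fixed smooth bump function on the line, equal to `1` on `[-1, 1]` and to `0` off `(-2, 2)`. -/
noncomputable def bump : ContDiffBump (0 : ℝ) := ⟨1, 2, one_pos, one_lt_two⟩

/-- The vertical cutoff at height `R`. -/
noncomputable def cutoff (R z : ℝ) : ℝ := bump (z / R)

/-- The first derivative of the cutoff. -/
noncomputable def cutoff' (R z : ℝ) : ℝ := deriv bump (z / R) / R

/-- The second derivative of the cutoff. -/
noncomputable def cutoff'' (R z : ℝ) : ℝ := deriv (deriv bump) (z / R) / R ^ 2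

lemma bump_contDiff (n : ℕ) : ContDiff ℝ n bump := bump.contDiff

lemma bump_deriv_contDiff : ContDiff ℝ 1 (deriv bump) := by
  have h : ContDiff ℝ (1 + 1) bump := by exact_mod_cast bump_contDiff 2
  exact ((contDiff_succ_iff_deriv).1 h).2.2

lemma continuous_bump_deriv_deriv : Continuous (deriv (deriv bump)) :=
  bump_deriv_contDiff.continuous_deriv le_rfl

lemma bump_eventuallyEq {z : ℝ} (hz : 2 < |z|) : bump =ᶠ[𝓝 z] fun _ => (0 : ℝ) := by
  filter_upwards [(isOpen_lt continuous_const continuous_abs).mem_nhds hz] with y hy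
  exact bump.zero_of_le_dist (by rw [Real.dist_eq, sub_zero]; exact (le_of_lt hy))

lemma bump_deriv_eq_zero {z : ℝ} (hz : 2 < |z|) : deriv bump z = 0 := by
  rw [(bump_eventuallyEq hz).deriv_eq]; simp

lemma bump_deriv_deriv_eq_zero {z : ℝ} (hz : 2 < |z|) : deriv (deriv bump) z = 0 := by
  rw [(bump_eventuallyEq hz).deriv.deriv_eq]; simp

lemma bump_deriv_eq_zero_of_lt {z : ℝ} (hz : |z| < 1) : deriv bump z = 0 := by
  have : bump =ᶠ[𝓝 z] fun _ => (1 : ℝ) := by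
    filter_upwards [(isOpen_lt continuous_abs continuous_const).mem_nhds hz] with y hy
    exact bump.one_of_mem_closedBall (by
      rw [mem_closedBall_zero_iff, Real.norm_eq_abs]; exact (le_of_lt hy))
  rw [this.deriv_eq]; simp

lemma exists_bump_bound : ∃ c, 0 < c ∧ (∀ z, |deriv bump z| ≤ c) ∧
    ∀ z, |deriv (deriv bump) z| ≤ c := by
  obtain ⟨c₁, h₁⟩ := (isCompact_Icc (a := (-2 : ℝ)) (b := 2)).exists_bound_of_continuousOn
    bump_deriv_contDiff.continuous.continuousOn
  obtain ⟨c₂, h₂⟩ := (isCompact_Icc (a := (-2 : ℝ)) (b := 2)).exists_bound_of_continuousOn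
    continuous_bump_deriv_deriv.continuousOn
  refine ⟨max 1 (max c₁ c₂), by positivity, fun z => ?_, fun z => ?_⟩
  · by_cases hz : 2 < |z|
    · rw [bump_deriv_eq_zero hz, abs_zero]; positivity
    · exact (h₁ z (abs_le.1 (not_lt.1 hz))).trans
        ((le_max_left _ _).trans (le_max_right _ _))
  · by_cases hz : 2 < |z|
    · rw [bump_deriv_deriv_eq_zero hz, abs_zero]; positivity
    · exact (h₂ z (abs_le.1 (not_lt.1 hz))).trans
        ((le_max_right _ _).trans (le_max_right _ _))

section Cutoff

variable {R z : ℝ}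

lemma two_lt_of_three_mul_le (hR : 0 < R) (hz : 3 * R ≤ |z|) : 2 < |z / R| := by
  rw [abs_div, abs_of_pos hR, lt_div_iff₀ hR]; linarith

lemma cutoff_nonneg (R z : ℝ) : 0 ≤ cutoff R z := bump.nonneg

lemma cutoff_le_one (R z : ℝ) : cutoff R z ≤ 1 := bump.le_one

lemma cutoff_eq_one (hR : 0 < R) (hz : |z| ≤ R) : cutoff R z = 1 :=
  bump.one_of_mem_closedBall (by
    rw [mem_closedBall_zero_iff, Real.norm_eq_abs, abs_div, abs_of_pos hR]
    exact (div_le_one hR).2 hz)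

lemma cutoff_eq_zero (hR : 0 < R) (hz : 3 * R ≤ |z|) : cutoff R z = 0 :=
  (bump_eventuallyEq (two_lt_of_three_mul_le hR hz)).eq_of_nhds

lemma cutoff'_eq_zero (hR : 0 < R) (hz : 3 * R ≤ |z|) : cutoff' R z = 0 := by
  rw [cutoff', bump_deriv_eq_zero (two_lt_of_three_mul_le hR hz), zero_div]

lemma cutoff''_eq_zero (hR : 0 < R) (hz : 3 * R ≤ |z|) : cutoff'' R z = 0 := by
  rw [cutoff'', bump_deriv_deriv_eq_zero (two_lt_of_three_mul_le hR hz), zero_div]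

lemma cutoff'_eq_zero_of_lt (hR : 0 < R) (hz : |z| < R) : cutoff' R z = 0 := by
  rw [cutoff', bump_deriv_eq_zero_of_lt, zero_div]
  rw [abs_div, abs_of_pos hR]
  exact (div_lt_one hR).2 hz

lemma contDiff_cutoff (R : ℝ) : ContDiff ℝ 1 (cutoff R) :=
  (bump_contDiff 1).comp (contDiff_id.div_const R)

lemma contDiff_cutoff' (R : ℝ) : ContDiff ℝ 1 (cutoff' R) :=
  (bump_deriv_contDiff.comp (contDiff_id.div_const R)).div_const R

lemma continuous_cutoff'' (R : ℝ) : Continuous (cutoff'' R) :=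
  (continuous_bump_deriv_deriv.comp (continuous_id.div_const R)).div_const (R ^ 2)

lemma hasDerivAt_cutoff (R z : ℝ) : HasDerivAt (cutoff R) (cutoff' R z) z := by
  have h1 := (((bump_contDiff 1).differentiable (by norm_num)) (z / R)).hasDerivAt
  have h2 := h1.comp z ((hasDerivAt_id z).div_const R)
  exact h2.congr_deriv (mul_one_div _ _)

lemma hasDerivAt_cutoff' (R z : ℝ) : HasDerivAt (cutoff' R) (cutoff'' R z) z := by
  have h1 := ((bump_deriv_contDiff.differentiable (by norm_num)) (z / R)).hasDerivAt
  have h2 := (h1.comp z ((hasDerivAt_id z).div_const R)).div_const R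
  refine h2.congr_deriv ?_
  rw [cutoff'']
  ring

lemma tendsto_cutoff_atTop (z : ℝ) : Tendsto (fun R => cutoff R z) atTop (𝓝 1) := by
  refine tendsto_const_nhds.congr' ?_
  filter_upwards [eventually_gt_atTop 0, eventually_ge_atTop |z|] with R h1 h2
  exact (cutoff_eq_one h1 h2).symm

end Cutoff

/-! ### The weak form of transport-diffusion equations -/

/-- The transport-diffusion operator `∂ₜ + v · ∇ - κ Δ`. -/
noncomputable def transportOp (κ : ℝ) (u w g : ScalarField) : ScalarField := fun t x z =>
  dt g t x z + (u t x z * dx g t x z + w t x z * dz g t x z) - κ * laplacian g t x z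

section Weak

variable {L κ t τ : ℝ} {u w g : ScalarField}

lemma IsPeriodic.dx (hg : IsPeriodic L g) : IsPeriodic L (dx g) := fun t ht x z => by
  have h : (fun y => g t y z) = fun y => g t (y + L) z := funext fun y => (hg t ht y z).symm
  exact (deriv_comp_add_const (fun y => g t y z) L x).symm.trans
    (congrArg (fun φ => deriv φ x) h.symm)

lemma continuousOn_transportOp (hu : IsClassical u) (hw : IsClassical w) (hg : IsClassical g)
    (κ : ℝ) : ContinuousOn (fun p : ℝ × ℝ × ℝ => transportOp κ u w g p.1 p.2.1 p.2.2)
      (Ioi 0 ×ˢ univ) := by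
  have h1 := hg.smooth_dt.continuousOn
  have h2 := hg.smooth_dx.continuousOn
  have h3 := hg.smooth_dz.continuousOn
  have h4 := (IsSmoothField.dx (n := 0) (by simpa using hg.smooth_dx)).continuousOn
  have h5 := (IsSmoothField.dz (n := 0) (by simpa using hg.smooth_dz)).continuousOn
  have h6 := hu.smooth.continuousOn
  have h7 := hw.smooth.continuousOn
  exact (h1.add ((h6.mul h2).add (h7.mul h3))).sub (continuousOn_const.mul (h4.add h5))

/-- A function that is continuous for `t > 0` is continuous on every positive time slice. -/
lemma continuous_slice {g : ScalarField}
    (hg : ContinuousOn (fun p : ℝ × ℝ × ℝ => g p.1 p.2.1 p.2.2) (Ioi 0 ×ˢ univ)) (ht : 0 < t) :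
    Continuous fun p : ℝ × ℝ => g t p.1 p.2 :=
  hg.comp_continuous (f := fun p : ℝ × ℝ => ((t, p) : ℝ × ℝ × ℝ)) (by fun_prop)
    fun _ => ⟨ht, mem_univ _⟩

/-- Integration by parts at a fixed time. -/
lemma setIntegral_transport_mul_cutoff (hL : 0 < L) (hu : IsClassical u) (hw : IsClassical w)
    (hg : IsClassical g) (pu : IsPeriodic L u) (pg : IsPeriodic L g) (ht : 0 < t)
    (hdiv : ∀ x z, dx u t x z + dz w t x z = 0) {R : ℝ} (hR : 0 < R) :
    ∫ p in strip L, (transportOp κ u w g t p.1 p.2 - dt g t p.1 p.2) * cutoff R p.2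
      = -∫ p in strip L, g t p.1 p.2 * (w t p.1 p.2 * cutoff' R p.2 + κ * cutoff'' R p.2) := by
  have cη := (contDiff_cutoff R).comp (contDiff_snd (E := ℝ) (F := ℝ) (𝕜 := ℝ))
  have cη' := (contDiff_cutoff' R).comp (contDiff_snd (E := ℝ) (F := ℝ) (𝕜 := ℝ))
  have sg := (hg.smooth.mono (m := 1) (by norm_num)).slice ht
  have su := (hu.smooth.mono (m := 1) (by norm_num)).slice ht
  have sw := (hw.smooth.mono (m := 1) (by norm_num)).slice ht
  have sgx := hg.smooth_dx.slice ht
  have sgz := hg.smooth_dz.slice ht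
  have key := setIntegral_strip_div_eq_zero (b := 3 * R) hL
    (F := fun p => (u t p.1 p.2 * g t p.1 p.2 - κ * dx g t p.1 p.2) * cutoff R p.2)
    (G := fun p => (w t p.1 p.2 * g t p.1 p.2 - κ * dz g t p.1 p.2) * cutoff R p.2
      + κ * g t p.1 p.2 * cutoff' R p.2)
    (Fx := fun p => ((dx u t p.1 p.2 * g t p.1 p.2 + u t p.1 p.2 * dx g t p.1 p.2)
      - κ * dx (dx g) t p.1 p.2) * cutoff R p.2)
    (Gz := fun p => ((dz w t p.1 p.2 * g t p.1 p.2 + w t p.1 p.2 * dz g t p.1 p.2)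
      - κ * dz (dz g) t p.1 p.2) * cutoff R p.2
      + (w t p.1 p.2 * g t p.1 p.2 - κ * dz g t p.1 p.2) * cutoff' R p.2
      + (κ * dz g t p.1 p.2 * cutoff' R p.2 + κ * g t p.1 p.2 * cutoff'' R p.2))
    (((su.mul sg).sub (contDiff_const.mul sgx)).mul cη)
    ((((sw.mul sg).sub (contDiff_const.mul sgz)).mul cη).add ((contDiff_const.mul sg).mul cη'))
    (fun p => (((hu.smooth.hasDerivAt_dx (by norm_num) ht p.1 p.2).mul
        (hg.smooth.hasDerivAt_dx (by norm_num) ht p.1 p.2)).sub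
        ((hg.smooth_dx.hasDerivAt_dx (by norm_num) ht p.1 p.2).const_mul κ)).mul_const (cutoff R p.2))
    (fun p => ((((hw.smooth.hasDerivAt_dz (by norm_num) ht p.1 p.2).mul
        (hg.smooth.hasDerivAt_dz (by norm_num) ht p.1 p.2)).sub
        ((hg.smooth_dz.hasDerivAt_dz (by norm_num) ht p.1 p.2).const_mul κ)).mul
        (hasDerivAt_cutoff R p.2)).add
        (((hg.smooth.hasDerivAt_dz (by norm_num) ht p.1 p.2).const_mul κ).mul
        (hasDerivAt_cutoff' R p.2)))
    (fun z => by
      have h1 := pu t ht.le 0 z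
      have h2 := pg t ht.le 0 z
      have h3 := pg.dx t ht.le 0 z
      rw [zero_add] at h1 h2 h3
      simp only [h1, h2, h3])
    (by positivity)
    (fun p hp => by simp only [cutoff_eq_zero hR hp, mul_zero])
    (fun p hp => by simp only [cutoff_eq_zero hR hp, cutoff'_eq_zero hR hp, mul_zero, add_zero])
    (fun p hp => by
      simp only [cutoff_eq_zero hR hp, cutoff'_eq_zero hR hp, cutoff''_eq_zero hR hp, mul_zero,
        add_zero])
  rw [eq_neg_iff_add_eq_zero, ← key, ← integral_add]
  · refine integral_congr_ae (Eventually.of_forall fun p => ?_)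
    simp only [transportOp, laplacian]
    linear_combination (-g t p.1 p.2 * cutoff R p.2) * hdiv p.1 p.2
  · refine integrableOn_strip_of_vanish (b := 3 * R) ?_
      fun p hp => by simp only [cutoff_eq_zero hR hp, mul_zero]
    exact ((continuous_slice (continuousOn_transportOp hu hw hg κ) ht).sub
      (hg.smooth_dt.slice ht).continuous).mul cη.continuous
  · refine integrableOn_strip_of_vanish (b := 3 * R) ?_
      fun p hp => by
        simp only [cutoff'_eq_zero hR hp, cutoff''_eq_zero hR hp, mul_zero, add_zero]
    exact sg.continuous.mul ((sw.continuous.mul cη'.continuous).add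
      (continuous_const.mul ((continuous_cutoff'' R).comp continuous_snd)))

/-- The error caused by the cutoff vanishes in the limit for every bounded field, because the
velocity tends to `0` at both ends. -/
lemma exists_cutoff_error_le (hL : 0 < L) (hw : IsDecaying L w) (hκ : 0 ≤ κ) {B : ℝ} (hB : 0 < B)
    (hgB : ∀ s ∈ Icc 0 t, ∀ x z, |g s x z| ≤ B) {ε : ℝ} (hε : 0 < ε) :
    ∃ R₀ > 0, ∀ R, R₀ ≤ R → ∀ s ∈ Icc 0 t,
      |∫ p in strip L, g s p.1 p.2 * (w s p.1 p.2 * cutoff' R p.2 + κ * cutoff'' R p.2)| ≤ ε := by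
  obtain ⟨c, hc, hc1, hc2⟩ := exists_bump_bound
  set δ := ε / (12 * L * B * c) with hδ
  have hδ0 : 0 < δ := by positivity
  obtain ⟨Z, hZ, hwZ⟩ := hw.bot.exists_abs hw.top t hδ0
  refine ⟨max Z (max 1 (κ / δ)), by positivity, fun R hR s hs => ?_⟩
  have hRZ : Z ≤ R := (le_max_left _ _).trans hR
  have hR1 : 1 ≤ R := ((le_max_left _ _).trans (le_max_right _ _)).trans hR
  have hRκ : κ / δ ≤ R := ((le_max_right _ _).trans (le_max_right _ _)).trans hR
  have hR0 : 0 < R := by linarith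
  rw [setIntegral_strip_eq_box (b := 3 * R) fun p hp => by
        simp only [cutoff'_eq_zero hR0 hp, cutoff''_eq_zero hR0 hp, mul_zero, add_zero]]
  have hbox : (Icc ((0 : ℝ), -(3 * R)) (L, 3 * R)) = Icc 0 L ×ˢ Icc (-(3 * R)) (3 * R) :=
    (Icc_prod_Icc _ _ _ _).symm
  have hvol : volume.real (Icc ((0 : ℝ), -(3 * R)) (L, 3 * R)) = L * (6 * R) := by
    rw [hbox, Measure.volume_eq_prod, measureReal_prod_prod, Real.volume_real_Icc_of_le hL.le,
      Real.volume_real_Icc_of_le (by linarith)]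
    ring
  have hpt : ∀ p : ℝ × ℝ,
      ‖g s p.1 p.2 * (w s p.1 p.2 * cutoff' R p.2 + κ * cutoff'' R p.2)‖ ≤ B * (2 * δ * c / R) := by
    intro p
    rw [Real.norm_eq_abs, abs_mul]
    have a1 : |w s p.1 p.2 * cutoff' R p.2| ≤ δ * (c / R) := by
      by_cases hp : |p.2| < R
      · rw [cutoff'_eq_zero_of_lt hR0 hp, mul_zero, abs_zero]; positivity
      · rw [abs_mul]
        have b1 := (hwZ p.2 (hRZ.trans (not_lt.1 hp)) s hs p.1).le
        have b2 : |cutoff' R p.2| ≤ c / R := by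
          rw [cutoff', abs_div, abs_of_pos hR0]
          exact div_le_div_of_nonneg_right (hc1 _) hR0.le
        gcongr
    have a2 : |κ * cutoff'' R p.2| ≤ δ * (c / R) := by
      rw [abs_mul, abs_of_nonneg hκ, cutoff'', abs_div, abs_of_pos (by positivity : 0 < R ^ 2)]
      have b1 := hc2 (p.2 / R)
      have b2 : κ ≤ R * δ := (div_le_iff₀ hδ0).1 hRκ
      calc κ * (|deriv (deriv bump) (p.2 / R)| / R ^ 2) ≤ (R * δ) * (c / R ^ 2) := by gcongr
        _ = δ * (c / R) := by field_simp
    have a3 := (abs_add_le (w s p.1 p.2 * cutoff' R p.2) (κ * cutoff'' R p.2)).trans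
      (add_le_add a1 a2)
    have a4 : δ * (c / R) + δ * (c / R) = 2 * δ * c / R := by ring
    rw [a4] at a3
    exact mul_le_mul (hgB s hs p.1 p.2) a3 (abs_nonneg _) hB.le
  have := norm_setIntegral_le_of_norm_le_const (s := Icc ((0 : ℝ), -(3 * R)) (L, 3 * R))
    (isCompact_Icc.measure_lt_top (μ := (volume : Measure (ℝ × ℝ)))) fun p _ => hpt p
  rw [hvol, Real.norm_eq_abs] at this
  refine this.trans (le_of_eq ?_)
  rw [hδ]
  field_simp
  ring

/-- Space-time functions that are continuous for `t > 0` and vanish for large `|z|` are integrable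
on time intervals bounded away from `0`. -/
lemma integrable_prod_strip_of_vanish {b : ℝ} {H : ℝ × ℝ × ℝ → ℝ}
    (hH : ContinuousOn H (Ioi 0 ×ˢ univ)) (hτ : 0 < τ)
    (hb : ∀ s, ∀ p : ℝ × ℝ, b ≤ |p.2| → H (s, p) = 0) :
    Integrable H ((volume.restrict (Ioc τ t)).prod (volume.restrict (strip L))) := by
  rw [Measure.prod_restrict]
  have h1 : IntegrableOn H (Icc τ t ×ˢ Icc ((0 : ℝ), -b) (L, b)) (volume.prod volume) :=
    (hH.mono fun p hp => ⟨hτ.trans_le hp.1.1, mem_univ _⟩).integrableOn_compact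
      (isCompact_Icc.prod isCompact_Icc)
  refine IntegrableOn.of_forall_sdiff_eq_zero h1
    (measurableSet_Ioc.prod (measurableSet_strip L)) ?_
  rintro ⟨s, x, z⟩ ⟨⟨hs, hx, -⟩, hp⟩
  apply hb
  by_contra! hz
  rw [abs_lt] at hz
  exact hp ⟨Ioc_subset_Icc_self hs, ⟨hx.1, hz.1.le⟩, hx.2, hz.2.le⟩

lemma continuousOn_mul_cutoff {g : ScalarField}
    (hg : ContinuousOn (fun p : ℝ × ℝ × ℝ => g p.1 p.2.1 p.2.2) (Ioi 0 ×ˢ univ)) (R : ℝ) :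
    ContinuousOn (fun p : ℝ × ℝ × ℝ => g p.1 p.2.1 p.2.2 * cutoff R p.2.2) (Ioi 0 ×ˢ univ) :=
  hg.mul ((contDiff_cutoff R).continuous.comp (by fun_prop)).continuousOn

lemma integrable_mul_cutoff {g : ScalarField}
    (hg : ContinuousOn (fun p : ℝ × ℝ × ℝ => g p.1 p.2.1 p.2.2) (Ioi 0 ×ˢ univ)) {R : ℝ}
    (hR : 0 < R) (hτ : 0 < τ) (L t : ℝ) :
    Integrable (fun p : ℝ × ℝ × ℝ => g p.1 p.2.1 p.2.2 * cutoff R p.2.2)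
      ((volume.restrict (Ioc τ t)).prod (volume.restrict (strip L))) :=
  integrable_prod_strip_of_vanish (b := 3 * R) (continuousOn_mul_cutoff hg R) hτ
    fun s p hp => by simp only [cutoff_eq_zero hR hp, mul_zero]

lemma intervalIntegrable_setIntegral_mul_cutoff {g : ScalarField}
    (hg : ContinuousOn (fun p : ℝ × ℝ × ℝ => g p.1 p.2.1 p.2.2) (Ioi 0 ×ˢ univ)) {R : ℝ}
    (hR : 0 < R) (hτ : 0 < τ) (hτt : τ ≤ t) (L : ℝ) :
    IntervalIntegrable (fun s => ∫ p in strip L, g s p.1 p.2 * cutoff R p.2) volume τ t := by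
  rw [intervalIntegrable_iff_integrableOn_Ioc_of_le hτt]
  exact (integrable_mul_cutoff hg hR hτ L t).integral_prod_left

lemma integrableOn_slice_mul_cutoff {g : ScalarField}
    (hg : Continuous fun p : ℝ × ℝ => g t p.1 p.2) {R : ℝ} (hR : 0 < R) (L : ℝ) :
    IntegrableOn (fun p : ℝ × ℝ => g t p.1 p.2 * cutoff R p.2) (strip L) :=
  integrableOn_strip_of_vanish (b := 3 * R)
    (hg.mul ((contDiff_cutoff R).continuous.comp continuous_snd))
    fun p hp => by simp only [cutoff_eq_zero hR hp, mul_zero]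

lemma integral_dt_mul_cutoff (hg : IsClassical g) {R : ℝ} (hR : 0 < R) (hτ : 0 < τ) (hτt : τ ≤ t) :
    ∫ s in τ..t, ∫ p in strip L, dt g s p.1 p.2 * cutoff R p.2
      = ∫ p in strip L, (g t p.1 p.2 - g τ p.1 p.2) * cutoff R p.2 := by
  rw [intervalIntegral.integral_of_le hτt,
    integral_integral_swap (integrable_mul_cutoff hg.smooth_dt.continuousOn hR hτ L t)]
  refine integral_congr_ae (Eventually.of_forall fun p => ?_)
  simp only
  rw [← intervalIntegral.integral_of_le hτt, intervalIntegral.integral_mul_const]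
  congr 1
  refine intervalIntegral.integral_eq_sub_of_hasDerivAt (f := fun s => g s p.1 p.2)
    (fun s hs => ?_) ?_
  · rw [uIcc_of_le hτt] at hs
    exact hg.smooth.hasDerivAt_dt (by norm_num) (hτ.trans_le hs.1) p.1 p.2
  · refine ContinuousOn.intervalIntegrable (fun s hs => ?_)
    rw [uIcc_of_le hτt] at hs
    have := (hg.smooth_dt.contDiffAt (hτ.trans_le hs.1) p.1 p.2).continuousAt.comp
      (f := fun s : ℝ => ((s, p.1, p.2) : ℝ × ℝ × ℝ)) (x := s) (by fun_prop)
    exact this.continuousWithinAt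

/-- The weak form of a transport-diffusion equation, tested with large cutoffs, at a fixed time and
integrated in time. -/
lemma exists_weak_form (hL : 0 < L) (hκ : 0 ≤ κ) (hu : IsClassical u) (hw : IsClassical w)
    (hg : IsClassical g) (pu : IsPeriodic L u) (pg : IsPeriodic L g) (hwd : IsDecaying L w)
    (hdiv : ∀ t, 0 < t → ∀ x z, dx u t x z + dz w t x z = 0) {B : ℝ} (hB : 0 < B)
    (hgB : ∀ s ∈ Icc 0 t, ∀ x z, |g s x z| ≤ B) {ε : ℝ} (hε : 0 < ε) :
    ∃ R₀ > 0, ∀ R, R₀ ≤ R →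
      (∀ s ∈ Ioc 0 t, |(∫ p in strip L, transportOp κ u w g s p.1 p.2 * cutoff R p.2)
        - ∫ p in strip L, dt g s p.1 p.2 * cutoff R p.2| ≤ ε) ∧
      ∀ τ, 0 < τ → τ ≤ t →
        |(∫ s in τ..t, ∫ p in strip L, transportOp κ u w g s p.1 p.2 * cutoff R p.2)
          - ∫ p in strip L, (g t p.1 p.2 - g τ p.1 p.2) * cutoff R p.2| ≤ ε * t := by
  obtain ⟨R₀, hR₀, hR⟩ := exists_cutoff_error_le hL hwd hκ hB hgB hε
  refine ⟨R₀, hR₀, fun R hRR => ?_⟩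
  have hR0 := hR₀.trans_le hRR
  have hop := continuousOn_transportOp hu hw hg κ
  have hfix : ∀ s ∈ Ioc 0 t, |(∫ p in strip L, transportOp κ u w g s p.1 p.2 * cutoff R p.2)
        - ∫ p in strip L, dt g s p.1 p.2 * cutoff R p.2| ≤ ε := fun s hs => by
    rw [← integral_sub (integrableOn_slice_mul_cutoff (continuous_slice hop hs.1) hR0 L)
      (integrableOn_slice_mul_cutoff (hg.smooth_dt.slice hs.1).continuous hR0 L)]
    simp_rw [← sub_mul]
    rw [setIntegral_transport_mul_cutoff hL hu hw hg pu pg hs.1 (hdiv s hs.1) hR0, abs_neg]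
    exact hR R hRR s ⟨hs.1.le, hs.2⟩
  refine ⟨hfix, fun τ hτ hτt => ?_⟩
  rw [← integral_dt_mul_cutoff hg hR0 hτ hτt, ← intervalIntegral.integral_sub
    (intervalIntegrable_setIntegral_mul_cutoff hop hR0 hτ hτt L)
    (intervalIntegrable_setIntegral_mul_cutoff hg.smooth_dt.continuousOn hR0 hτ hτt L)]
  have := intervalIntegral.norm_integral_le_of_norm_le_const (a := τ) (b := t) (C := ε)
    (f := fun s => (∫ p in strip L, transportOp κ u w g s p.1 p.2 * cutoff R p.2)
        - ∫ p in strip L, dt g s p.1 p.2 * cutoff R p.2) fun s hs => by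
      rw [uIoc_of_le hτt] at hs
      exact hfix s ⟨hτ.trans hs.1, hs.2⟩
  rw [Real.norm_eq_abs, abs_of_nonneg (by linarith : 0 ≤ t - τ)] at this
  exact this.trans (by gcongr; linarith)

/-- Integrals against a cutoff are continuous up to the initial time. -/
lemma tendsto_setIntegral_mul_cutoff (hg : IsClassical g) {R : ℝ} (hR : 0 < R) :
    Tendsto (fun τ => ∫ p in strip L, g τ p.1 p.2 * cutoff R p.2) (𝓝[>] 0)
      (𝓝 (∫ p in strip L, g 0 p.1 p.2 * cutoff R p.2)) := by
  have hc : Continuous (Function.uncurry fun (s : ℝ) (p : ℝ × ℝ) =>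
      g (max s 0) p.1 p.2 * cutoff R p.2) := by
    refine Continuous.mul ?_ ((contDiff_cutoff R).continuous.comp (by fun_prop))
    exact hg.continuousOn.comp_continuous
      (f := fun q : ℝ × ℝ × ℝ => ((max q.1 0, q.2) : ℝ × ℝ × ℝ)) (by fun_prop)
      fun q => ⟨show (0 : ℝ) ≤ max q.1 0 from le_max_right _ _, mem_univ _⟩
  have h1 := (continuous_parametric_integral_of_continuous (μ := volume) hc
    (isCompact_Icc (a := ((0 : ℝ), -(3 * R))) (b := (L, 3 * R)))).tendsto 0
  have e : ∀ s, 0 ≤ s → ∫ p in Icc ((0 : ℝ), -(3 * R)) (L, 3 * R),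
      g (max s 0) p.1 p.2 * cutoff R p.2 = ∫ p in strip L, g s p.1 p.2 * cutoff R p.2 := by
    intro s hs
    rw [max_eq_left hs, setIntegral_strip_eq_box (b := 3 * R) fun p hp => by
      simp only [cutoff_eq_zero hR hp, mul_zero]]
  rw [e 0 le_rfl] at h1
  refine (h1.mono_left nhdsWithin_le_nhds).congr' ?_
  filter_upwards [self_mem_nhdsWithin] with s hs using e s (le_of_lt hs)

end Weak

/-! ### The chain rule for transport-diffusion operators -/

section Chain

variable {L κ t : ℝ} {φ : ℝ → ℝ} {u w g : ScalarField}

lemma IsClassical.comp (hg : IsClassical g) (hφ : ContDiff ℝ 2 φ) :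
    IsClassical fun t x z => φ (g t x z) :=
  ⟨hφ.continuous.comp_continuousOn hg.continuousOn, hφ.comp_contDiffOn hg.contDiffOn⟩

lemma IsPeriodic.comp (hg : IsPeriodic L g) (φ : ℝ → ℝ) :
    IsPeriodic L fun t x z => φ (g t x z) := fun t ht x z =>
  congrArg φ (hg t ht x z)

/-- The operator `∂ₜ + v · ∇ - κ Δ` applied to a function of a field. -/
lemma transportOp_comp (hg : IsClassical g) (hφ : ContDiff ℝ 2 φ) (ht : 0 < t) (x z : ℝ) :
    transportOp κ u w (fun t x z => φ (g t x z)) t x z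
      = deriv φ (g t x z) * transportOp κ u w g t x z
        - κ * (deriv (deriv φ) (g t x z) * (dx g t x z ^ 2 + dz g t x z ^ 2)) := by
  have hφ1 : ∀ y, HasDerivAt φ (deriv φ y) y := fun y =>
    (hφ.differentiable (by norm_num) y).hasDerivAt
  have hφ' : ContDiff ℝ 1 (deriv φ) :=
    ((contDiff_succ_iff_deriv (n := 1)).1 (by rw [one_add_one_eq_two]; exact hφ)).2.2
  have hφ2 : ∀ y, HasDerivAt (deriv φ) (deriv (deriv φ) y) y := fun y =>
    (hφ'.differentiable (by norm_num) y).hasDerivAt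
  have s0 := hg.smooth
  have sx := hg.smooth_dx
  have sz := hg.smooth_dz
  have e1 : dt (fun t x z => φ (g t x z)) t x z = deriv φ (g t x z) * dt g t x z :=
    ((hφ1 _).comp t (s0.hasDerivAt_dt (by norm_num) ht x z)).deriv
  have e2 : ∀ x z, dx (fun t x z => φ (g t x z)) t x z = deriv φ (g t x z) * dx g t x z :=
    fun x z => ((hφ1 _).comp x (s0.hasDerivAt_dx (by norm_num) ht x z)).deriv
  have e3 : ∀ x z, dz (fun t x z => φ (g t x z)) t x z = deriv φ (g t x z) * dz g t x z :=
    fun x z => ((hφ1 _).comp z (s0.hasDerivAt_dz (by norm_num) ht x z)).deriv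
  have e4 : dx (dx (fun t x z => φ (g t x z))) t x z
      = deriv (deriv φ) (g t x z) * dx g t x z * dx g t x z
        + deriv φ (g t x z) * dx (dx g) t x z := by
    have h := ((hφ2 _).comp x (s0.hasDerivAt_dx (by norm_num) ht x z)).mul
      (sx.hasDerivAt_dx (by norm_num) ht x z)
    rw [show dx (dx (fun t x z => φ (g t x z))) t x z
      = deriv (fun y => deriv φ (g t y z) * dx g t y z) x from
      congrArg (fun ψ => deriv ψ x) (funext fun y => e2 y z)]
    exact h.deriv
  have e5 : dz (dz (fun t x z => φ (g t x z))) t x z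
      = deriv (deriv φ) (g t x z) * dz g t x z * dz g t x z
        + deriv φ (g t x z) * dz (dz g) t x z := by
    have h := ((hφ2 _).comp z (s0.hasDerivAt_dz (by norm_num) ht x z)).mul
      (sz.hasDerivAt_dz (by norm_num) ht x z)
    rw [show dz (dz (fun t x z => φ (g t x z))) t x z
      = deriv (fun y => deriv φ (g t x y) * dz g t x y) z from
      congrArg (fun ψ => deriv ψ z) (funext fun y => e3 x y)]
    exact h.deriv
  simp only [transportOp, laplacian]
  rw [e1, e2, e3, e4, e5]
  ring

end Chain

/-! ### Removing the cutoffs -/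

section Limits

variable {L t : ℝ} {F : ScalarField}

lemma aemeasurable_spaceTime
    (hF : ContinuousOn (fun p : ℝ × ℝ × ℝ => F p.1 p.2.1 p.2.2) (Ioi 0 ×ˢ univ)) (L t : ℝ) :
    AEMeasurable (fun p : ℝ × ℝ × ℝ => F p.1 p.2.1 p.2.2)
      ((volume.restrict (Ioc 0 t)).prod (volume.restrict (strip L))) := by
  rw [Measure.prod_restrict]
  exact (hF.mono fun p hp => ⟨hp.1.1, mem_univ _⟩).aemeasurable
    (measurableSet_Ioc.prod (measurableSet_strip L))

lemma lintegral_spaceTime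
    (hF : ContinuousOn (fun p : ℝ × ℝ × ℝ => F p.1 p.2.1 p.2.2) (Ioi 0 ×ˢ univ)) :
    ∫⁻ s in Ioc 0 t, ∫⁻ p in strip L, ENNReal.ofReal (F s p.1 p.2)
      = ∫⁻ q, ENNReal.ofReal (F q.1 q.2.1 q.2.2)
        ∂((volume.restrict (Ioc 0 t)).prod (volume.restrict (strip L))) :=
  (lintegral_prod _ (aemeasurable_spaceTime hF L t).ennreal_ofReal).symm

lemma lintegral_mul_cutoff
    (hF : ContinuousOn (fun p : ℝ × ℝ × ℝ => F p.1 p.2.1 p.2.2) (Ioi 0 ×ˢ univ))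
    (hF0 : ∀ s, 0 < s → ∀ x z, 0 ≤ F s x z) {R τ : ℝ} (hR : 0 < R) (hτ : 0 < τ) (hτt : τ ≤ t) :
    ∫⁻ q, ENNReal.ofReal (F q.1 q.2.1 q.2.2 * cutoff R q.2.2)
        ∂((volume.restrict (Ioc τ t)).prod (volume.restrict (strip L)))
      = ENNReal.ofReal (∫ s in τ..t, ∫ p in strip L, F s p.1 p.2 * cutoff R p.2) := by
  have hi := integrable_mul_cutoff hF hR hτ L t
  rw [intervalIntegral.integral_of_le hτt, ← integral_prod _ hi,
    ofReal_integral_eq_lintegral_ofReal hi]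
  rw [Measure.prod_restrict]
  refine (ae_restrict_iff' (measurableSet_Ioc.prod (measurableSet_strip L))).2
    (Eventually.of_forall fun q hq => ?_)
  exact mul_nonneg (hF0 _ (hτ.trans hq.1.1) _ _) (cutoff_nonneg _ _)

/-- Fatou's lemma for the exhaustion of space-time by cutoffs. -/
lemma lintegral_le_of_cutoff {B : ℝ} (ht : 0 < t)
    (hF : ContinuousOn (fun p : ℝ × ℝ × ℝ => F p.1 p.2.1 p.2.2) (Ioi 0 ×ˢ univ))
    (hF0 : ∀ s, 0 < s → ∀ x z, 0 ≤ F s x z)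
    (h : ∀ ε > 0, ∃ R₀ > 0, ∀ R, R₀ ≤ R → ∀ᶠ τ in 𝓝[>] 0,
      ∫ s in τ..t, ∫ p in strip L, F s p.1 p.2 * cutoff R p.2 ≤ B + ε) :
    ∫⁻ s in Ioc 0 t, ∫⁻ p in strip L, ENNReal.ofReal (F s p.1 p.2) ≤ ENNReal.ofReal B := by
  rw [lintegral_spaceTime hF]
  have hlim : Tendsto (fun ε => ENNReal.ofReal (B + ε)) (𝓝[>] 0) (𝓝 (ENNReal.ofReal B)) := by
    have : Tendsto (fun ε => ENNReal.ofReal (B + ε)) (𝓝 0) (𝓝 (ENNReal.ofReal (B + 0))) :=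
      (ENNReal.continuous_ofReal.comp (continuous_const.add continuous_id)).tendsto 0
    rw [add_zero] at this
    exact this.mono_left nhdsWithin_le_nhds
  refine ge_of_tendsto hlim ?_
  filter_upwards [self_mem_nhdsWithin] with ε hε
  obtain ⟨R₀, hR₀, hR⟩ := h ε hε
  have hex : ∀ n : ℕ, ∃ τ : ℝ, 0 < τ ∧ τ ≤ t ∧ τ ≤ 1 / (n + 1) ∧
      ∫ s in τ..t, ∫ p in strip L, F s p.1 p.2 * cutoff (R₀ + n) p.2 ≤ B + ε := fun n => by
    have h1 := hR (R₀ + n) (by simp)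
    have h2 : ∀ᶠ τ : ℝ in 𝓝[>] 0, τ ∈ Ioo 0 (min t (1 / (n + 1))) :=
      Ioo_mem_nhdsGT (lt_min ht (by positivity))
    obtain ⟨τ, h3, h4⟩ := (h1.and h2).exists
    exact ⟨τ, h4.1, h4.2.le.trans (min_le_left _ _), h4.2.le.trans (min_le_right _ _), h3⟩
  choose τ hτ0 hτt hτn hτB using hex
  have hτlim : Tendsto τ atTop (𝓝 0) :=
    squeeze_zero (fun n => (hτ0 n).le) hτn tendsto_one_div_add_atTop_nhds_zero_nat
  set ν := (volume.restrict (Ioc 0 t)).prod (volume.restrict (strip L)) with hν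
  set G : ℕ → ℝ × ℝ × ℝ → ℝ≥0∞ := fun n => (Ioc (τ n) t ×ˢ univ).indicator
    fun q => ENNReal.ofReal (F q.1 q.2.1 q.2.2 * cutoff (R₀ + n) q.2.2) with hG
  have hGm : ∀ n, AEMeasurable (G n) ν := fun n => by
    refine AEMeasurable.indicator ?_ (measurableSet_Ioc.prod MeasurableSet.univ)
    exact ((aemeasurable_spaceTime hF L t).mul
      ((contDiff_cutoff _).continuous.measurable.comp (by fun_prop)).aemeasurable).ennreal_ofReal
  have hGint : ∀ n, ∫⁻ q, G n q ∂ν ≤ ENNReal.ofReal (B + ε) := fun n => by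
    have e : ν.restrict (Ioc (τ n) t ×ˢ univ)
        = (volume.restrict (Ioc (τ n) t)).prod (volume.restrict (strip L)) := by
      rw [hν, ← Measure.prod_restrict, Measure.restrict_univ,
        Measure.restrict_restrict measurableSet_Ioc,
        inter_eq_left.2 (Ioc_subset_Ioc_left (hτ0 n).le)]
    rw [hG, lintegral_indicator (measurableSet_Ioc.prod MeasurableSet.univ), e,
      lintegral_mul_cutoff hF hF0 (by positivity) (hτ0 n) (hτt n)]
    exact ENNReal.ofReal_le_ofReal (hτB n)
  have hpt : ∀ᵐ q ∂ν, ENNReal.ofReal (F q.1 q.2.1 q.2.2) ≤ liminf (fun n => G n q) atTop := by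
    rw [hν, Measure.prod_restrict]
    refine (ae_restrict_iff' (measurableSet_Ioc.prod (measurableSet_strip L))).2
      (Eventually.of_forall fun q hq => ?_)
    have : Tendsto (fun n => G n q) atTop (𝓝 (ENNReal.ofReal (F q.1 q.2.1 q.2.2))) := by
      refine tendsto_const_nhds.congr' ?_
      have hcast : Tendsto (fun n : ℕ => R₀ + (n : ℝ)) atTop atTop :=
        tendsto_atTop_add_const_left _ _ tendsto_natCast_atTop_atTop
      filter_upwards [hτlim.eventually_lt_const hq.1.1, hcast.eventually_ge_atTop |q.2.2|]
        with n hn hn'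
      rw [hG]
      simp only
      rw [indicator_of_mem (show q ∈ Ioc (τ n) t ×ˢ univ from ⟨⟨hn, hq.1.2⟩, mem_univ _⟩),
        cutoff_eq_one (by positivity) hn', mul_one]
    exact this.liminf_eq.ge
  calc ∫⁻ q, ENNReal.ofReal (F q.1 q.2.1 q.2.2) ∂ν ≤ ∫⁻ q, liminf (fun n => G n q) atTop ∂ν :=
        lintegral_mono_ae hpt
    _ ≤ liminf (fun n => ∫⁻ q, G n q ∂ν) atTop := lintegral_liminf_le' hGm
    _ ≤ ENNReal.ofReal (B + ε) := by
        refine liminf_le_of_frequently_le' (Frequently.of_forall hGint)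

lemma integral_mul_cutoff_le_toReal
    (hF : ContinuousOn (fun p : ℝ × ℝ × ℝ => F p.1 p.2.1 p.2.2) (Ioi 0 ×ˢ univ))
    (hF0 : ∀ s, 0 < s → ∀ x z, 0 ≤ F s x z)
    (hfin : ∫⁻ s in Ioc 0 t, ∫⁻ p in strip L, ENNReal.ofReal (F s p.1 p.2) ≠ ∞)
    {R τ : ℝ} (hR : 0 < R) (hτ : 0 < τ) (hτt : τ ≤ t) :
    ∫ s in τ..t, ∫ p in strip L, F s p.1 p.2 * cutoff R p.2
      ≤ (∫⁻ s in Ioc 0 t, ∫⁻ p in strip L, ENNReal.ofReal (F s p.1 p.2)).toReal := by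
  refine (ENNReal.ofReal_le_iff_le_toReal hfin).1 ?_
  rw [← lintegral_mul_cutoff hF hF0 hR hτ hτt, lintegral_spaceTime hF]
  refine (lintegral_mono' ?_ le_rfl).trans (lintegral_mono_ae ?_)
  · rw [Measure.prod_restrict, Measure.prod_restrict]
    exact Measure.restrict_mono (prod_mono (Ioc_subset_Ioc_left hτ.le) le_rfl) le_rfl
  · rw [Measure.prod_restrict]
    refine (ae_restrict_iff' (measurableSet_Ioc.prod (measurableSet_strip L))).2
      (Eventually.of_forall fun q hq => ENNReal.ofReal_le_ofReal ?_)
    exact mul_le_of_le_one_right (hF0 _ hq.1.1 _ _) (cutoff_le_one _ _)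

end Limits

/-! ### A two-sided exponential profile -/

/-- The profile that equals `1` on `[-p, q]` and decays exponentially outside, at rate `b` to the
left and at rate `1` to the right. -/
noncomputable def profile (p q b z : ℝ) : ℝ :=
  (Iic (-p)).indicator (fun z => Real.exp (b * p) * Real.exp (b * z)) z
    + (Ioc (-p) q).indicator (fun _ => 1) z
    + (Ioi q).indicator (fun z => Real.exp q * Real.exp (-z)) z

section Profile

variable {p q b z : ℝ}

lemma integrable_profile (hb : 0 < b) : Integrable (profile p q b) := by
  refine Integrable.add (Integrable.add ?_ ?_) ?_
  · refine IntegrableOn.integrable_indicator ?_ measurableSet_Iic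
    exact (integrableOn_exp_mul_Iic hb _).const_mul _
  · refine IntegrableOn.integrable_indicator ?_ measurableSet_Ioc
    exact integrableOn_const (by simp)
  · refine IntegrableOn.integrable_indicator ?_ measurableSet_Ioi
    exact (integrableOn_exp_neg_Ioi q).const_mul _

lemma integral_profile (hp : 0 ≤ p) (hq : 0 ≤ q) (hb : 0 < b) :
    ∫ z, profile p q b z = p + q + 1 + 1 / b := by
  have i1 : Integrable ((Iic (-p)).indicator fun z => Real.exp (b * p) * Real.exp (b * z)) :=
    IntegrableOn.integrable_indicator ((integrableOn_exp_mul_Iic hb _).const_mul _)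
      measurableSet_Iic
  have i2 : Integrable ((Ioc (-p) q).indicator fun _ => (1 : ℝ)) :=
    IntegrableOn.integrable_indicator (integrableOn_const (by simp)) measurableSet_Ioc
  have i3 : Integrable ((Ioi q).indicator fun z => Real.exp q * Real.exp (-z)) :=
    IntegrableOn.integrable_indicator ((integrableOn_exp_neg_Ioi q).const_mul _)
      measurableSet_Ioi
  have e : profile p q b =
    ((Iic (-p)).indicator (fun z => Real.exp (b * p) * Real.exp (b * z))
    + (Ioc (-p) q).indicator (fun _ => 1))
    + (Ioi q).indicator (fun z => Real.exp q * Real.exp (-z)) := rfl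
  rw [e, integral_add' (i1.add i2) i3, integral_add' i1 i2, integral_indicator measurableSet_Iic,
    integral_indicator measurableSet_Ioc, integral_indicator measurableSet_Ioi,
    integral_const_mul, integral_const_mul, integral_exp_mul_Iic hb, integral_exp_neg_Ioi,
    setIntegral_const, Real.volume_real_Ioc_of_le (by linarith)]
  have e1 : Real.exp (b * p) * (Real.exp (b * -p) / b) = 1 / b := by
    rw [← mul_div_assoc, ← Real.exp_add, mul_neg, add_neg_cancel, Real.exp_zero]
  have e2 : Real.exp q * Real.exp (-q) = 1 := by
    rw [← Real.exp_add, add_neg_cancel, Real.exp_zero]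
  rw [e1, e2]
  simp only [smul_eq_mul]
  ring

lemma le_profile {y : ℝ} (hpq : -p ≤ q) (h1 : y ≤ 1) (h2 : z ≤ -p → y ≤ Real.exp (b * (z + p)))
    (h3 : q < z → y ≤ Real.exp (q - z)) : y ≤ profile p q b z := by
  unfold profile
  by_cases hz : z ≤ -p
  · rw [indicator_of_mem (show z ∈ Iic (-p) from hz),
      indicator_of_notMem (fun h => absurd h.1 (not_lt.2 hz)),
      indicator_of_notMem (show z ∉ Ioi q from not_lt.2 (hz.trans hpq)),
      ← Real.exp_add, add_zero, add_zero]
    convert h2 hz using 2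
    ring
  · by_cases hz' : z ≤ q
    · rw [indicator_of_notMem (show z ∉ Iic (-p) from hz),
        indicator_of_mem (show z ∈ Ioc (-p) q from ⟨not_le.1 hz, hz'⟩),
        indicator_of_notMem (show z ∉ Ioi q from not_lt.2 hz')]
      linarith
    · rw [indicator_of_notMem (show z ∉ Iic (-p) from hz),
        indicator_of_notMem (fun h => absurd h.2 hz'),
        indicator_of_mem (show z ∈ Ioi q from not_le.1 hz'), ← Real.exp_add, zero_add, zero_add]
      exact h3 (not_le.1 hz')

lemma profile_nonneg (p q b z : ℝ) : 0 ≤ profile p q b z := by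
  unfold profile
  refine add_nonneg (add_nonneg ?_ ?_) ?_ <;>
  exact indicator_nonneg (fun _ _ => by positivity) _

lemma integrableOn_strip_profile (L : ℝ) (hb : 0 < b) :
    IntegrableOn (fun y : ℝ × ℝ => profile p q b y.2) (strip L) := by
  rw [IntegrableOn, volume_restrict_strip]
  exact (integrable_profile hb).comp_snd _

lemma setIntegral_strip_profile {L : ℝ} (hL : 0 < L) (hp : 0 ≤ p) (hq : 0 ≤ q) (hb : 0 < b) :
    ∫ y in strip L, profile p q b y.2 = L * (p + q + 1 + 1 / b) := by
  rw [volume_restrict_strip, integral_fun_snd (f := profile p q b), integral_profile hp hq hb]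
  simp [hL.le]

/-- A function below the profile has a controlled integral against every cutoff. -/
lemma setIntegral_mul_cutoff_le_profile {L : ℝ} (hL : 0 < L) (hp : 0 ≤ p) (hq : 0 ≤ q) (hb : 0 < b)
    {G : ℝ × ℝ → ℝ} (hG : Continuous G) (hle : ∀ y, G y ≤ profile p q b y.2) {R : ℝ} (hR : 0 < R) :
    ∫ y in strip L, G y * cutoff R y.2 ≤ L * (p + q + 1 + 1 / b) := by
  rw [← setIntegral_strip_profile hL hp hq hb]
  refine integral_mono ?_ (integrableOn_strip_profile L hb) fun y => ?_
  · exact integrableOn_slice_mul_cutoff (t := 0) (g := fun _ x z => G (x, z)) hG hR L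
  · calc G y * cutoff R y.2 ≤ profile p q b y.2 * cutoff R y.2 :=
        mul_le_mul_of_nonneg_right (hle y) (cutoff_nonneg _ _)
      _ ≤ profile p q b y.2 := mul_le_of_le_one_right (profile_nonneg _ _ _ _) (cutoff_le_one _ _)

end Profile

/-! ### Bounds for the temperature -/

/-- A solution with concave KPP nonlinearity, together with explicit front-like bounds on the initial
temperature. The decay rate `β` at `-∞` is normalized by `β ≤ 1`. -/
structure IsFrontSolution (L σ ρ : ℝ) (f : ℝ → ℝ) (m M α α' β : ℝ) (T u w ω : ScalarField) :
    Prop where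
  L_pos : 0 < L
  σ_pos : 0 < σ
  kpp : IsConcaveKPP f m M
  sol : IsSolution L σ ρ f T u w ω
  nonneg : ∀ x z, 0 ≤ T 0 x z
  le_one : ∀ x z, T 0 x z ≤ 1
  β_pos : 0 < β
  β_le_one : β ≤ 1
  upper : ∀ x z, T 0 x z ≤ Real.exp (α - z)
  lower : ∀ x z, 1 - T 0 x z ≤ Real.exp (α' + β * z)

/-- The contribution of the initial temperature to the bounds on the burnt mass. -/
noncomputable def frontConst (m α α' β : ℝ) : ℝ := |α| + (|α'| + m) / β + 1 + 1 / β

namespace IsFrontSolution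

variable {L σ ρ m M α α' β t : ℝ} {f : ℝ → ℝ} {T u w ω : ScalarField}

lemma mem_Icc (h : IsFrontSolution L σ ρ f m M α α' β T u w ω) (ht : 0 ≤ t) (x z : ℝ) :
    T t x z ∈ Icc (0 : ℝ) 1 :=
  ⟨h.sol.nonneg_T h.L_pos h.kpp h.nonneg ht x z, h.sol.T_le_one h.L_pos h.kpp h.le_one ht x z⟩

lemma abs_le_one (h : IsFrontSolution L σ ρ f m M α α' β T u w ω) (ht : 0 ≤ t) (x z : ℝ) :
    |T t x z| ≤ 1 := by
  have := h.mem_Icc ht x z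
  rw [abs_of_nonneg this.1]
  exact this.2

lemma frontConst_nonneg (h : IsFrontSolution L σ ρ f m M α α' β T u w ω) :
    0 ≤ frontConst m α α' β := by
  have := h.kpp.m_nonneg
  have := h.β_pos
  unfold frontConst
  positivity

lemma transportOp_T (h : IsFrontSolution L σ ρ f m M α α' β T u w ω) (ht : 0 < t) (x z : ℝ) :
    transportOp 1 u w T t x z = f (T t x z) := by
  rw [transportOp, one_mul, h.sol.temperature_eq t ht x z]

lemma le_exp_of_lt (h : IsFrontSolution L σ ρ f m M α α' β T u w ω) (ht : 0 ≤ t) (x z : ℝ) :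
    T t x z ≤ Real.exp ((|α| + 2 * t + drift w t) - z) :=
  (h.sol.T_le_exp h.L_pos h.kpp h.nonneg h.le_one h.upper ht x z).trans
    (Real.exp_le_exp.2 (by linarith [le_abs_self α]))

lemma continuous_slice_T (h : IsFrontSolution L σ ρ f m M α α' β T u w ω) (ht : 0 ≤ t) :
    Continuous fun p : ℝ × ℝ => T t p.1 p.2 :=
  h.sol.classical_T.continuousOn.comp_continuous
    (f := fun p : ℝ × ℝ => ((t, p) : ℝ × ℝ × ℝ)) (by fun_prop) fun _ => ⟨ht, mem_univ _⟩

lemma continuousOn_reaction (h : IsFrontSolution L σ ρ f m M α α' β T u w ω) :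
    ContinuousOn (fun p : ℝ × ℝ × ℝ => f (T p.1 p.2.1 p.2.2)) (Ioi 0 ×ˢ univ) :=
  (h.sol.classical_T.comp (h.kpp.contDiff_nat 2)).smooth.continuousOn

/-- The burnt mass gained until time `t`, seen through a cutoff. -/
lemma setIntegral_sub_mul_cutoff_le (h : IsFrontSolution L σ ρ f m M α α' β T u w ω) (ht : 0 ≤ t)
    {R : ℝ} (hR : 0 < R) :
    ∫ p in strip L, (T t p.1 p.2 - T 0 p.1 p.2) * cutoff R p.2
      ≤ L * (2 * t + drift w t + frontConst m α α' β) := by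
  have hβ := h.β_pos
  have hm := h.kpp.m_nonneg
  have hA := drift_nonneg w ht
  have hq : 0 ≤ |α| + 2 * t + drift w t := by positivity
  have hp : 0 ≤ |α'| / β := by positivity
  refine (setIntegral_mul_cutoff_le_profile h.L_pos hp hq hβ
    (G := fun p => T t p.1 p.2 - T 0 p.1 p.2)
    ((h.continuous_slice_T ht).sub (h.continuous_slice_T le_rfl)) (fun p => ?_) hR).trans ?_
  · have a1 := h.mem_Icc ht p.1 p.2
    have a0 := h.mem_Icc le_rfl p.1 p.2
    refine le_profile (by linarith) (by linarith [a1.2, a0.1]) (fun hz => ?_) (fun hz => ?_)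
    · have := h.lower p.1 p.2
      have e : Real.exp (α' + β * p.2) ≤ Real.exp (β * (p.2 + |α'| / β)) := by
        refine Real.exp_le_exp.2 ?_
        rw [mul_add, mul_div_cancel₀ _ hβ.ne']
        linarith [le_abs_self α']
      linarith [a1.2]
    · linarith [h.le_exp_of_lt ht p.1 p.2, a0.1]
  · refine mul_le_mul_of_nonneg_left ?_ h.L_pos.le
    unfold frontConst
    have : |α'| / β ≤ (|α'| + m) / β := by gcongr; linarith
    linarith

/-- The amount of reaction at time `t`, bounded by the width of the reaction zone. -/
lemma reaction_le_profile (h : IsFrontSolution L σ ρ f m M α α' β T u w ω) (ht : 0 ≤ t) (x z : ℝ) :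
    f (T t x z) ≤ profile ((|α'| + m) / β + t + drift w t) (|α| + 2 * t + drift w t) β z := by
  have hβ := h.β_pos
  have hm := h.kpp.m_nonneg
  have hA := drift_nonneg w ht
  have hq : 0 ≤ |α| + 2 * t + drift w t := by positivity
  have hp : 0 ≤ (|α'| + m) / β + t + drift w t := by positivity
  have a1 := h.mem_Icc ht x z
  refine le_profile (by linarith) (h.kpp.le_one a1) (fun hz => ?_) (fun hz => ?_)
  · have b1 := h.kpp.le_slope a1
    have b2 := h.sol.one_sub_T_le_exp h.L_pos h.kpp h.nonneg h.le_one hβ h.lower ht x z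
    have b3 : m ≤ Real.exp m := by linarith [Real.add_one_le_exp m]
    calc f (T t x z) ≤ m * (1 - T t x z) := b1
      _ ≤ Real.exp m * Real.exp (α' + β * z + β ^ 2 * t + β * drift w t) :=
        mul_le_mul b3 b2 (by linarith [a1.2]) (Real.exp_pos _).le
      _ ≤ Real.exp (β * (z + ((|α'| + m) / β + t + drift w t))) := by
        rw [← Real.exp_add]
        refine Real.exp_le_exp.2 ?_
        have e : β * (z + ((|α'| + m) / β + t + drift w t))
            = β * z + (|α'| + m) + β * t + β * drift w t := by field_simp; ring
        have e2 : β ^ 2 * t ≤ β * t := by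
          refine mul_le_mul_of_nonneg_right ?_ ht
          nlinarith [h.β_le_one]
        linarith [le_abs_self α']
  · exact (h.kpp.le_self _ a1).trans (h.le_exp_of_lt ht x z)

lemma setIntegral_reaction_mul_cutoff_le (h : IsFrontSolution L σ ρ f m M α α' β T u w ω)
    (ht : 0 ≤ t) {R : ℝ} (hR : 0 < R) :
    ∫ p in strip L, f (T t p.1 p.2) * cutoff R p.2
      ≤ L * (3 * t + 2 * drift w t + frontConst m α α' β) := by
  have hβ := h.β_pos
  have hm := h.kpp.m_nonneg
  have hA := drift_nonneg w ht
  have hq : 0 ≤ |α| + 2 * t + drift w t := by positivity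
  have hp : 0 ≤ (|α'| + m) / β + t + drift w t := by positivity
  refine (setIntegral_mul_cutoff_le_profile h.L_pos hp hq hβ
    (G := fun p => f (T t p.1 p.2))
    ((h.kpp.contDiff_nat 1).continuous.comp (h.continuous_slice_T ht))
    (fun p => h.reaction_le_profile ht p.1 p.2) hR).trans (le_of_eq ?_)
  unfold frontConst
  ring

/-- The space-time integral of the reaction is at most the gain of burnt mass. -/
lemma reaction_cutoff_bound (h : IsFrontSolution L σ ρ f m M α α' β T u w ω) (ht : 0 < t) {ε : ℝ}
    (hε : 0 < ε) : ∃ R₀ > 0, ∀ R, R₀ ≤ R → ∀ᶠ τ in 𝓝[>] 0,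
      ∫ s in τ..t, ∫ p in strip L, f (T s p.1 p.2) * cutoff R p.2
        ≤ L * (2 * t + drift w t + frontConst m α α' β) + ε := by
  obtain ⟨R₀, hR₀, hR⟩ := exists_weak_form (t := t) (κ := 1) h.L_pos zero_le_one
    h.sol.classical_u h.sol.classical_w h.sol.classical_T h.sol.periodic_u h.sol.periodic_T
    h.sol.decaying_w h.sol.incompressible one_pos (fun s hs x z => h.abs_le_one hs.1 x z)
    (ε := ε / (2 * t)) (by positivity)
  refine ⟨R₀, hR₀, fun R hRR => ?_⟩
  have hR0 := hR₀.trans_le hRR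
  have hlim := tendsto_setIntegral_mul_cutoff (L := L) h.sol.classical_T hR0
  have hint : ∀ s, 0 ≤ s → IntegrableOn (fun p : ℝ × ℝ => T s p.1 p.2 * cutoff R p.2) (strip L) :=
    fun s hs => integrableOn_slice_mul_cutoff (h.continuous_slice_T hs) hR0 L
  filter_upwards [hlim.eventually_const_lt (sub_lt_self _ (half_pos hε)),
    Ioo_mem_nhdsGT ht] with τ hτ1 hτ
  have h1 := (abs_le.1 ((hR R hRR).2 τ hτ.1 hτ.2.le)).2
  have h2 := h.setIntegral_sub_mul_cutoff_le ht.le hR0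
  simp_rw [sub_mul] at h1 h2
  rw [integral_sub (hint t ht.le) (hint τ hτ.1.le)] at h1
  rw [integral_sub (hint t ht.le) (hint 0 le_rfl)] at h2
  have e : ∫ s in τ..t, ∫ p in strip L, transportOp 1 u w T s p.1 p.2 * cutoff R p.2
      = ∫ s in τ..t, ∫ p in strip L, f (T s p.1 p.2) * cutoff R p.2 := by
    refine intervalIntegral.integral_congr fun s hs => ?_
    rw [uIcc_of_le hτ.2.le] at hs
    simp only [h.transportOp_T (hτ.1.trans_le hs.1)]
  rw [e] at h1
  have e2 : ε / (2 * t) * t = ε / 2 := by field_simp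
  rw [e2] at h1
  linarith

lemma lintegral_reaction_le (h : IsFrontSolution L σ ρ f m M α α' β T u w ω) (ht : 0 < t) :
    ∫⁻ s in Ioc 0 t, ∫⁻ p in strip L, ENNReal.ofReal (f (T s p.1 p.2))
      ≤ ENNReal.ofReal (L * (2 * t + drift w t + frontConst m α α' β)) :=
  lintegral_le_of_cutoff (F := fun s x z => f (T s x z)) ht h.continuousOn_reaction
    (fun _ hs x z => h.kpp.nonneg _ (h.mem_Icc hs.le x z))
    fun _ hε => h.reaction_cutoff_bound ht hε

/-- By strict concavity, testing the temperature equation with `f'(T)` controls the gradient. -/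
lemma gradSq_le_transportOp (h : IsFrontSolution L σ ρ f m M α α' β T u w ω) (ht : 0 < t)
    (x z : ℝ) : M * (dx T t x z ^ 2 + dz T t x z ^ 2)
      ≤ transportOp 1 u w (fun t x z => f (T t x z)) t x z + m * f (T t x z) := by
  rw [transportOp_comp h.sol.classical_T (h.kpp.contDiff_nat 2) ht, h.transportOp_T ht]
  have a1 := h.mem_Icc ht.le x z
  have a2 := h.kpp.concave _ a1
  have a3 := h.kpp.slope _ a1
  have a4 := h.kpp.nonneg _ a1
  nlinarith [mul_nonneg (sub_nonneg.2 a2)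
    (add_nonneg (sq_nonneg (dx T t x z)) (sq_nonneg (dz T t x z))),
    mul_nonneg (sub_nonneg.2 a3) a4]

/-- The bound on the space-time integral of `|∇T|²` in terms of the drift. -/
lemma lintegral_gradSq_le (h : IsFrontSolution L σ ρ f m M α α' β T u w ω) (ht : 0 < t) :
    ∫⁻ s in Ioc 0 t, ∫⁻ p in strip L, ENNReal.ofReal (dx T s p.1 p.2 ^ 2 + dz T s p.1 p.2 ^ 2)
      ≤ ENNReal.ofReal (L * ((m + 2) * drift w t + (2 * m + 3) * t
          + (m + 1) * frontConst m α α' β) / M) := by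
  have hM := h.kpp.M_pos
  have hm := h.kpp.m_nonneg
  have hfT := h.sol.classical_T.comp (h.kpp.contDiff_nat 2)
  have cx := h.sol.classical_T.smooth_dx.continuousOn
  have cz := h.sol.classical_T.smooth_dz.continuousOn
  have cg : ContinuousOn (fun p : ℝ × ℝ × ℝ =>
      dx T p.1 p.2.1 p.2.2 ^ 2 + dz T p.1 p.2.1 p.2.2 ^ 2) (Ioi 0 ×ˢ univ) :=
    (cx.pow 2).add (cz.pow 2)
  have cop := continuousOn_transportOp h.sol.classical_u h.sol.classical_w hfT 1
  have crhs : ContinuousOn (fun p : ℝ × ℝ × ℝ => transportOp 1 u w (fun t x z => f (T t x z))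
      p.1 p.2.1 p.2.2 + m * f (T p.1 p.2.1 p.2.2)) (Ioi 0 ×ˢ univ) :=
    cop.add (continuousOn_const.mul h.continuousOn_reaction)
  refine lintegral_le_of_cutoff (F := fun s x z => dx T s x z ^ 2 + dz T s x z ^ 2) ht cg
    (fun _ _ _ _ => by positivity) fun ε hε => ?_
  set δ := ε * M / (m + 1) with hδ
  have hδ0 : 0 < δ := by positivity
  obtain ⟨R₁, hR₁, h1⟩ := h.reaction_cutoff_bound ht hδ0
  obtain ⟨R₂, hR₂, h2⟩ := exists_weak_form (t := t) (κ := 1) h.L_pos zero_le_one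
    h.sol.classical_u h.sol.classical_w hfT h.sol.periodic_u (h.sol.periodic_T.comp f)
    h.sol.decaying_w h.sol.incompressible one_pos
    (fun s hs x z => by
      have a1 := h.mem_Icc hs.1 x z
      rw [abs_of_nonneg (h.kpp.nonneg _ a1)]
      exact h.kpp.le_one a1)
    (ε := δ / t) (by positivity)
  refine ⟨max R₁ R₂, by positivity, fun R hRR => ?_⟩
  have hR1 := (le_max_left _ _).trans hRR
  have hR2 := (le_max_right _ _).trans hRR
  have hR0 := hR₁.trans_le hR1
  filter_upwards [h1 R hR1, Ioo_mem_nhdsGT ht] with τ hτ1 hτ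
  have hτ0 := hτ.1
  have hτt := hτ.2.le
  have b1 := (abs_le.1 ((h2 R hR2).2 τ hτ0 hτt)).2
  rw [div_mul_cancel₀ _ ht.ne'] at b1
  -- `f (T τ)` is nonnegative, so only the reaction at the final time matters.
  have b2 : ∫ p in strip L, (f (T t p.1 p.2) - f (T τ p.1 p.2)) * cutoff R p.2
      ≤ L * (3 * t + 2 * drift w t + frontConst m α α' β) := by
    refine le_trans (integral_mono ?_ ?_ fun p => ?_)
      (h.setIntegral_reaction_mul_cutoff_le ht.le hR0)
    · exact integrableOn_slice_mul_cutoff (t := t)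
        (g := fun t x z => f (T t x z) - f (T τ x z))
        (((h.kpp.contDiff_nat 1).continuous.comp (h.continuous_slice_T ht.le)).sub
          ((h.kpp.contDiff_nat 1).continuous.comp (h.continuous_slice_T hτ0.le))) hR0 L
    · exact integrableOn_slice_mul_cutoff (t := t) (g := fun t x z => f (T t x z))
        ((h.kpp.contDiff_nat 1).continuous.comp (h.continuous_slice_T ht.le)) hR0 L
    · exact mul_le_mul_of_nonneg_right
        (sub_le_self _ (h.kpp.nonneg _ (h.mem_Icc hτ0.le _ _))) (cutoff_nonneg _ _)
  have iop := intervalIntegrable_setIntegral_mul_cutoff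
    (g := transportOp 1 u w fun t x z => f (T t x z)) cop hR0 hτ0 hτt L
  have ire := intervalIntegrable_setIntegral_mul_cutoff
    (g := fun t x z => f (T t x z)) h.continuousOn_reaction hR0 hτ0 hτt L
  have igr := intervalIntegrable_setIntegral_mul_cutoff
    (g := fun s x z => dx T s x z ^ 2 + dz T s x z ^ 2) cg hR0 hτ0 hτt L
  have b3 : M * ∫ s in τ..t, ∫ p in strip L,
        (dx T s p.1 p.2 ^ 2 + dz T s p.1 p.2 ^ 2) * cutoff R p.2
      ≤ (∫ s in τ..t, ∫ p in strip L,
          transportOp 1 u w (fun t x z => f (T t x z)) s p.1 p.2 * cutoff R p.2)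
        + m * ∫ s in τ..t, ∫ p in strip L, f (T s p.1 p.2) * cutoff R p.2 := by
    rw [← intervalIntegral.integral_const_mul, ← intervalIntegral.integral_const_mul,
      ← intervalIntegral.integral_add iop (ire.const_mul m)]
    refine intervalIntegral.integral_mono_on hτt (igr.const_mul M) (iop.add (ire.const_mul m))
      fun s hs => ?_
    have hs0 : 0 < s := hτ0.trans_le hs.1
    have jop := integrableOn_slice_mul_cutoff (continuous_slice cop hs0) hR0 L
    have jre := integrableOn_slice_mul_cutoff (g := fun t x z => f (T t x z)) (t := s)
      (continuous_slice (g := fun t x z => f (T t x z)) h.continuousOn_reaction hs0) hR0 L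
    have jgr := integrableOn_slice_mul_cutoff (g := fun s x z => dx T s x z ^ 2 + dz T s x z ^ 2)
      (t := s) (continuous_slice (g := fun s x z => dx T s x z ^ 2 + dz T s x z ^ 2) cg hs0) hR0 L
    rw [← integral_const_mul, ← integral_const_mul, ← integral_add jop (jre.const_mul m)]
    refine integral_mono (jgr.const_mul M) (jop.add (jre.const_mul m)) fun p => ?_
    have := mul_le_mul_of_nonneg_right (h.gradSq_le_transportOp hs0 p.1 p.2)
      (cutoff_nonneg R p.2)
    simp only
    linarith
  have b4 : M * ∫ s in τ..t, ∫ p in strip L,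
        (dx T s p.1 p.2 ^ 2 + dz T s p.1 p.2 ^ 2) * cutoff R p.2
      ≤ L * ((m + 2) * drift w t + (2 * m + 3) * t + (m + 1) * frontConst m α α' β)
        + (m + 1) * δ := by
    have := mul_le_mul_of_nonneg_left hτ1 hm
    linarith
  have e : (m + 1) * δ = ε * M := by rw [hδ]; field_simp
  rw [e] at b4
  have e2 : L * ((m + 2) * drift w t + (2 * m + 3) * t + (m + 1) * frontConst m α α' β) / M + ε
      = (L * ((m + 2) * drift w t + (2 * m + 3) * t + (m + 1) * frontConst m α α' β) + ε * M) / M :=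
    by field_simp
  rw [e2, le_div_iff₀ hM]
  linarith

/-! ### The bulk burning rate -/

lemma integrableOn_reaction (h : IsFrontSolution L σ ρ f m M α α' β T u w ω) (ht : 0 ≤ t) :
    IntegrableOn (fun p : ℝ × ℝ => f (T t p.1 p.2)) (strip L) := by
  refine Integrable.mono' (integrableOn_strip_profile (p := (|α'| + m) / β + t + drift w t)
    (q := |α| + 2 * t + drift w t) L h.β_pos) ((h.kpp.contDiff_nat 1).continuous.comp
      (h.continuous_slice_T ht)).aestronglyMeasurable
    (Eventually.of_forall fun p => ?_)
  rw [Real.norm_eq_abs, abs_of_nonneg (h.kpp.nonneg _ (h.mem_Icc ht _ _))]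
  exact h.reaction_le_profile ht p.1 p.2

lemma tendsto_setIntegral_mul_cutoff_atTop {G : ℝ × ℝ → ℝ} (hG : IntegrableOn G (strip L)) :
    Tendsto (fun R => ∫ p in strip L, G p * cutoff R p.2) atTop (𝓝 (∫ p in strip L, G p)) := by
  refine tendsto_integral_filter_of_dominated_convergence (fun p => ‖G p‖)
    (Eventually.of_forall fun R => ?_) (Eventually.of_forall fun R => Eventually.of_forall fun p =>
      ?_) hG.norm (Eventually.of_forall fun p => ?_)
  · exact hG.aestronglyMeasurable.mul
      ((contDiff_cutoff R).continuous.comp continuous_snd).aestronglyMeasurable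
  · rw [norm_mul, Real.norm_of_nonneg (cutoff_nonneg _ _)]
    exact mul_le_of_le_one_right (norm_nonneg _) (cutoff_le_one _ _)
  · simpa using (tendsto_cutoff_atTop p.2).const_mul (G p)

/-- The bulk burning rate is the normalized integral of the reaction. -/
lemma burningRate_eq (h : IsFrontSolution L σ ρ f m M α α' β T u w ω) (ht : 0 < t)
    (hi : IntegrableOn (fun p : ℝ × ℝ => dt T t p.1 p.2) (strip L)) :
    burningRate L T t = 1 / L * ∫ p in strip L, f (T t p.1 p.2) := by
  rw [burningRate]
  congr 1
  have l1 := tendsto_setIntegral_mul_cutoff_atTop hi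
  have l2 := tendsto_setIntegral_mul_cutoff_atTop (h.integrableOn_reaction ht.le)
  refine (sub_eq_zero.1 (tendsto_nhds_unique (l2.sub l1) ?_)).symm
  rw [Metric.tendsto_atTop]
  intro ε hε
  obtain ⟨R₀, hR₀, hR⟩ := exists_weak_form (t := t) (κ := 1) h.L_pos zero_le_one
    h.sol.classical_u h.sol.classical_w h.sol.classical_T h.sol.periodic_u h.sol.periodic_T
    h.sol.decaying_w h.sol.incompressible one_pos (fun s hs x z => h.abs_le_one hs.1 x z)
    (half_pos hε)
  refine ⟨R₀, fun R hRR => ?_⟩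
  have h1 := (hR R hRR).1 t ⟨ht, le_rfl⟩
  simp only [h.transportOp_T ht] at h1
  rw [Real.dist_eq, sub_zero]
  linarith

/-- The bulk burning rate is integrable in time, and its integral is at most the gain of burnt
mass. -/
lemma burningRate_integral (h : IsFrontSolution L σ ρ f m M α α' β T u w ω)
    (hi : ∀ t : ℝ, 0 < t → IntegrableOn (fun p : ℝ × ℝ => dt T t p.1 p.2) (strip L))
    (ht : 0 < t) : IntervalIntegrable (burningRate L T) volume 0 t ∧
      ∫ s in (0 : ℝ)..t, burningRate L T s ≤ 2 * t + drift w t + frontConst m α α' β := by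
  have hL := h.L_pos
  have hint : Integrable (fun q : ℝ × ℝ × ℝ => f (T q.1 q.2.1 q.2.2))
      ((volume.restrict (Ioc 0 t)).prod (volume.restrict (strip L))) := by
    refine ⟨(aemeasurable_spaceTime (F := fun s x z => f (T s x z))
      h.continuousOn_reaction L t).aestronglyMeasurable, ?_⟩
    rw [hasFiniteIntegral_iff_ofReal]
    · rw [← lintegral_spaceTime (F := fun s x z => f (T s x z)) h.continuousOn_reaction]
      exact (h.lintegral_reaction_le ht).trans_lt ENNReal.ofReal_lt_top
    · rw [Measure.prod_restrict]
      refine (ae_restrict_iff' (measurableSet_Ioc.prod (measurableSet_strip L))).2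
        (Eventually.of_forall fun q hq => ?_)
      exact h.kpp.nonneg _ (h.mem_Icc hq.1.1.le _ _)
  have e : ∀ s ∈ Ioc 0 t, burningRate L T s = 1 / L * ∫ p in strip L, f (T s p.1 p.2) :=
    fun s hs => h.burningRate_eq hs.1 (hi s hs.1)
  have hint' : IntegrableOn (fun s => 1 / L * ∫ p in strip L, f (T s p.1 p.2)) (Ioc 0 t) :=
    hint.integral_prod_left.const_mul (1 / L)
  constructor
  · rw [intervalIntegrable_iff_integrableOn_Ioc_of_le ht.le]
    exact hint'.congr_fun (fun s hs => (e s hs).symm) measurableSet_Ioc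
  · rw [intervalIntegral.integral_of_le ht.le, setIntegral_congr_fun measurableSet_Ioc e,
      integral_const_mul, ← integral_prod _ hint]
    have h1 : ∫ q, f (T q.1 q.2.1 q.2.2)
        ∂((volume.restrict (Ioc 0 t)).prod (volume.restrict (strip L)))
        ≤ L * (2 * t + drift w t + frontConst m α α' β) := by
      refine (ENNReal.ofReal_le_ofReal_iff ?_).1 ?_
      · have := drift_nonneg w ht.le
        have := h.frontConst_nonneg
        positivity
      · rw [ofReal_integral_eq_lintegral_ofReal hint,
          ← lintegral_spaceTime (F := fun s x z => f (T s x z)) h.continuousOn_reaction]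
        · exact h.lintegral_reaction_le ht
        · rw [Measure.prod_restrict]
          refine (ae_restrict_iff' (measurableSet_Ioc.prod (measurableSet_strip L))).2
            (Eventually.of_forall fun q hq => ?_)
          exact h.kpp.nonneg _ (h.mem_Icc hq.1.1.le _ _)
    calc _ ≤ 1 / L * (L * (2 * t + drift w t + frontConst m α α' β)) := by gcongr
      _ = _ := by field_simp

end IsFrontSolution

/-! ### One-dimensional inequalities -/

section OneDim

variable {L : ℝ}

/-- The Cauchy–Schwarz inequality on an interval. -/
lemma sq_integral_abs_le {v : ℝ → ℝ} (hL : 0 < L) (hv : Continuous v) :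
    (∫ x in (0 : ℝ)..L, |v x|) ^ 2 ≤ L * ∫ x in (0 : ℝ)..L, v x ^ 2 := by
  set c := (∫ x in (0 : ℝ)..L, |v x|) / L with hc
  have h1 : 0 ≤ ∫ x in (0 : ℝ)..L, (|v x| - c) ^ 2 :=
    intervalIntegral.integral_nonneg hL.le fun _ _ => sq_nonneg _
  have e : (fun x => (|v x| - c) ^ 2) = fun x => v x ^ 2 - 2 * c * |v x| + c ^ 2 := by
    funext x
    rw [sub_sq, sq_abs]; ring
  have i1 : IntervalIntegrable (fun x => v x ^ 2) volume 0 L := (hv.pow 2).intervalIntegrable _ _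
  have i2 : IntervalIntegrable (fun x => 2 * c * |v x|) volume 0 L :=
    (continuous_const.mul hv.abs).intervalIntegrable _ _
  rw [e, intervalIntegral.integral_add (i1.sub i2) (by simp), intervalIntegral.integral_sub i1 i2,
    intervalIntegral.integral_const_mul, intervalIntegral.integral_const, smul_eq_mul,
    sub_zero] at h1
  have e2 : ∫ x in (0 : ℝ)..L, |v x| = c * L := by rw [hc, div_mul_cancel₀ _ hL.ne']
  rw [e2] at h1 ⊢
  nlinarith

lemma abs_sub_le_integral_abs {a a' : ℝ → ℝ} (ha : ∀ x, HasDerivAt a (a' x) x)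
    (ha' : Continuous a') {x y : ℝ} (hx : x ∈ Icc 0 L) (hy : y ∈ Icc 0 L) :
    |a x - a y| ≤ ∫ s in (0 : ℝ)..L, |a' s| := by
  rw [← intervalIntegral.integral_eq_sub_of_hasDerivAt (fun s _ => ha s)
    (ha'.intervalIntegrable y x)]
  have h1 := intervalIntegral.norm_integral_le_integral_norm_uIoc (f := a') (a := y) (b := x)
    (μ := volume)
  refine h1.trans ?_
  rw [intervalIntegral.integral_of_le (hx.1.trans hx.2)]
  refine setIntegral_mono_set ?_ (Eventually.of_forall fun s => abs_nonneg _)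
    (LE.le.eventuallyLE ?_)
  · exact (ha'.abs.continuousOn.integrableOn_compact isCompact_Icc).mono_set Ioc_subset_Icc_self
  · exact Ioc_subset_Ioc (le_min hy.1 hx.1) (max_le hy.2 hx.2)

lemma exists_zero_of_integral_eq_zero {a : ℝ → ℝ} (hL : 0 < L) (ha : Continuous a)
    (h0 : ∫ x in (0 : ℝ)..L, a x = 0) : ∃ y ∈ Icc 0 L, a y = 0 := by
  have hd : ∀ y, HasDerivAt (fun y => ∫ x in (0 : ℝ)..y, a x) (a y) y := fun y =>
    ha.integral_hasStrictDerivAt 0 y |>.hasDerivAt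
  obtain ⟨y, hy, h⟩ := exists_hasDerivAt_eq_zero hL
    (fun y _ => (hd y).continuousAt.continuousWithinAt) (by simp [h0]) (fun y _ => hd y)
  exact ⟨y, Ioo_subset_Icc_self hy, h⟩

/-- The Poincaré inequality in the uniform norm for functions of mean zero. -/
lemma sq_le_of_integral_eq_zero {a a' : ℝ → ℝ} (hL : 0 < L) (ha : ∀ x, HasDerivAt a (a' x) x)
    (ha' : Continuous a') (h0 : ∫ x in (0 : ℝ)..L, a x = 0) {x : ℝ} (hx : x ∈ Icc 0 L) :
    a x ^ 2 ≤ L * ∫ s in (0 : ℝ)..L, a' s ^ 2 := by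
  have hc : Continuous a := continuous_iff_continuousAt.2 fun x => (ha x).continuousAt
  obtain ⟨y, hy, hy0⟩ := exists_zero_of_integral_eq_zero hL hc h0
  have h1 := abs_sub_le_integral_abs ha ha' hx hy
  rw [hy0, sub_zero] at h1
  calc a x ^ 2 = |a x| ^ 2 := (sq_abs _).symm
    _ ≤ (∫ s in (0 : ℝ)..L, |a' s|) ^ 2 := by gcongr
    _ ≤ _ := sq_integral_abs_le hL ha'

/-- The pairing of `a` with `b'` is controlled by derivatives only: constants may be subtracted from
`a` since `b'` has mean zero. -/
lemma two_mul_integral_mul_deriv_le {a a' b b' : ℝ → ℝ} {ρ : ℝ} (hL : 0 < L)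
    (ha : ∀ x, HasDerivAt a (a' x) x) (ha' : Continuous a') (hb : ∀ x, HasDerivAt b (b' x) x)
    (hb' : Continuous b') (hper : b L = b 0) :
    2 * ρ * ∫ x in (0 : ℝ)..L, a x * b' x
      ≤ (∫ x in (0 : ℝ)..L, a' x ^ 2) + ρ ^ 2 * L ^ 2 * ∫ x in (0 : ℝ)..L, b' x ^ 2 := by
  have hc : Continuous a := continuous_iff_continuousAt.2 fun x => (ha x).continuousAt
  set A := ∫ x in (0 : ℝ)..L, |a' x| with hA
  set B := ∫ x in (0 : ℝ)..L, |b' x| with hB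
  have hA2 := sq_integral_abs_le hL ha'
  have hB2 := sq_integral_abs_le hL hb'
  rw [← hA] at hA2
  rw [← hB] at hB2
  have hmean : ∫ x in (0 : ℝ)..L, b' x = 0 := by
    rw [intervalIntegral.integral_eq_sub_of_hasDerivAt (fun s _ => hb s)
      (hb'.intervalIntegrable 0 L), hper, sub_self]
  have e : ∫ x in (0 : ℝ)..L, a x * b' x = ∫ x in (0 : ℝ)..L, (a x - a 0) * b' x := by
    have i1 : IntervalIntegrable (fun x => a x * b' x) volume 0 L :=
      (hc.mul hb').intervalIntegrable _ _
    have i2 : IntervalIntegrable (fun x => a 0 * b' x) volume 0 L :=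
      (continuous_const.mul hb').intervalIntegrable _ _
    simp_rw [sub_mul]
    rw [intervalIntegral.integral_sub i1 i2, intervalIntegral.integral_const_mul,
      hmean, mul_zero, sub_zero]
  have hAB : |∫ x in (0 : ℝ)..L, a x * b' x| ≤ A * B := by
    rw [e]
    refine (intervalIntegral.abs_integral_le_integral_abs hL.le).trans ?_
    rw [hB, ← intervalIntegral.integral_const_mul]
    refine intervalIntegral.integral_mono_on hL.le
      ((((hc.sub continuous_const).mul hb').abs).intervalIntegrable _ _)
      ((continuous_const.mul hb'.abs).intervalIntegrable _ _) fun x hx => ?_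
    rw [abs_mul]
    exact mul_le_mul_of_nonneg_right
      (abs_sub_le_integral_abs ha ha' hx ⟨le_rfl, hL.le⟩) (abs_nonneg _)
  have h1 : 2 * ρ * ∫ x in (0 : ℝ)..L, a x * b' x ≤ 2 * |ρ| * (A * B) := by
    calc 2 * ρ * ∫ x in (0 : ℝ)..L, a x * b' x
        ≤ |2 * ρ * ∫ x in (0 : ℝ)..L, a x * b' x| := le_abs_self _
      _ = 2 * |ρ| * |∫ x in (0 : ℝ)..L, a x * b' x| := by
          rw [abs_mul, abs_mul, abs_two]
      _ ≤ 2 * |ρ| * (A * B) := by gcongr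
  refine h1.trans ?_
  -- Young's inequality `2 |ρ| A B ≤ A² / L + ρ² L B²`.
  have h2 : L * (2 * |ρ| * (A * B)) ≤ A ^ 2 + ρ ^ 2 * L ^ 2 * B ^ 2 := by
    have := sq_nonneg (A - |ρ| * L * B)
    rw [← sq_abs ρ]
    linarith
  have h3 : ρ ^ 2 * L ^ 2 * B ^ 2 ≤ ρ ^ 2 * L ^ 2 * (L * ∫ x in (0 : ℝ)..L, b' x ^ 2) := by
    gcongr
  refine le_of_mul_le_mul_left ?_ hL
  linarith

/-- Fubini's theorem on the strip. -/
lemma setIntegral_strip_eq {F : ℝ × ℝ → ℝ} (hL : 0 ≤ L) (hF : IntegrableOn F (strip L)) :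
    ∫ p in strip L, F p = ∫ z, ∫ x in (0 : ℝ)..L, F (x, z) := by
  rw [IntegrableOn, volume_restrict_strip] at hF
  rw [volume_restrict_strip, integral_prod_symm _ hF]
  simp_rw [intervalIntegral.integral_of_le hL, integral_Icc_eq_integral_Ioc]

end OneDim

/-! ### The enstrophy estimate -/

lemma lintegral_lt_top_of_normSqL2 {L : ℝ} {g : ℝ → ℝ → ℝ} (h : normSqL2 L g < ∞) :
    ∫⁻ p in strip L, ENNReal.ofReal (g p.1 p.2 ^ 2) < ∞ := by
  rw [lt_top_iff_ne_top]
  intro h2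
  rw [normSqL2, h2, ENNReal.mul_top (by simp)] at h
  exact lt_irrefl _ h

namespace IsSolution

variable {L σ ρ t : ℝ} {f : ℝ → ℝ} {T u w ω : ScalarField}

lemma transportOp_sq_vorticity (h : IsSolution L σ ρ f T u w ω) (ht : 0 < t) (x z : ℝ) :
    transportOp σ u w (fun t x z => ω t x z ^ 2) t x z
      = 2 * ω t x z * (σ * ρ * dx T t x z) - 2 * σ * (dx ω t x z ^ 2 + dz ω t x z ^ 2) := by
  have e1 : deriv (fun y : ℝ => y ^ 2) = fun y => 2 * y := by
    funext y; simp
  have e2 : deriv (fun y : ℝ => 2 * y) = fun _ => 2 := by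
    funext y; simp
  have h1 := transportOp_comp (κ := σ) (u := u) (w := w) h.classical_ω
    (φ := fun y => y ^ 2) (by fun_prop) ht x z
  rw [h1, e1, e2]
  have h2 : transportOp σ u w ω t x z = σ * ρ * dx T t x z := h.vorticity_eq t ht x z
  simp only [h2]
  ring

/-- The buoyancy torque `2 ρ ∫ ω ∂ₓT` is controlled by the `L²` norms of horizontal derivatives. -/
lemma setIntegral_torque_nonneg (h : IsSolution L σ ρ f T u w ω) (hL : 0 < L) (ht : 0 < t) {R : ℝ}
    (hR : 0 < R) :
    0 ≤ ∫ p in strip L, (dx ω t p.1 p.2 ^ 2 + ρ ^ 2 * L ^ 2 * dx T t p.1 p.2 ^ 2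
      - 2 * ρ * (ω t p.1 p.2 * dx T t p.1 p.2)) * cutoff R p.2 := by
  have c1 := (h.classical_ω.smooth_dx.slice ht).continuous
  have c2 := (h.classical_T.smooth_dx.slice ht).continuous
  have c3 := (h.classical_ω.smooth.slice ht).continuous
  rw [setIntegral_strip_eq hL.le (integrableOn_slice_mul_cutoff (t := t) (R := R)
    (g := fun t x z => dx ω t x z ^ 2 + ρ ^ 2 * L ^ 2 * dx T t x z ^ 2
      - 2 * ρ * (ω t x z * dx T t x z))
    (((c1.pow 2).add (continuous_const.mul (c2.pow 2))).sub
      (continuous_const.mul (c3.mul c2))) hR L)]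
  refine integral_nonneg fun z => ?_
  have d1 : Continuous fun x => dx ω t x z := c1.comp (by fun_prop : Continuous fun x => (x, z))
  have d2 : Continuous fun x => dx T t x z := c2.comp (by fun_prop : Continuous fun x => (x, z))
  have d3 : Continuous fun x => ω t x z := c3.comp (by fun_prop : Continuous fun x => (x, z))
  have i1 : IntervalIntegrable (fun x => dx ω t x z ^ 2) volume 0 L :=
    (d1.pow 2).intervalIntegrable _ _
  have i2 : IntervalIntegrable (fun x => ρ ^ 2 * L ^ 2 * dx T t x z ^ 2) volume 0 L :=
    (continuous_const.mul (d2.pow 2)).intervalIntegrable _ _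
  have i3 : IntervalIntegrable (fun x => 2 * ρ * (ω t x z * dx T t x z)) volume 0 L :=
    (continuous_const.mul (d3.mul d2)).intervalIntegrable _ _
  simp only [Pi.zero_apply]
  rw [intervalIntegral.integral_mul_const, intervalIntegral.integral_sub (i1.add i2) i3,
    intervalIntegral.integral_add i1 i2,
    intervalIntegral.integral_const_mul, intervalIntegral.integral_const_mul]
  refine mul_nonneg ?_ (cutoff_nonneg _ _)
  have := two_mul_integral_mul_deriv_le (ρ := ρ) hL
    (fun x => h.classical_ω.smooth.hasDerivAt_dx (by norm_num) ht x z) d1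
    (fun x => h.classical_T.smooth.hasDerivAt_dx (by norm_num) ht x z) d2
    (by simpa using h.periodic_T t ht.le 0 z)
  linarith

/-- The vorticity gradient is controlled by the temperature gradient and the initial enstrophy. -/
lemma lintegral_dx_vorticity_le (h : IsSolution L σ ρ f T u w ω) (hL : 0 < L) (hσ : 0 < σ)
    (ht : 0 < t) (hω : ∫⁻ p in strip L, ENNReal.ofReal (ω 0 p.1 p.2 ^ 2) ≠ ∞)
    (hT : ∫⁻ s in Ioc 0 t, ∫⁻ p in strip L, ENNReal.ofReal (dx T s p.1 p.2 ^ 2) ≠ ∞) :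
    ∫⁻ s in Ioc 0 t, ∫⁻ p in strip L, ENNReal.ofReal (dx ω s p.1 p.2 ^ 2)
      ≤ ENNReal.ofReal ((∫⁻ p in strip L, ENNReal.ofReal (ω 0 p.1 p.2 ^ 2)).toReal / σ
        + ρ ^ 2 * L ^ 2 *
          (∫⁻ s in Ioc 0 t, ∫⁻ p in strip L, ENNReal.ofReal (dx T s p.1 p.2 ^ 2)).toReal) := by
  set Ω := (∫⁻ p in strip L, ENNReal.ofReal (ω 0 p.1 p.2 ^ 2)).toReal with hΩ
  set X := (∫⁻ s in Ioc 0 t, ∫⁻ p in strip L, ENNReal.ofReal (dx T s p.1 p.2 ^ 2)).toReal with hX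
  have hω2 : IsClassical fun t x z => ω t x z ^ 2 :=
    h.classical_ω.comp (φ := fun y => y ^ 2) (by fun_prop)
  have pω2 : IsPeriodic L fun t x z => ω t x z ^ 2 := h.periodic_ω.comp fun y => y ^ 2
  have cx : ContinuousOn (fun p : ℝ × ℝ × ℝ => dx ω p.1 p.2.1 p.2.2 ^ 2) (Ioi 0 ×ˢ univ) :=
    h.classical_ω.smooth_dx.continuousOn.pow 2
  have cT : ContinuousOn (fun p : ℝ × ℝ × ℝ => dx T p.1 p.2.1 p.2.2 ^ 2) (Ioi 0 ×ˢ univ) :=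
    h.classical_T.smooth_dx.continuousOn.pow 2
  have cop := continuousOn_transportOp h.classical_u h.classical_w hω2 σ
  obtain ⟨B, hB, hωB⟩ := exists_bound hL h.classical_ω.continuousOn h.periodic_ω h.ω_bot h.ω_top t
  refine lintegral_le_of_cutoff (F := fun s x z => dx ω s x z ^ 2) ht cx
    (fun _ _ _ _ => sq_nonneg _) fun ε hε => ?_
  obtain ⟨R₀, hR₀, hR⟩ := exists_weak_form (t := t) (κ := σ) hL hσ.le
    h.classical_u h.classical_w hω2 h.periodic_u pω2 h.decaying_w h.incompressible
    (B := B ^ 2) (by positivity)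
    (fun s hs x z => by
      rw [abs_pow]
      have := hωB s hs x z
      gcongr)
    (ε := ε * σ / (2 * t)) (by positivity)
  refine ⟨R₀, hR₀, fun R hRR => ?_⟩
  have hR0 := hR₀.trans_le hRR
  have hlim := tendsto_setIntegral_mul_cutoff (L := L) hω2 hR0
  have c0 : Continuous fun p : ℝ × ℝ => ω 0 p.1 p.2 :=
    h.classical_ω.continuousOn.comp_continuous
      (f := fun p : ℝ × ℝ => (((0 : ℝ), p) : ℝ × ℝ × ℝ)) (by fun_prop)
      fun _ => ⟨self_mem_Ici, mem_univ _⟩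
  have hinit : ∫ p in strip L, ω 0 p.1 p.2 ^ 2 * cutoff R p.2 ≤ Ω := by
    refine (ENNReal.ofReal_le_iff_le_toReal hω).1 ?_
    rw [ofReal_integral_eq_lintegral_ofReal
      (integrableOn_slice_mul_cutoff (t := 0) (g := fun t x z => ω t x z ^ 2) (c0.pow 2) hR0 L)
      (Eventually.of_forall fun p => mul_nonneg (sq_nonneg _) (cutoff_nonneg _ _))]
    exact lintegral_mono fun p => ENNReal.ofReal_le_ofReal
      (mul_le_of_le_one_right (sq_nonneg _) (cutoff_le_one _ _))
  have hpos : 0 < ε * σ / 2 := by positivity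
  filter_upwards [hlim.eventually_lt_const (lt_add_of_pos_right _ hpos),
    Ioo_mem_nhdsGT ht] with τ hτ1 hτ
  have hτ0 := hτ.1
  have hτt := hτ.2.le
  have b1 := (abs_le.1 ((hR R hRR).2 τ hτ0 hτt)).1
  have e1 : ε * σ / (2 * t) * t = ε * σ / 2 := by field_simp
  rw [e1] at b1
  have b2 : -(∫ p in strip L, ω τ p.1 p.2 ^ 2 * cutoff R p.2)
      ≤ ∫ p in strip L, (ω t p.1 p.2 ^ 2 - ω τ p.1 p.2 ^ 2) * cutoff R p.2 := by
    have i1 := integrableOn_slice_mul_cutoff (t := t) (g := fun t x z => ω t x z ^ 2)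
      ((h.classical_ω.smooth.slice ht).continuous.pow 2) hR0 L
    have i2 := integrableOn_slice_mul_cutoff (t := τ) (g := fun t x z => ω t x z ^ 2)
      ((h.classical_ω.smooth.slice hτ0).continuous.pow 2) hR0 L
    simp_rw [sub_mul]
    rw [integral_sub i1 i2]
    have : 0 ≤ ∫ p in strip L, ω t p.1 p.2 ^ 2 * cutoff R p.2 :=
      integral_nonneg fun p => mul_nonneg (sq_nonneg _) (cutoff_nonneg _ _)
    linarith
  have iop := intervalIntegrable_setIntegral_mul_cutoff
    (g := transportOp σ u w fun t x z => ω t x z ^ 2) cop hR0 hτ0 hτt L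
  have ix := intervalIntegrable_setIntegral_mul_cutoff
    (g := fun s x z => dx ω s x z ^ 2) cx hR0 hτ0 hτt L
  have iT := intervalIntegrable_setIntegral_mul_cutoff
    (g := fun s x z => dx T s x z ^ 2) cT hR0 hτ0 hτt L
  have b3 : ∫ s in τ..t, ∫ p in strip L,
        transportOp σ u w (fun t x z => ω t x z ^ 2) s p.1 p.2 * cutoff R p.2
      ≤ σ * ρ ^ 2 * L ^ 2 * (∫ s in τ..t, ∫ p in strip L, dx T s p.1 p.2 ^ 2 * cutoff R p.2)
        - σ * ∫ s in τ..t, ∫ p in strip L, dx ω s p.1 p.2 ^ 2 * cutoff R p.2 := by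
    rw [← intervalIntegral.integral_const_mul, ← intervalIntegral.integral_const_mul,
      ← intervalIntegral.integral_sub (iT.const_mul _) (ix.const_mul _)]
    refine intervalIntegral.integral_mono_on hτt iop ((iT.const_mul _).sub (ix.const_mul _))
      fun s hs => ?_
    have hs0 : 0 < s := hτ0.trans_le hs.1
    have jop := integrableOn_slice_mul_cutoff (continuous_slice cop hs0) hR0 L
    have jx := integrableOn_slice_mul_cutoff (g := fun s x z => dx ω s x z ^ 2) (t := s)
      (continuous_slice (g := fun s x z => dx ω s x z ^ 2) cx hs0) hR0 L
    have jT := integrableOn_slice_mul_cutoff (g := fun s x z => dx T s x z ^ 2) (t := s)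
      (continuous_slice (g := fun s x z => dx T s x z ^ 2) cT hs0) hR0 L
    have jq := integrableOn_slice_mul_cutoff (t := s) (R := R)
      (g := fun t x z => dx ω t x z ^ 2 + ρ ^ 2 * L ^ 2 * dx T t x z ^ 2
        - 2 * ρ * (ω t x z * dx T t x z))
      ((((h.classical_ω.smooth_dx.slice hs0).continuous.pow 2).add (continuous_const.mul
        ((h.classical_T.smooth_dx.slice hs0).continuous.pow 2))).sub
        (continuous_const.mul ((h.classical_ω.smooth.slice hs0).continuous.mul
          (h.classical_T.smooth_dx.slice hs0).continuous))) hR0 L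
    have k1 := mul_nonneg hσ.le (h.setIntegral_torque_nonneg hL hs0 hR0)
    rw [← integral_const_mul, ← integral_const_mul,
      ← integral_sub (jT.const_mul _) (jx.const_mul _)]
    rw [← integral_const_mul] at k1
    have k2 : ∫ p in strip L,
          transportOp σ u w (fun t x z => ω t x z ^ 2) s p.1 p.2 * cutoff R p.2
        ≤ ∫ p in strip L, ((σ * ρ ^ 2 * L ^ 2 * (dx T s p.1 p.2 ^ 2 * cutoff R p.2)
          - σ * (dx ω s p.1 p.2 ^ 2 * cutoff R p.2))
          - σ * ((dx ω s p.1 p.2 ^ 2 + ρ ^ 2 * L ^ 2 * dx T s p.1 p.2 ^ 2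
            - 2 * ρ * (ω s p.1 p.2 * dx T s p.1 p.2)) * cutoff R p.2)) := by
      refine integral_mono jop (((jT.const_mul _).sub (jx.const_mul _)).sub (jq.const_mul σ))
        fun p => ?_
      simp only
      rw [h.transportOp_sq_vorticity hs0]
      have := mul_nonneg (mul_nonneg hσ.le (sq_nonneg (dz ω s p.1 p.2))) (cutoff_nonneg R p.2)
      nlinarith
    have jA : IntegrableOn (fun p : ℝ × ℝ => σ * ρ ^ 2 * L ^ 2 *
        (dx T s p.1 p.2 ^ 2 * cutoff R p.2) - σ * (dx ω s p.1 p.2 ^ 2 * cutoff R p.2)) (strip L) :=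
      (jT.const_mul _).sub (jx.const_mul _)
    rw [integral_sub jA (jq.const_mul σ)] at k2
    linarith
  have b4 := integral_mul_cutoff_le_toReal (F := fun s x z => dx T s x z ^ 2) cT
    (fun _ _ _ _ => sq_nonneg _) hT hR0 hτ0 hτt
  have b5 := mul_le_mul_of_nonneg_left b4
    (show 0 ≤ σ * ρ ^ 2 * L ^ 2 by positivity)
  rw [← hX] at b5
  have e2 : Ω / σ + ρ ^ 2 * L ^ 2 * X + ε = (Ω + σ * ρ ^ 2 * L ^ 2 * X + ε * σ) / σ := by
    field_simp
  rw [e2, le_div_iff₀ hσ]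
  linarith

end IsSolution

/-! ### An ordinary differential inequality -/

section ODE

variable {P P' P'' H : ℝ → ℝ} {a : ℝ}

lemma le_of_deriv_deriv_ge_of_deriv_nonneg (ha : 0 < a) (hP : ∀ z, HasDerivAt P (P' z) z)
    (hP' : ∀ z, HasDerivAt P' (P'' z) z) (hH : Continuous H) (hH0 : ∀ z, 0 ≤ H z)
    (hHi : Integrable H) (hineq : ∀ z, a ^ 2 * P z - H z ≤ P'' z) (hlim : Tendsto P atTop (𝓝 0))
    {z₀ : ℝ} (hz₀ : 0 ≤ P' z₀) : a * P z₀ ≤ ∫ z, H z := by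
  by_contra! hcon
  set c := a * P z₀ - ∫ z, H z with hc
  have hc0 : 0 < c := by rw [hc]; linarith
  set Φ : ℝ → ℝ := fun z => (P' z + a * P z) * Real.exp (-(a * (z - z₀))) + ∫ s in z₀..z, H s with hΦ
  have hd : ∀ z, HasDerivAt Φ
      ((P'' z - a ^ 2 * P z) * Real.exp (-(a * (z - z₀))) + H z) z := fun z => by
    have h1 : HasDerivAt (fun z => Real.exp (-(a * (z - z₀))))
        (Real.exp (-(a * (z - z₀))) * -(a * 1)) z :=
      ((((hasDerivAt_id z).sub_const z₀).const_mul a).neg).exp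
    have h2 := (((hP' z).add ((hP z).const_mul a)).mul h1).add
      (hH.integral_hasStrictDerivAt z₀ z).hasDerivAt
    refine h2.congr_deriv ?_
    simp only [Pi.add_apply]
    ring
  have hmono : MonotoneOn Φ (Ici z₀) := by
    refine monotoneOn_of_hasDerivWithinAt_nonneg (convex_Ici z₀)
      (fun z _ => (hd z).continuousAt.continuousWithinAt) (fun z _ => (hd z).hasDerivWithinAt)
      fun z hz => ?_
    rw [interior_Ici] at hz
    have h1 : Real.exp (-(a * (z - z₀))) ≤ 1 :=
      Real.exp_le_one_iff.2 (by nlinarith [show z₀ < z from hz])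
    have h2 := Real.exp_pos (-(a * (z - z₀)))
    nlinarith [hineq z, hH0 z]
  have hlow : ∀ z, z₀ ≤ z → c ≤ P' z + a * P z := fun z hz => by
    have h1 := hmono self_mem_Ici hz hz
    simp only [hΦ, sub_self, mul_zero, neg_zero, Real.exp_zero, mul_one,
      intervalIntegral.integral_same, add_zero] at h1
    have h2 : ∫ s in z₀..z, H s ≤ ∫ z, H z := by
      rw [intervalIntegral.integral_of_le hz]
      exact setIntegral_le_integral hHi (Eventually.of_forall hH0)
    have h3 : c ≤ (P' z + a * P z) * Real.exp (-(a * (z - z₀))) := by rw [hc]; linarith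
    have h4 : Real.exp (-(a * (z - z₀))) ≤ 1 := Real.exp_le_one_iff.2 (by nlinarith)
    have h5 := Real.exp_pos (-(a * (z - z₀)))
    have h6 : 0 < P' z + a * P z := pos_of_mul_pos_left (hc0.trans_le h3) h5.le
    nlinarith
  -- Where `a P` is below `c / 2`, the slope of `P` is at least `c / 2`; so `P` cannot tend to `0`.
  have hev : ∀ᶠ z in atTop, |P z| < c / (2 * a) := by
    have := hlim.abs
    rw [abs_zero] at this
    exact this.eventually_lt_const (by positivity)
  obtain ⟨z₁, hz₁⟩ := eventually_atTop.1 (hev.and (eventually_ge_atTop z₀))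
  have hslope : ∀ z, z₁ ≤ z → c / 2 ≤ P' z := fun z hz => by
    have h1 := hlow z (hz₁ z hz).2
    have h2 := (abs_lt.1 (hz₁ z hz).1).2
    rw [lt_div_iff₀ (by positivity)] at h2
    linarith
  have hgrow := (convex_Icc z₁ (z₁ + 2 / a)).mul_sub_le_image_sub_of_le_deriv
    (fun z _ => (hP z).continuousAt.continuousWithinAt)
    (fun z _ => (hP z).differentiableAt.differentiableWithinAt) (C := c / 2)
    (fun z hz => by
      rw [(hP z).deriv]
      exact hslope z (interior_subset hz).1)
    z₁ ⟨le_rfl, by linarith [show 0 < 2 / a by positivity]⟩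
    (z₁ + 2 / a) ⟨by linarith [show 0 < 2 / a by positivity], le_rfl⟩
    (by linarith [show 0 < 2 / a by positivity])
  have h3 := (abs_lt.1 (hz₁ z₁ le_rfl).1).1
  have h4 := (abs_lt.1 (hz₁ (z₁ + 2 / a) (by linarith [show 0 < 2 / a by positivity])).1).2
  have e : c / 2 * (z₁ + 2 / a - z₁) = 2 * (c / (2 * a)) := by field_simp; ring
  linarith

/-- A function vanishing at both ends of the line with `P'' ≥ a² P - H` is at most `a⁻¹ ∫ H`. -/
lemma le_of_deriv_deriv_ge (ha : 0 < a) (hP : ∀ z, HasDerivAt P (P' z) z)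
    (hP' : ∀ z, HasDerivAt P' (P'' z) z) (hH : Continuous H) (hH0 : ∀ z, 0 ≤ H z)
    (hHi : Integrable H) (hineq : ∀ z, a ^ 2 * P z - H z ≤ P'' z) (htop : Tendsto P atTop (𝓝 0))
    (hbot : Tendsto P atBot (𝓝 0)) (z₀ : ℝ) : a * P z₀ ≤ ∫ z, H z := by
  rcases le_total 0 (P' z₀) with h | h
  · exact le_of_deriv_deriv_ge_of_deriv_nonneg ha hP hP' hH hH0 hHi hineq htop h
  · have h1 : ∀ z, HasDerivAt (fun z => P (-z)) (-P' (-z)) z := fun z =>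
      ((hP (-z)).comp z (hasDerivAt_neg z)).congr_deriv (by ring)
    have h2 : ∀ z, HasDerivAt (fun z => -P' (-z)) (P'' (-z)) z := fun z =>
      ((hP' (-z)).comp z (hasDerivAt_neg z)).neg.congr_deriv (by ring)
    have := le_of_deriv_deriv_ge_of_deriv_nonneg (P := fun z => P (-z)) (P' := fun z => -P' (-z))
      (P'' := fun z => P'' (-z)) (H := fun z => H (-z)) ha h1 h2 (hH.comp continuous_neg)
      (fun z => hH0 _) hHi.comp_neg (fun z => hineq _) (hbot.comp tendsto_neg_atTop_atBot)
      (z₀ := -z₀) (by simpa using h)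
    rw [integral_neg_eq_self H] at this
    simpa using this

end ODE

/-! ### Periodic functions and parametric integrals -/

section Periodic

variable {L : ℝ}

lemma hasDerivAt_intervalIntegral_of_continuous {K K' : ℝ → ℝ → ℝ} (hL : 0 ≤ L)
    (hK : ∀ z, Continuous (K z)) (hd : ∀ z x, HasDerivAt (fun z => K z x) (K' z x) z)
    (hK' : Continuous (Function.uncurry K')) (z : ℝ) :
    HasDerivAt (fun z => ∫ x in (0 : ℝ)..L, K z x) (∫ x in (0 : ℝ)..L, K' z x) z := by
  obtain ⟨C, hC⟩ := ((isCompact_closedBall z 1).prod (isCompact_Icc (a := (0 : ℝ)) (b := L))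
    ).exists_bound_of_continuousOn hK'.continuousOn
  refine (intervalIntegral.hasDerivAt_integral_of_dominated_loc_of_deriv_le
    (μ := volume) (F := K) (F' := K') (bound := fun _ => C) (Metric.ball_mem_nhds z one_pos)
    (Eventually.of_forall fun y => (hK y).aestronglyMeasurable)
    ((hK z).intervalIntegrable _ _)
    (hK'.comp (by fun_prop : Continuous fun x => (z, x))).aestronglyMeasurable
    (Eventually.of_forall fun x hx y hy => ?_) (by simp)
    (Eventually.of_forall fun x _ y _ => hd y x)).2
  rw [uIoc_of_le hL] at hx
  exact hC (y, x) ⟨Metric.ball_subset_closedBall hy, Ioc_subset_Icc_self hx⟩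

/-- Difference quotients of a periodic function are bounded by the derivative in `L²`. -/
lemma integral_sq_sub_le {a a' : ℝ → ℝ} (hL : 0 < L) (ha : ∀ x, HasDerivAt a (a' x) x)
    (ha' : Continuous a') (hper : Function.Periodic a' L) (ε : ℝ) :
    ∫ x in (0 : ℝ)..L, (a (x + ε) - a x) ^ 2 ≤ ε ^ 2 * ∫ x in (0 : ℝ)..L, a' x ^ 2 := by
  have hc : Continuous a := continuous_iff_continuousAt.2 fun x => (ha x).continuousAt
  have hpt : ∀ x, (a (x + ε) - a x) ^ 2 ≤ ε ^ 2 * ∫ s in (0 : ℝ)..1, a' (x + ε * s) ^ 2 := by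
    intro x
    have hcs : Continuous fun s => a' (x + ε * s) := ha'.comp (by fun_prop)
    have h1 : ∫ s in (0 : ℝ)..1, ε * a' (x + ε * s) = a (x + ε) - a x := by
      have hd : ∀ s, HasDerivAt (fun s => a (x + ε * s)) (ε * a' (x + ε * s)) s := fun s =>
        ((ha (x + ε * s)).comp s (((hasDerivAt_id s).const_mul ε).const_add x)).congr_deriv
          (by ring)
      have hi : IntervalIntegrable (fun s => ε * a' (x + ε * s)) volume 0 1 :=
        (continuous_const.mul hcs).intervalIntegrable _ _
      rw [intervalIntegral.integral_eq_sub_of_hasDerivAt (fun s _ => hd s) hi]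
      simp
    rw [← h1, intervalIntegral.integral_const_mul, mul_pow]
    refine mul_le_mul_of_nonneg_left ?_ (sq_nonneg ε)
    have h2 := sq_integral_abs_le one_pos hcs
    rw [one_mul] at h2
    refine le_trans ?_ h2
    rw [← sq_abs]
    have := intervalIntegral.abs_integral_le_integral_abs (f := fun s => a' (x + ε * s))
      (μ := volume) (zero_le_one' ℝ)
    gcongr
  have hc2 : Continuous (Function.uncurry fun x s => a' (x + ε * s) ^ 2) := by fun_prop
  have hswap : ∫ x in (0 : ℝ)..L, ∫ s in (0 : ℝ)..1, a' (x + ε * s) ^ 2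
      = ∫ s in (0 : ℝ)..1, ∫ x in (0 : ℝ)..L, a' (x + ε * s) ^ 2 := by
    simp_rw [intervalIntegral.integral_of_le hL.le, intervalIntegral.integral_of_le zero_le_one]
    refine integral_integral_swap ?_
    rw [Measure.prod_restrict]
    exact (hc2.continuousOn.integrableOn_compact (isCompact_Icc.prod isCompact_Icc)).mono_set
      (prod_mono Ioc_subset_Icc_self Ioc_subset_Icc_self)
  have hshift : ∀ s, ∫ x in (0 : ℝ)..L, a' (x + ε * s) ^ 2 = ∫ x in (0 : ℝ)..L, a' x ^ 2 := by
    intro s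
    have hp : Function.Periodic (fun x => a' x ^ 2) L := fun x => by
      simp only [hper x]
    rw [intervalIntegral.integral_comp_add_right (fun x => a' x ^ 2), zero_add, add_comm]
    simpa using hp.intervalIntegral_add_eq (ε * s) 0
  calc ∫ x in (0 : ℝ)..L, (a (x + ε) - a x) ^ 2
      ≤ ∫ x in (0 : ℝ)..L, ε ^ 2 * ∫ s in (0 : ℝ)..1, a' (x + ε * s) ^ 2 := by
        refine intervalIntegral.integral_mono_on hL.le ?_ ?_ fun x _ => hpt x
        · exact (((hc.comp (continuous_add_const ε)).sub hc).pow 2).intervalIntegrable _ _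
        · exact (continuous_const.mul
            (intervalIntegral.continuous_parametric_intervalIntegral_of_continuous' hc2 0 1)
            ).intervalIntegrable _ _
    _ = ε ^ 2 * ∫ x in (0 : ℝ)..L, a' x ^ 2 := by
        rw [intervalIntegral.integral_const_mul, hswap]
        simp_rw [hshift]
        simp

end Periodic

/-! ### The uniform bound for the vertical velocity -/

namespace IsSolution

variable {L σ ρ t : ℝ} {f : ℝ → ℝ} {T u w ω : ScalarField}

/-- The vertical velocity solves the Poisson equation `Δ w = ∂ₓ ω`. -/
lemma laplacian_w (h : IsSolution L σ ρ f T u w ω) (ht : 0 < t) (x z : ℝ) :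
    dx (dx w) t x z + dz (dz w) t x z = dx ω t x z := by
  have h1 : (fun y => ω t y z) = fun y => dx w t y z - dz u t y z :=
    funext fun y => h.vorticity t ht y z
  have e1 : dx ω t x z = dx (dx w) t x z - dx (dz u) t x z := by
    have := (h.classical_w.smooth_dx.hasDerivAt_dx (by norm_num) ht x z).sub
      (h.classical_u.smooth_dz.hasDerivAt_dx (by norm_num) ht x z)
    calc dx ω t x z = deriv (fun y => dx w t y z - dz u t y z) x :=
          congrArg (fun φ => deriv φ x) h1
      _ = _ := this.deriv
  have h2 : (fun y => dz w t x y) = fun y => -dx u t x y :=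
    funext fun y => by linarith [h.incompressible t ht x y]
  have e2 : dz (dz w) t x z = -dz (dx u) t x z := by
    have := (h.classical_u.smooth_dx.hasDerivAt_dz (by norm_num) ht x z).neg
    calc dz (dz w) t x z = deriv (fun y => -dx u t x y) z :=
          congrArg (fun φ => deriv φ z) h2
      _ = _ := this.deriv
  rw [e1, e2, h.classical_u.dx_dz_comm ht]
  ring

/-- The horizontal average of the vertical velocity vanishes. -/
lemma integral_w_eq_zero (h : IsSolution L σ ρ f T u w ω) (hL : 0 < L) (ht : 0 < t) (z : ℝ) :
    ∫ x in (0 : ℝ)..L, w t x z = 0 := by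
  have cw := (h.classical_w.smooth.slice ht).continuous
  have cwz := (h.classical_w.smooth_dz.slice ht).continuous
  have cux := (h.classical_u.smooth_dx.slice ht).continuous
  have hd : ∀ z, HasDerivAt (fun z => ∫ x in (0 : ℝ)..L, w t x z) 0 z := fun z => by
    have h1 := hasDerivAt_intervalIntegral_of_continuous (K := fun z x => w t x z)
      (K' := fun z x => Boussinesq.dz w t x z) hL.le
      (fun z => cw.comp (by fun_prop : Continuous fun x => (x, z)))
      (fun z x => h.classical_w.smooth.hasDerivAt_dz (by norm_num) ht x z)
      (cwz.comp (by fun_prop : Continuous fun p : ℝ × ℝ => (p.2, p.1))) z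
    refine h1.congr_deriv ?_
    have e : (fun x => Boussinesq.dz w t x z) = fun x => -Boussinesq.dx u t x z :=
      funext fun x => by linarith [h.incompressible t ht x z]
    rw [e, intervalIntegral.integral_neg, intervalIntegral.integral_eq_sub_of_hasDerivAt
      (fun x _ => h.classical_u.smooth.hasDerivAt_dx (by norm_num) ht x z)
      ((cux.comp (by fun_prop : Continuous fun x => (x, z))).intervalIntegrable 0 L)]
    have := h.periodic_u t ht.le 0 z
    rw [zero_add] at this
    rw [this, sub_self, neg_zero]
  have hconst : ∀ z', ∫ x in (0 : ℝ)..L, w t x z = ∫ x in (0 : ℝ)..L, w t x z' := fun z' =>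
    is_const_of_deriv_eq_zero (fun z => (hd z).differentiableAt) (fun z => (hd z).deriv) z z'
  rw [← abs_nonpos_iff]
  refine le_of_forall_pos_le_add fun ε hε => ?_
  obtain ⟨Z, hZ⟩ := h.w_top.exists_top t (ε := ε / L) (by positivity)
  have h1 := intervalIntegral.norm_integral_le_of_norm_le_const (a := 0) (b := L) (C := ε / L)
    (f := fun x => w t x Z) fun x _ => by
      have := (hZ Z le_rfl t ⟨ht.le, le_rfl⟩ x).le
      rwa [sub_zero] at this
  rw [hconst Z]
  rw [Real.norm_eq_abs, sub_zero, abs_of_pos hL, div_mul_cancel₀ _ hL.ne'] at h1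
  linarith

/-- The squared difference quotients of `w` in the horizontal direction satisfy a differential
inequality in the vertical direction; this bounds them in terms of `∂ₓ ω`. -/
lemma integral_sq_diff_w_le (h : IsSolution L σ ρ f T u w ω) (hL : 0 < L) (ht : 0 < t)
    (hi : IntegrableOn (fun p : ℝ × ℝ => dx ω t p.1 p.2 ^ 2) (strip L)) (ε z₀ : ℝ) :
    ∫ x in (0 : ℝ)..L, (w t (x + ε) z₀ - w t x z₀) ^ 2
      ≤ L * (ε ^ 2 * ∫ p in strip L, dx ω t p.1 p.2 ^ 2) := by
  have sw := h.classical_w.smooth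
  have swx := h.classical_w.smooth_dx
  have swz := h.classical_w.smooth_dz
  have swxx : IsSmoothField 0 (dx (dx w)) := IsSmoothField.dx (n := 0) (by simpa using swx)
  have swzz : IsSmoothField 0 (dz (dz w)) := IsSmoothField.dz (n := 0) (by simpa using swz)
  have cw := (sw.slice ht).continuous
  have cwx := (swx.slice ht).continuous
  have cwz := (swz.slice ht).continuous
  have cwxx := (swxx.slice ht).continuous
  have cwzz := (swzz.slice ht).continuous
  have cω := (h.classical_ω.smooth.slice ht).continuous
  have cωx := (h.classical_ω.smooth_dx.slice ht).continuous
  set δ : ℝ → ℝ → ℝ := fun z x => w t (x + ε) z - w t x z with hδ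
  set δx : ℝ → ℝ → ℝ := fun z x => dx w t (x + ε) z - dx w t x z with hδx
  set δz : ℝ → ℝ → ℝ := fun z x => dz w t (x + ε) z - dz w t x z with hδz
  set δxx : ℝ → ℝ → ℝ := fun z x => dx (dx w) t (x + ε) z - dx (dx w) t x z with hδxx
  set δzz : ℝ → ℝ → ℝ := fun z x => dz (dz w) t (x + ε) z - dz (dz w) t x z with hδzz
  set δω : ℝ → ℝ → ℝ := fun z x => ω t (x + ε) z - ω t x z with hδω
  set δh : ℝ → ℝ → ℝ := fun z x => dx ω t (x + ε) z - dx ω t x z with hδh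
  have cont : ∀ {G : ℝ → ℝ → ℝ}, (Continuous fun p : ℝ × ℝ => G p.1 p.2) →
      Continuous (Function.uncurry fun z x => G (x + ε) z - G x z) := fun hG =>
    (hG.comp (by fun_prop : Continuous fun p : ℝ × ℝ => (p.2 + ε, p.1))).sub
      (hG.comp (by fun_prop : Continuous fun p : ℝ × ℝ => (p.2, p.1)))
  have cδ : Continuous (Function.uncurry δ) := cont (G := fun x z => w t x z) cw
  have cδx : Continuous (Function.uncurry δx) := cont (G := fun x z => dx w t x z) cwx
  have cδz : Continuous (Function.uncurry δz) := cont (G := fun x z => dz w t x z) cwz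
  have cδxx : Continuous (Function.uncurry δxx) := cont (G := fun x z => dx (dx w) t x z) cwxx
  have cδzz : Continuous (Function.uncurry δzz) := cont (G := fun x z => dz (dz w) t x z) cwzz
  have cδω : Continuous (Function.uncurry δω) := cont (G := fun x z => ω t x z) cω
  have cδh : Continuous (Function.uncurry δh) := cont (G := fun x z => dx ω t x z) cωx
  have row : ∀ {G : ℝ → ℝ → ℝ}, Continuous (Function.uncurry G) → ∀ z, Continuous (G z) :=
    fun hG z => hG.comp (by fun_prop : Continuous fun x => (z, x))
  -- Derivatives of the differences.
  have dδ_z : ∀ z x, HasDerivAt (fun z => δ z x) (δz z x) z := fun z x =>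
    (sw.hasDerivAt_dz (by norm_num) ht (x + ε) z).sub (sw.hasDerivAt_dz (by norm_num) ht x z)
  have dδz_z : ∀ z x, HasDerivAt (fun z => δz z x) (δzz z x) z := fun z x =>
    (swz.hasDerivAt_dz (by norm_num) ht (x + ε) z).sub (swz.hasDerivAt_dz (by norm_num) ht x z)
  have dδ_x : ∀ z x, HasDerivAt (δ z) (δx z x) x := fun z x =>
    ((sw.hasDerivAt_dx (by norm_num) ht (x + ε) z).comp_add_const x ε).sub
      (sw.hasDerivAt_dx (by norm_num) ht x z)
  have dδx_x : ∀ z x, HasDerivAt (δx z) (δxx z x) x := fun z x =>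
    ((swx.hasDerivAt_dx (by norm_num) ht (x + ε) z).comp_add_const x ε).sub
      (swx.hasDerivAt_dx (by norm_num) ht x z)
  have dδω_x : ∀ z x, HasDerivAt (δω z) (δh z x) x := fun z x =>
    ((h.classical_ω.smooth.hasDerivAt_dx (by norm_num) ht (x + ε) z).comp_add_const x ε).sub
      (h.classical_ω.smooth.hasDerivAt_dx (by norm_num) ht x z)
  have hpois : ∀ z x, δxx z x + δzz z x = δh z x := fun z x => by
    have h1 := h.laplacian_w ht (x + ε) z
    have h2 := h.laplacian_w ht x z
    simp only [hδxx, hδzz, hδh]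
    linarith
  -- Boundary values agree by periodicity.
  have per : ∀ {g : ScalarField}, IsPeriodic L g → ∀ z,
      g t (L + ε) z - g t L z = g t (0 + ε) z - g t 0 z := fun {g} hg z => by
    have h1 := hg t ht.le (0 + ε) z
    have h2 := hg t ht.le 0 z
    rw [zero_add] at h2
    rw [h2, ← h1]
    ring_nf
  have pδ : ∀ z, δ z L = δ z 0 := fun z => per h.periodic_w z
  have pδx : ∀ z, δx z L = δx z 0 := fun z => per h.periodic_w.dx z
  have pδω : ∀ z, δω z L = δω z 0 := fun z => per h.periodic_ω z
  set P : ℝ → ℝ := fun z => ∫ x in (0 : ℝ)..L, δ z x ^ 2 with hP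
  set P' : ℝ → ℝ := fun z => ∫ x in (0 : ℝ)..L, 2 * δ z x * δz z x with hP'
  set P'' : ℝ → ℝ := fun z => ∫ x in (0 : ℝ)..L, (2 * δz z x * δz z x + 2 * δ z x * δzz z x)
    with hP''
  set H : ℝ → ℝ := fun z => ∫ x in (0 : ℝ)..L, dx ω t x z ^ 2 with hH
  have dP : ∀ z, HasDerivAt P (P' z) z := hasDerivAt_intervalIntegral_of_continuous hL.le
    (K := fun z x => δ z x ^ 2) (K' := fun z x => 2 * δ z x * δz z x)
    (fun z => (row cδ z).pow 2) (fun z x => ((dδ_z z x).pow 2).congr_deriv (by ring))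
    ((continuous_const.mul cδ).mul cδz)
  have dP' : ∀ z, HasDerivAt P' (P'' z) z := hasDerivAt_intervalIntegral_of_continuous hL.le
    (K := fun z x => 2 * δ z x * δz z x)
    (K' := fun z x => 2 * δz z x * δz z x + 2 * δ z x * δzz z x)
    (fun z => (continuous_const.mul (row cδ z)).mul (row cδz z))
    (fun z x => ((dδ_z z x).const_mul 2).mul (dδz_z z x))
    (((continuous_const.mul cδz).mul cδz).add ((continuous_const.mul cδ).mul cδzz))
  have cH : Continuous H := by
    refine intervalIntegral.continuous_parametric_intervalIntegral_of_continuous' ?_ 0 L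
    exact (cωx.comp (by fun_prop : Continuous fun p : ℝ × ℝ => (p.2, p.1))).pow 2
  have hH0 : ∀ z, 0 ≤ H z := fun z => intervalIntegral.integral_nonneg hL.le fun _ _ => sq_nonneg _
  have hHint : ∫ z, H z = ∫ p in strip L, dx ω t p.1 p.2 ^ 2 :=
    (setIntegral_strip_eq hL.le hi).symm
  have hHi : Integrable H := by
    rw [IntegrableOn, volume_restrict_strip] at hi
    refine hi.integral_prod_right.congr (Eventually.of_forall fun z => ?_)
    simp only [hH]
    rw [intervalIntegral.integral_of_le hL.le, integral_Icc_eq_integral_Ioc]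
  have hmean : ∀ z, ∫ x in (0 : ℝ)..L, δ z x = 0 := fun z => by
    have cz : Continuous fun x => w t x z := cw.comp (by fun_prop : Continuous fun x => (x, z))
    have hp : Function.Periodic (fun x => w t x z) L := fun x => h.periodic_w t ht.le x z
    have e1 : ∫ x in (0 : ℝ)..L, w t (x + ε) z = 0 := by
      rw [intervalIntegral.integral_comp_add_right (fun x => w t x z), zero_add, add_comm,
        hp.intervalIntegral_add_eq ε 0, zero_add]
      exact h.integral_w_eq_zero hL ht z
    have i1 : IntervalIntegrable (fun x => w t (x + ε) z) volume 0 L :=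
      (cz.comp (continuous_add_const ε)).intervalIntegrable _ _
    simp only [hδ]
    rw [intervalIntegral.integral_sub i1 (cz.intervalIntegrable _ _), e1,
      h.integral_w_eq_zero hL ht z, sub_zero]
  have hineq : ∀ z, (1 / L) ^ 2 * P z - ε ^ 2 * H z ≤ P'' z := fun z => by
    have rδ := row cδ z
    have rδx := row cδx z
    have rδz := row cδz z
    have rδxx := row cδxx z
    have rδzz := row cδzz z
    have rδω := row cδω z
    have rδh := row cδh z
    have iz : IntervalIntegrable (fun x => 2 * δz z x * δz z x) volume 0 L :=
      ((continuous_const.mul rδz).mul rδz).intervalIntegrable _ _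
    have izz : IntervalIntegrable (fun x => 2 * δ z x * δzz z x) volume 0 L :=
      ((continuous_const.mul rδ).mul rδzz).intervalIntegrable _ _
    have ih : IntervalIntegrable (fun x => δ z x * δh z x) volume 0 L :=
      (rδ.mul rδh).intervalIntegrable _ _
    have ixx : IntervalIntegrable (fun x => δ z x * δxx z x) volume 0 L :=
      (rδ.mul rδxx).intervalIntegrable _ _
    have ix2 : IntervalIntegrable (fun x => δx z x * δx z x) volume 0 L :=
      (rδx.mul rδx).intervalIntegrable _ _
    have ixω : IntervalIntegrable (fun x => δx z x * δω z x) volume 0 L :=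
      (rδx.mul rδω).intervalIntegrable _ _
    have k1 : ∫ x in (0 : ℝ)..L, δ z x * δxx z x = -∫ x in (0 : ℝ)..L, δx z x * δx z x := by
      rw [intervalIntegral.integral_mul_deriv_eq_deriv_mul (fun x _ => dδ_x z x)
        (fun x _ => dδx_x z x) (rδx.intervalIntegrable _ _) (rδxx.intervalIntegrable _ _),
        pδ, pδx]
      ring
    have k2 : ∫ x in (0 : ℝ)..L, δ z x * δh z x = -∫ x in (0 : ℝ)..L, δx z x * δω z x := by
      rw [intervalIntegral.integral_mul_deriv_eq_deriv_mul (fun x _ => dδ_x z x)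
        (fun x _ => dδω_x z x) (rδx.intervalIntegrable _ _) (rδh.intervalIntegrable _ _),
        pδ, pδω]
      ring
    have k3 : ∫ x in (0 : ℝ)..L, 2 * δ z x * δzz z x
        = 2 * ((∫ x in (0 : ℝ)..L, δx z x * δx z x) - ∫ x in (0 : ℝ)..L, δx z x * δω z x) := by
      have e : (fun x => 2 * δ z x * δzz z x)
          = fun x => 2 * (δ z x * δh z x - δ z x * δxx z x) :=
        funext fun x => by rw [← hpois]; ring
      rw [e, intervalIntegral.integral_const_mul, intervalIntegral.integral_sub ih ixx, k1, k2]
      ring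
    have k4 : 0 ≤ ∫ x in (0 : ℝ)..L, 2 * δz z x * δz z x :=
      intervalIntegral.integral_nonneg hL.le fun x _ => by nlinarith [sq_nonneg (δz z x)]
    have k5 : ∫ x in (0 : ℝ)..L, δω z x ^ 2 ≤ ε ^ 2 * H z :=
      integral_sq_sub_le hL
        (fun x => h.classical_ω.smooth.hasDerivAt_dx (by norm_num) ht x z)
        (cωx.comp (by fun_prop : Continuous fun x => (x, z)))
        (fun x => h.periodic_ω.dx t ht.le x z) ε
    have k6 : 2 * ∫ x in (0 : ℝ)..L, δx z x * δω z x
        ≤ (∫ x in (0 : ℝ)..L, δx z x * δx z x) + ∫ x in (0 : ℝ)..L, δω z x ^ 2 := by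
      have iω2 : IntervalIntegrable (fun x => δω z x ^ 2) volume 0 L :=
        (rδω.pow 2).intervalIntegrable _ _
      rw [← intervalIntegral.integral_const_mul, ← intervalIntegral.integral_add ix2 iω2]
      refine intervalIntegral.integral_mono_on hL.le (ixω.const_mul 2) (ix2.add iω2)
        fun x _ => ?_
      nlinarith [sq_nonneg (δx z x - δω z x)]
    have k7 : P z ≤ L * (L * ∫ x in (0 : ℝ)..L, δx z x * δx z x) := by
      have hpt : ∀ x ∈ Icc 0 L, δ z x ^ 2 ≤ L * ∫ x in (0 : ℝ)..L, δx z x * δx z x :=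
        fun x hx => by
          have := sq_le_of_integral_eq_zero hL (dδ_x z) rδx (hmean z) hx
          simpa only [sq] using this
      calc P z ≤ ∫ _x in (0 : ℝ)..L, L * ∫ x in (0 : ℝ)..L, δx z x * δx z x :=
            intervalIntegral.integral_mono_on hL.le ((rδ.pow 2).intervalIntegrable _ _) (by simp)
              hpt
        _ = _ := by rw [intervalIntegral.integral_const, sub_zero, smul_eq_mul]
    have k8 : (1 / L) ^ 2 * P z ≤ ∫ x in (0 : ℝ)..L, δx z x * δx z x := by
      calc (1 / L) ^ 2 * P z ≤ (1 / L) ^ 2 * (L * (L * ∫ x in (0 : ℝ)..L, δx z x * δx z x)) := by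
            gcongr
        _ = _ := by field_simp
    simp only [hP'']
    rw [intervalIntegral.integral_add iz izz, k3]
    linarith
  -- The differences tend to `0` at both ends, uniformly in `x`.
  have hsmall : ∀ η > 0, ∃ Z, ∀ z, Z ≤ |z| → |P z| ≤ η := fun η hη => by
    obtain ⟨Z, -, hZ⟩ := h.w_bot.exists_abs h.w_top t (ε := √(η / L) / 2) (by positivity)
    refine ⟨Z, fun z hz => ?_⟩
    have hpt : ∀ x, ‖δ z x ^ 2‖ ≤ η / L := fun x => by
      have h1 := hZ z hz t ⟨ht.le, le_rfl⟩ x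
      have h2 := hZ z hz t ⟨ht.le, le_rfl⟩ (x + ε)
      have h3 : |δ z x| ≤ √(η / L) := (abs_sub _ _).trans (by linarith)
      rw [norm_pow, Real.norm_eq_abs]
      calc |δ z x| ^ 2 ≤ √(η / L) ^ 2 := by gcongr
        _ = η / L := Real.sq_sqrt (by positivity)
    have := intervalIntegral.norm_integral_le_of_norm_le_const (a := 0) (b := L)
      (f := fun x => δ z x ^ 2) fun x _ => hpt x
    rwa [sub_zero, abs_of_pos hL, div_mul_cancel₀ _ hL.ne'] at this
  have htop : Tendsto P atTop (𝓝 0) := by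
    rw [Metric.tendsto_nhds]
    intro η hη
    obtain ⟨Z, hZ⟩ := hsmall (η / 2) (half_pos hη)
    filter_upwards [eventually_ge_atTop Z] with z hz
    rw [Real.dist_eq, sub_zero]
    linarith [hZ z (hz.trans (le_abs_self z))]
  have hbot : Tendsto P atBot (𝓝 0) := by
    rw [Metric.tendsto_nhds]
    intro η hη
    obtain ⟨Z, hZ⟩ := hsmall (η / 2) (half_pos hη)
    filter_upwards [eventually_le_atBot (-Z)] with z hz
    rw [Real.dist_eq, sub_zero]
    linarith [hZ z (le_trans (by linarith) (neg_le_abs z))]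
  have key := le_of_deriv_deriv_ge (H := fun z => ε ^ 2 * H z) (one_div_pos.2 hL) dP dP'
    (continuous_const.mul cH) (fun z => mul_nonneg (sq_nonneg ε) (hH0 z)) (hHi.const_mul _)
    hineq htop hbot z₀
  rw [integral_const_mul, hHint, one_div, inv_mul_le_iff₀ hL] at key
  exact key

/-- The uniform norm of the vertical velocity is controlled by `∂ₓ ω` in `L²`. -/
lemma sq_w_le (h : IsSolution L σ ρ f T u w ω) (hL : 0 < L) (ht : 0 < t)
    (hi : IntegrableOn (fun p : ℝ × ℝ => dx ω t p.1 p.2 ^ 2) (strip L)) (x z : ℝ) :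
    w t x z ^ 2 ≤ L ^ 2 * ∫ p in strip L, dx ω t p.1 p.2 ^ 2 := by
  set I := ∫ p in strip L, dx ω t p.1 p.2 ^ 2 with hI
  have cw : Continuous fun x => w t x z :=
    (h.classical_w.smooth.slice ht).continuous.comp (by fun_prop : Continuous fun x => (x, z))
  have cwx : Continuous fun x => dx w t x z :=
    (h.classical_w.smooth_dx.slice ht).continuous.comp (by fun_prop : Continuous fun x => (x, z))
  have dw := fun x => h.classical_w.smooth.hasDerivAt_dx (by norm_num) ht x z
  obtain ⟨B, hB⟩ := isCompact_Icc.exists_bound_of_continuousOn (s := Icc 0 L) cwx.continuousOn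
  have hper : Function.Periodic (fun x => dx w t x z) L := fun x => h.periodic_w.dx t ht.le x z
  have hB' : ∀ x, ‖dx w t x z‖ ≤ B := fun x => by
    obtain ⟨y, hy, e⟩ := hper.exists_mem_Ico₀ hL x
    rw [show dx w t x z = dx w t y z from e]
    exact hB y (Ico_subset_Icc_self hy)
  -- Passage from difference quotients to the derivative by dominated convergence.
  have hlim : Tendsto (fun n : ℕ => ∫ x in (0 : ℝ)..L,
      ((n + 1 : ℝ) * (w t (x + 1 / (n + 1)) z - w t x z)) ^ 2) atTop
      (𝓝 (∫ x in (0 : ℝ)..L, dx w t x z ^ 2)) := by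
    refine intervalIntegral.tendsto_integral_filter_of_dominated_convergence (fun _ => B ^ 2)
      (Eventually.of_forall fun n => ?_) (Eventually.of_forall fun n =>
        Eventually.of_forall fun x _ => ?_) (by simp) (Eventually.of_forall fun x _ => ?_)
    · exact ((continuous_const.mul ((cw.comp (continuous_add_const _)).sub cw)).pow
        2).aestronglyMeasurable
    · have h1 := Convex.norm_image_sub_le_of_norm_hasDerivWithin_le
        (fun y _ => (dw y).hasDerivWithinAt) (fun y _ => hB' y) convex_univ (mem_univ x)
        (mem_univ (x + 1 / (n + 1 : ℝ)))
      rw [add_sub_cancel_left, Real.norm_of_nonneg (by positivity : (0 : ℝ) ≤ 1 / (n + 1))] at h1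
      have h2 : ‖(n + 1 : ℝ) * (w t (x + 1 / (n + 1)) z - w t x z)‖ ≤ B := by
        rw [norm_mul, Real.norm_of_nonneg (by positivity : (0 : ℝ) ≤ n + 1)]
        calc (n + 1 : ℝ) * ‖w t (x + 1 / (n + 1)) z - w t x z‖
            ≤ (n + 1) * (B * (1 / (n + 1))) := by gcongr
          _ = B := by field_simp
      rw [norm_pow]
      gcongr
    · have h1 : Tendsto (fun n : ℕ => (1 : ℝ) / (n + 1)) atTop (𝓝[≠] 0) :=
        tendsto_nhdsWithin_iff.2 ⟨tendsto_one_div_add_atTop_nhds_zero_nat,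
          Eventually.of_forall fun n => by
            simp only [mem_compl_iff, mem_singleton_iff]; positivity⟩
      have h2 := ((hasDerivAt_iff_tendsto_slope_zero.1 (dw x)).comp h1).pow 2
      refine h2.congr fun n => ?_
      simp
  have hbound : ∫ x in (0 : ℝ)..L, dx w t x z ^ 2 ≤ L * I := by
    refine le_of_tendsto hlim (Eventually.of_forall fun n => ?_)
    simp_rw [mul_pow]
    rw [intervalIntegral.integral_const_mul]
    calc (n + 1 : ℝ) ^ 2 * ∫ x in (0 : ℝ)..L, (w t (x + 1 / (n + 1)) z - w t x z) ^ 2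
        ≤ (n + 1 : ℝ) ^ 2 * (L * ((1 / (n + 1 : ℝ)) ^ 2 * I)) := by
          have := h.integral_sq_diff_w_le hL ht hi (1 / (n + 1 : ℝ)) z
          gcongr
      _ = L * I := by field_simp
  obtain ⟨y, hy, e⟩ := h.periodic_w.exists_mem_Icc hL ht.le x z
  rw [e]
  calc w t y z ^ 2 ≤ L * ∫ x in (0 : ℝ)..L, dx w t x z ^ 2 :=
        sq_le_of_integral_eq_zero hL dw cwx (h.integral_w_eq_zero hL ht z) hy
    _ ≤ L * (L * I) := by gcongr
    _ = L ^ 2 * I := by ring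

end IsSolution

/-! ### Closing the estimates -/

/-- The square of the drift is controlled by the temperature gradient and the initial enstrophy. -/
lemma IsSolution.sq_drift_le {L σ ρ t : ℝ} {f : ℝ → ℝ} {T u w ω : ScalarField}
    (h : IsSolution L σ ρ f T u w ω) (hL : 0 < L) (hσ : 0 < σ)
    (ht : 0 < t) (hω : ∫⁻ p in strip L, ENNReal.ofReal (ω 0 p.1 p.2 ^ 2) ≠ ∞)
    (hT : ∫⁻ s in Ioc 0 t, ∫⁻ p in strip L, ENNReal.ofReal (dx T s p.1 p.2 ^ 2) ≠ ∞) :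
    drift w t ^ 2 ≤ t * (L ^ 2 *
      ((∫⁻ p in strip L, ENNReal.ofReal (ω 0 p.1 p.2 ^ 2)).toReal / σ
        + ρ ^ 2 * L ^ 2 *
        (∫⁻ s in Ioc 0 t, ∫⁻ p in strip L, ENNReal.ofReal (dx T s p.1 p.2 ^ 2)).toReal)) := by
  have hbound := h.lintegral_dx_vorticity_le hL hσ ht hω hT
  set E := (∫⁻ p in strip L, ENNReal.ofReal (ω 0 p.1 p.2 ^ 2)).toReal / σ + ρ ^ 2 * L ^ 2 *
    (∫⁻ s in Ioc 0 t, ∫⁻ p in strip L, ENNReal.ofReal (dx T s p.1 p.2 ^ 2)).toReal with hE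
  have hE0 : 0 ≤ E := by
    have := (∫⁻ p in strip L, ENNReal.ofReal (ω 0 p.1 p.2 ^ 2)).toReal_nonneg
    have := (∫⁻ s in Ioc 0 t, ∫⁻ p in strip L,
      ENNReal.ofReal (dx T s p.1 p.2 ^ 2)).toReal_nonneg
    positivity
  have cS := h.decaying_w.continuous_supNorm hL
  have h1 : drift w t ^ 2 ≤ t * ∫ s in (0 : ℝ)..t, supNorm w s ^ 2 := by
    have := sq_integral_abs_le ht cS
    simp_rw [abs_of_nonneg (supNorm_nonneg w _)] at this
    exact this
  refine h1.trans (mul_le_mul_of_nonneg_left ?_ ht.le)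
  refine (ENNReal.ofReal_le_ofReal_iff (by positivity)).1 ?_
  have i2 : IntegrableOn (fun s => supNorm w s ^ 2) (Ioc 0 t) :=
    ((cS.pow 2).continuousOn.integrableOn_compact isCompact_Icc).mono_set Ioc_subset_Icc_self
  rw [intervalIntegral.integral_of_le ht.le, ofReal_integral_eq_lintegral_ofReal i2
    (Eventually.of_forall fun s => sq_nonneg _), ENNReal.ofReal_mul (by positivity)]
  refine le_trans ?_ (mul_le_mul_right hbound (ENNReal.ofReal (L ^ 2)))
  rw [← lintegral_const_mul' _ _ ENNReal.ofReal_ne_top]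
  refine setLIntegral_mono' measurableSet_Ioc fun s hs => ?_
  by_cases hfin : ∫⁻ p in strip L, ENNReal.ofReal (dx ω s p.1 p.2 ^ 2) = ∞
  · rw [hfin, ENNReal.mul_top (by simpa using hL.ne')]
    exact le_top
  have c2 : Continuous fun p : ℝ × ℝ => dx ω s p.1 p.2 ^ 2 :=
    (h.classical_ω.smooth_dx.slice hs.1).continuous.pow 2
  have hi : IntegrableOn (fun p : ℝ × ℝ => dx ω s p.1 p.2 ^ 2) (strip L) :=
    ⟨c2.aestronglyMeasurable, by
      rw [hasFiniteIntegral_iff_ofReal (Eventually.of_forall fun p => sq_nonneg _)]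
      exact lt_top_iff_ne_top.2 hfin⟩
  rw [← ofReal_integral_eq_lintegral_ofReal hi (Eventually.of_forall fun p => sq_nonneg _),
    ← ENNReal.ofReal_mul (by positivity)]
  refine ENNReal.ofReal_le_ofReal ?_
  have hI : 0 ≤ L ^ 2 * ∫ p in strip L, dx ω s p.1 p.2 ^ 2 :=
    mul_nonneg (sq_nonneg L) (integral_nonneg fun p => sq_nonneg _)
  have hsup : supNorm w s ≤ √(L ^ 2 * ∫ p in strip L, dx ω s p.1 p.2 ^ 2) :=
    supNorm_le hs.1.le fun x z => Real.abs_le_sqrt (h.sq_w_le hL hs.1 hi x z)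
  calc supNorm w s ^ 2 ≤ √(L ^ 2 * ∫ p in strip L, dx ω s p.1 p.2 ^ 2) ^ 2 := by
        have := supNorm_nonneg w s
        gcongr
    _ = _ := Real.sq_sqrt hI

lemma avgGradSq_eq {L t : ℝ} {T : ScalarField} (hL : 0 < L) (hT : IsClassical T) :
    avgGradSq L T t = (ENNReal.ofReal t)⁻¹ * ((ENNReal.ofReal L)⁻¹ *
      ∫⁻ s in Ioc 0 t, ∫⁻ p in strip L,
        ENNReal.ofReal (dx T s p.1 p.2 ^ 2 + dz T s p.1 p.2 ^ 2)) := by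
  rw [avgGradSq]
  congr 1
  rw [← lintegral_const_mul' _ _ (by simpa using hL)]
  refine setLIntegral_congr_fun measurableSet_Ioc fun s hs => ?_
  simp only [normSqL2]
  rw [← mul_add, ← lintegral_add_left]
  · simp_rw [ENNReal.ofReal_add (sq_nonneg _) (sq_nonneg _)]
  · exact (((hT.smooth_dx.slice hs.1).continuous.pow 2).measurable).ennreal_ofReal

lemma avgSup_le {L t : ℝ} {w : ScalarField} (hL : 0 < L) (hw : IsDecaying L w) (ht : 0 < t) :
    avgSup L w t ≤ ENNReal.ofReal (drift w t / t) := by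
  have cS := hw.continuous_supNorm hL
  have i : IntegrableOn (supNorm w) (Ioc 0 t) :=
    (cS.continuousOn.integrableOn_compact isCompact_Icc).mono_set Ioc_subset_Icc_self
  have h1 : ∫⁻ s in Ioc 0 t, eLpNorm (fun p : ℝ × ℝ => w s p.1 p.2) ∞
      (volume.restrict (strip L)) ≤ ENNReal.ofReal (drift w t) := by
    rw [drift, intervalIntegral.integral_of_le ht.le, ofReal_integral_eq_lintegral_ofReal i
      (Eventually.of_forall fun s => supNorm_nonneg w s)]
    refine setLIntegral_mono' measurableSet_Ioc fun s hs => ?_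
    rw [eLpNorm_exponent_top]
    exact eLpNormEssSup_le_of_ae_bound
      (Eventually.of_forall fun p => hw.abs_le_supNorm hL hs.1.le p.1 p.2)
  rw [avgSup, div_eq_inv_mul, ENNReal.ofReal_mul (by positivity), ENNReal.ofReal_inv_of_pos ht]
  gcongr

/-- The two coupled inequalities between the averaged temperature gradient `n` and the averaged
drift. -/
lemma IsFrontSolution.exists_coupled {L σ ρ m M α α' β t : ℝ} {f : ℝ → ℝ} {T u w ω : ScalarField}
    (h : IsFrontSolution L σ ρ f m M α α' β T u w ω) (ht : 0 < t)
    (hω : ∫⁻ p in strip L, ENNReal.ofReal (ω 0 p.1 p.2 ^ 2) ≠ ∞) :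
    ∃ n : ℝ, 0 ≤ n ∧ avgGradSq L T t = ENNReal.ofReal n ∧
      M * n ≤ (m + 2) * (drift w t / t) + (2 * m + 3) + (m + 1) * frontConst m α α' β / t ∧
      (drift w t / t) ^ 2 ≤ L ^ 2 *
        ((∫⁻ p in strip L, ENNReal.ofReal (ω 0 p.1 p.2 ^ 2)).toReal / σ) / t
          + ρ ^ 2 * L ^ 5 * n := by
  have hL := h.L_pos
  have hM := h.kpp.M_pos
  have hm := h.kpp.m_nonneg
  have hg := h.lintegral_gradSq_le ht
  set G := ∫⁻ s in Ioc 0 t, ∫⁻ p in strip L,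
    ENNReal.ofReal (dx T s p.1 p.2 ^ 2 + dz T s p.1 p.2 ^ 2) with hG
  have hGfin : G ≠ ∞ := (hg.trans_lt ENNReal.ofReal_lt_top).ne
  have hle : ∫⁻ s in Ioc 0 t, ∫⁻ p in strip L, ENNReal.ofReal (dx T s p.1 p.2 ^ 2) ≤ G :=
    lintegral_mono fun s => lintegral_mono fun p =>
      ENNReal.ofReal_le_ofReal (le_add_of_nonneg_right (sq_nonneg _))
  have hXfin := (hle.trans_lt (lt_top_iff_ne_top.2 hGfin)).ne
  have hX := ENNReal.toReal_mono hGfin hle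
  have hA := h.sol.sq_drift_le hL h.σ_pos ht hω hXfin
  have hdr := drift_nonneg w ht.le
  have hc := h.frontConst_nonneg
  refine ⟨G.toReal / (L * t), by positivity, ?_, ?_, ?_⟩
  · rw [avgGradSq_eq hL h.sol.classical_T, ← hG, div_eq_inv_mul, mul_inv, mul_comm L⁻¹,
      mul_assoc, ENNReal.ofReal_mul (by positivity), ENNReal.ofReal_mul (by positivity),
      ENNReal.ofReal_inv_of_pos ht, ENNReal.ofReal_inv_of_pos hL, ENNReal.ofReal_toReal hGfin]
  · have h1 := ENNReal.toReal_mono ENNReal.ofReal_ne_top hg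
    rw [ENNReal.toReal_ofReal (by positivity), le_div_iff₀ hM] at h1
    have e : (m + 2) * (drift w t / t) + (2 * m + 3) + (m + 1) * frontConst m α α' β / t
        = (L * ((m + 2) * drift w t + (2 * m + 3) * t + (m + 1) * frontConst m α α' β))
          / (L * t) := by field_simp
    rw [e, ← mul_div_assoc, div_le_div_iff_of_pos_right (by positivity)]
    linarith
  · set Ω := (∫⁻ p in strip L, ENNReal.ofReal (ω 0 p.1 p.2 ^ 2)).toReal with hΩ
    have h2 : drift w t ^ 2 ≤ t * (L ^ 2 * (Ω / σ + ρ ^ 2 * L ^ 2 * G.toReal)) :=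
      hA.trans (by gcongr)
    calc (drift w t / t) ^ 2 = drift w t ^ 2 / t ^ 2 := div_pow _ _ _
      _ ≤ t * (L ^ 2 * (Ω / σ + ρ ^ 2 * L ^ 2 * G.toReal)) / t ^ 2 := by gcongr
      _ = _ := by field_simp

lemma sqrt_add_le {a b : ℝ} (ha : 0 ≤ a) (hb : 0 ≤ b) : √(a + b) ≤ √a + √b := by
  rw [Real.sqrt_le_iff]
  refine ⟨by positivity, ?_⟩
  nlinarith [Real.sq_sqrt ha, Real.sq_sqrt hb, Real.sqrt_nonneg a, Real.sqrt_nonneg b,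
    mul_nonneg (Real.sqrt_nonneg a) (Real.sqrt_nonneg b)]

/-- Resolving the coupled inequalities: the linear bound for `n` by `a` and the bound for `a` by the
square root of `n` are combined by Young's inequality. -/
lemma coupled_bounds {n a m M s Q c t : ℝ} (ht : 0 < t) (hM : 0 < M) (hm : 0 ≤ m) (hs : 0 ≤ s)
    (hQ : 0 ≤ Q) (hn : 0 ≤ n) (hc : 0 ≤ c)
    (h1 : M * n ≤ (m + 2) * a + (2 * m + 3) + (m + 1) * c / t)
    (h2 : a ^ 2 ≤ Q / t + s ^ 2 * n) :
    n ≤ (m + 2) ^ 2 / M ^ 2 * s ^ 2 + (4 * m + 6) / M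
        + (2 * (m + 2) * √Q / M / √t + 2 * (m + 1) * c / M / t) ∧
      a ≤ (m + 2) / M * s ^ 2 + √((4 * m + 6) / M) * s
        + s * √(2 * (m + 2) * √Q / M) / t ^ (1 / 4 : ℝ)
        + (s * √(2 * (m + 1) * c / M) + √Q) / t ^ (1 / 2 : ℝ) := by
  have hst : 0 < √t := Real.sqrt_pos.2 ht
  have ha : a ≤ s * √n + √Q / √t := by
    have h3 : a ≤ √(Q / t + s ^ 2 * n) := Real.le_sqrt_of_sq_le h2
    have h4 : √(Q / t + s ^ 2 * n) ≤ √(Q / t) + √(s ^ 2 * n) :=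
      sqrt_add_le (by positivity) (by positivity)
    rw [Real.sqrt_div hQ, Real.sqrt_mul (sq_nonneg s), Real.sqrt_sq hs] at h4
    linarith
  have hn1 : n ≤ (m + 2) ^ 2 / M ^ 2 * s ^ 2 + (4 * m + 6) / M
        + (2 * (m + 2) * √Q / M / √t + 2 * (m + 1) * c / M / t) := by
    have hy : 2 * ((m + 2) * (s * √n)) ≤ M * n + (m + 2) ^ 2 * s ^ 2 / M := by
      have e : M * n + (m + 2) ^ 2 * s ^ 2 / M - 2 * ((m + 2) * (s * √n))
          = (M * √n - (m + 2) * s) ^ 2 / M := by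
        have e1 : n = √n ^ 2 := (Real.sq_sqrt hn).symm
        rw [e1, Real.sqrt_sq (Real.sqrt_nonneg n)]
        field_simp
        ring
      have : 0 ≤ (M * √n - (m + 2) * s) ^ 2 / M := by positivity
      linarith
    have h5 : (m + 2) * a ≤ (m + 2) * (s * √n) + (m + 2) * (√Q / √t) := by
      rw [← mul_add]
      gcongr
    have h6 : M * n ≤ (m + 2) ^ 2 * s ^ 2 / M + 2 * ((m + 2) * (√Q / √t)) + 2 * (2 * m + 3)
        + 2 * ((m + 1) * c / t) := by linarith
    have e : (m + 2) ^ 2 / M ^ 2 * s ^ 2 + (4 * m + 6) / M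
        + (2 * (m + 2) * √Q / M / √t + 2 * (m + 1) * c / M / t)
        = ((m + 2) ^ 2 * s ^ 2 / M + 2 * ((m + 2) * (√Q / √t)) + 2 * (2 * m + 3)
        + 2 * ((m + 1) * c / t)) / M := by
      field_simp
      ring
    rw [e, le_div_iff₀ hM]
    linarith
  refine ⟨hn1, ha.trans ?_⟩
  have hsq : √n ≤ (m + 2) / M * s + √((4 * m + 6) / M)
      + (√(2 * (m + 2) * √Q / M) / t ^ (1 / 4 : ℝ)
      + √(2 * (m + 1) * c / M) / t ^ (1 / 2 : ℝ)) := by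
    have q1 : √((m + 2) ^ 2 / M ^ 2 * s ^ 2) = (m + 2) / M * s := by
      rw [← div_pow, ← mul_pow, Real.sqrt_sq (by positivity)]
    have q2 : √(2 * (m + 2) * √Q / M / √t) = √(2 * (m + 2) * √Q / M) / t ^ (1 / 4 : ℝ) := by
      rw [Real.sqrt_div (by positivity), Real.sqrt_eq_rpow (√t), Real.sqrt_eq_rpow t,
        ← Real.rpow_mul ht.le]
      norm_num
    have q3 : √(2 * (m + 1) * c / M / t) = √(2 * (m + 1) * c / M) / t ^ (1 / 2 : ℝ) := by
      rw [Real.sqrt_div (by positivity), Real.sqrt_eq_rpow t]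
    calc √n ≤ _ := Real.sqrt_le_sqrt hn1
      _ ≤ _ := sqrt_add_le (by positivity) (by positivity)
      _ ≤ _ := add_le_add (sqrt_add_le (by positivity) (by positivity))
          (sqrt_add_le (by positivity) (by positivity))
      _ = _ := by rw [q1, q2, q3]
  have h7 := mul_le_mul_of_nonneg_left hsq hs
  rw [Real.sqrt_eq_rpow t]
  refine (add_le_add_left h7 _).trans (le_of_eq ?_)
  ring

end Boussinesq

theorem mainTheorem1 :
    ∃ C : ℝ, 0 < C ∧
      ∀ (L σ ρ : ℝ), 0 < L → 0 < σ → 0 < ρ →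
      ∀ (f : ℝ → ℝ) (m M : ℝ), Boussinesq.IsConcaveKPP f m M →
      ∀ (T₀ ω₀ : ℝ → ℝ → ℝ), Boussinesq.IsFrontLike T₀ → Boussinesq.normSqL2 L ω₀ < ∞ →
      ∃ K₁ K₂ K₃ K₄ : ℝ,
        ∀ (T u w ω : Boussinesq.ScalarField), Boussinesq.IsSolution L σ ρ f T u w ω →
          (∀ x z, T 0 x z = T₀ x z) → (∀ x z, ω 0 x z = ω₀ x z) →
          (∀ t : ℝ, 0 < t →
            Boussinesq.avgGradSq L T t ≤ ENNReal.ofReal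
              (C ^ 2 * (m + 2) ^ 2 / M ^ 2 * ρ ^ 2 * L ^ 5 + (4 * m + 6) / M
                + (K₁ / √t + K₂ / t))) ∧
          (∀ t : ℝ, 0 < t →
            Boussinesq.avgSup L w t ≤ ENNReal.ofReal
              (C ^ 2 * (m + 2) / M * ρ ^ 2 * L ^ 5
                + C * √((4 * m + 6) / M) * ρ * L ^ (5 / 2 : ℝ)
                + K₃ / t ^ (1 / 4 : ℝ) + K₄ / t ^ (1 / 2 : ℝ))) ∧
          ((∀ t : ℝ, 0 < t → IntegrableOn (fun p : ℝ × ℝ => Boussinesq.dt T t p.1 p.2)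
              (Boussinesq.strip L)) →
            (∀ t : ℝ, 0 < t → IntervalIntegrable (Boussinesq.burningRate L T) volume 0 t) ∧
            limsup (fun t : ℝ => (Boussinesq.avgBurningRate L T t : EReal)) atTop ≤
              ((2 + C ^ 2 * (m + 2) / M * ρ ^ 2 * L ^ 5
                + C * √((4 * m + 6) / M) * ρ * L ^ (5 / 2 : ℝ) : ℝ) : EReal)) := by
  refine ⟨1, one_pos, fun L σ ρ hL hσ hρ f m M hf T₀ ω₀ hT₀ hω₀ => ?_⟩
  obtain ⟨α, α', β, hβ, hβ1, hup, hlow⟩ := hT₀.exists_tails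
  have hm := hf.m_nonneg
  have hM := hf.M_pos
  set c := Boussinesq.frontConst m α α' β with hc
  have hc0 : 0 ≤ c := by
    rw [hc, Boussinesq.frontConst]
    positivity
  set Q := L ^ 2 * ((∫⁻ p in Boussinesq.strip L, ENNReal.ofReal (ω₀ p.1 p.2 ^ 2)).toReal / σ)
    with hQ
  have hQ0 : 0 ≤ Q := by positivity
  set s := ρ * L ^ (5 / 2 : ℝ) with hs
  have hs0 : 0 ≤ s := by positivity
  have hs2 : s ^ 2 = ρ ^ 2 * L ^ 5 := by
    rw [hs, mul_pow, ← Real.rpow_natCast (L ^ (5 / 2 : ℝ)), ← Real.rpow_mul hL.le,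
      ← Real.rpow_natCast L 5]
    norm_num
  refine ⟨2 * (m + 2) * √Q / M, 2 * (m + 1) * c / M, s * √(2 * (m + 2) * √Q / M),
    s * √(2 * (m + 1) * c / M) + √Q, fun T u w ω hsol hT hω => ?_⟩
  have hF : Boussinesq.IsFrontSolution L σ ρ f m M α α' β T u w ω :=
    ⟨hL, hσ, hf, hsol, fun x z => by rw [hT]; exact hT₀.nonneg x z,
      fun x z => by rw [hT]; exact hT₀.le_one x z, hβ, hβ1,
      fun x z => by rw [hT]; exact hup x z, fun x z => by rw [hT]; exact hlow x z⟩
  have key : ∀ t : ℝ, 0 < t → ∃ n : ℝ, Boussinesq.avgGradSq L T t = ENNReal.ofReal n ∧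
      n ≤ (m + 2) ^ 2 / M ^ 2 * s ^ 2 + (4 * m + 6) / M
        + (2 * (m + 2) * √Q / M / √t + 2 * (m + 1) * c / M / t) ∧
      Boussinesq.drift w t / t ≤ (m + 2) / M * s ^ 2 + √((4 * m + 6) / M) * s
        + s * √(2 * (m + 2) * √Q / M) / t ^ (1 / 4 : ℝ)
        + (s * √(2 * (m + 1) * c / M) + √Q) / t ^ (1 / 2 : ℝ) := by
    intro t ht
    obtain ⟨n, hn0, hn, h1, h2⟩ := hF.exists_coupled ht (by
      simp only [hω]
      exact (Boussinesq.lintegral_lt_top_of_normSqL2 hω₀).ne)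
    simp only [hω] at h2
    rw [← hs2, ← hQ] at h2
    exact ⟨n, hn, Boussinesq.coupled_bounds ht hM hm hs0 hQ0 hn0 hc0 h1 h2⟩
  have ew : (1 : ℝ) ^ 2 * (m + 2) / M * ρ ^ 2 * L ^ 5
      + 1 * √((4 * m + 6) / M) * ρ * L ^ (5 / 2 : ℝ)
      = (m + 2) / M * s ^ 2 + √((4 * m + 6) / M) * s := by
    rw [hs2, hs]
    ring
  refine ⟨fun t ht => ?_, fun t ht => ?_, fun hi => ⟨fun t ht => ?_, ?_⟩⟩
  · obtain ⟨n, hn, h1, -⟩ := key t ht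
    rw [hn]
    refine ENNReal.ofReal_le_ofReal (h1.trans (le_of_eq ?_))
    rw [hs2]
    ring
  · obtain ⟨n, -, -, h2⟩ := key t ht
    rw [ew]
    exact (Boussinesq.avgSup_le hL hsol.decaying_w ht).trans (ENNReal.ofReal_le_ofReal h2)
  · exact (hF.burningRate_integral hi ht).1
  · rw [add_assoc, ew]
    set K₃ := s * √(2 * (m + 2) * √Q / M) with hK₃
    set K₄ := s * √(2 * (m + 1) * c / M) + √Q with hK₄
    set W := (m + 2) / M * s ^ 2 + √((4 * m + 6) / M) * s with hW
    have hlim : Tendsto (fun t : ℝ =>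
        2 + (W + K₃ / t ^ (1 / 4 : ℝ) + K₄ / t ^ (1 / 2 : ℝ)) + c / t) atTop (𝓝 (2 + W)) := by
      have h1 : Tendsto (fun t : ℝ => K₃ / t ^ (1 / 4 : ℝ)) atTop (𝓝 0) :=
        tendsto_const_nhds.div_atTop (tendsto_rpow_atTop (by norm_num))
      have h2 : Tendsto (fun t : ℝ => K₄ / t ^ (1 / 2 : ℝ)) atTop (𝓝 0) :=
        tendsto_const_nhds.div_atTop (tendsto_rpow_atTop (by norm_num))
      have h3 : Tendsto (fun t : ℝ => c / t) atTop (𝓝 0) :=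
        tendsto_const_nhds.div_atTop tendsto_id
      simpa using (((tendsto_const_nhds (x := W)).add h1).add h2).const_add 2 |>.add h3
    have hlim' := (continuous_coe_real_ereal.tendsto (2 + W)).comp hlim
    rw [← hlim'.limsup_eq]
    refine limsup_le_limsup ?_
    filter_upwards [eventually_gt_atTop 0] with t ht
    obtain ⟨n, -, -, h2⟩ := key t ht
    have h3 := (hF.burningRate_integral hi ht).2
    simp only [Function.comp_apply]
    refine EReal.coe_le_coe_iff.2 ?_
    rw [Boussinesq.avgBurningRate]
    calc 1 / t * ∫ s in (0 : ℝ)..t, Boussinesq.burningRate L T s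
        ≤ 1 / t * (2 * t + Boussinesq.drift w t + c) := by gcongr
      _ = 2 + Boussinesq.drift w t / t + c / t := by field_simp
      _ ≤ _ := by linarith
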